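/- Write $\hat f(\xi)=\int_{\mathbb R}e^{-ix\xi}f(x)\,dx$, and call the operator $f\mapsto \frac1{2\pi}\int_{\mathbb R} e^{ix\xi}m(\xi)\hat f(\xi)\,d\xi$ the Fourier multiplier with symbol $m$. Fix an even function $\psi\in C_0^\infty(\mathbb R)$ with $\psi\ge 0$, $\operatorname{supp}\psi\subset[-\frac32,\frac32]$ and $\psi\equiv 1$ on $[-\frac54,\frac54]$. For $\varepsilon>0$ let $U_\varepsilon(t)=e^{-t(\partial_x^3+\varepsilon\partial_x^5)}$ be the free evolution of the Kawahara equation, that is, the Fourier multiplier with symbol $e^{it(\xi^3-\varepsilon\xi^5)}$; let $D_x^{1/4}$ be the Fourier multiplier with symbol $|\xi|^{1/4}$; and let $P_{A_\varepsilon}$, $P_{B_\varepsilon}$, $P_{\le 2}$ be the Fourier multipliers with symbols $$1-\psi\Big(20\sqrt\varepsilon\big(|\xi|-\sqrt{\tfrac{3}{5\varepsilon}}\big)\Big),\qquad 1-\psi\Big(20\sqrt\varepsilon\big(|\xi|-\sqrt{\tfrac{3}{10\varepsilon}}\big)\Big),\qquad \psi(\xi/2).$$ **Lemma 2.1.** There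 exist $\varepsilon_0>0$ and $C\ge 0$, depending only on $\psi$, such that for all $0<\varepsilon<\varepsilon_0$, all $T\in(0,1]$ and all $\varphi\in\mathcal S(\mathbb R)$, $$\|P_{A_\varepsilon}\partial_xU_\varepsilon(t)\varphi\|_{L^\infty_x(\mathbb R;L^2_t(\mathbb R))}\le C\|\varphi\|_{L^2},$$ $$\|D_x^{1/4}P_{B_\varepsilon}U_\varepsilon(t)\varphi\|_{L^4_t(\mathbb R;L^\infty_x(\mathbb R))}\le C\|\varphi\|_{L^2},$$ $$\|P_{\le 2}U_\varepsilon(t)\varphi\|_{L^2_x(\mathbb R;L^\infty_t([-T,T]))}\le C\|\varphi\|_{L^2}.$$ -/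

import Mathlib

open MeasureTheory FourierTransform
open scoped ENNReal NNReal ContDiff SchwartzMap

noncomputable section

namespace Kawahara

/-- The conditions on the even Littlewood-Paley cut-off `ψ = η₀`. -/
structure IsCutoff (ψ : ℝ → ℝ) : Prop where
  smooth : ContDiff ℝ ∞ ψ
  even : ∀ ξ, ψ (-ξ) = ψ ξ
  nonneg : ∀ ξ, 0 ≤ ψ ξ
  tsupport_subset : tsupport ψ ⊆ Set.Icc (-(3 / 2)) (3 / 2)
  eq_one : ∀ ξ ∈ Set.Icc (-(5 / 4) : ℝ) (5 / 4), ψ ξ = 1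

/-- The Fourier multiplier operator with symbol `m`, i.e. `f ↦ (x ↦ (2π)⁻¹ ∫ e^{ixξ} m(ξ) f̂(ξ) dξ)`
with `f̂(ξ) = ∫ e^{-ixξ} f(x) dx`. Here `m` is a function of the angular frequency (so that
`∂ₓ` has symbol `iξ`), while the Fourier transform `𝓕 f (ξ) = ∫ e^{-2πixξ} f(x) dx` of Mathlib
uses the ordinary frequency; hence the argument `2πξ` of `m`. -/
def fourierMul (m : ℝ → ℂ) (f : ℝ → ℂ) : ℝ → ℂ :=
  𝓕⁻ (fun ξ : ℝ => m (2 * Real.pi * ξ) * 𝓕 f ξ)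

/-- The phase function `φ_ε(ξ) = ξ³ - ε ξ⁵`. -/
def phase (ε ξ : ℝ) : ℝ := ξ ^ 3 - ε * ξ ^ 5

/-- The free evolution `U_ε(t) = e^{-t(∂ₓ³ + ε ∂ₓ⁵)}`; its symbol is
`exp(-t((iξ)³ + ε(iξ)⁵)) = exp(i t φ_ε(ξ))`. -/
def U (ε t : ℝ) : (ℝ → ℂ) → (ℝ → ℂ) :=
  fourierMul fun ξ => Complex.exp (Complex.I * (t * phase ε ξ : ℝ))

/-- The Riesz potential `D_x^s`, with symbol `|ξ|^s`. -/
def D (s : ℝ) : (ℝ → ℂ) → (ℝ → ℂ) :=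
  fourierMul fun ξ => ((|ξ| ^ s : ℝ) : ℂ)

/-- The projector `P_{A_ε}` away from the zeros `|ξ| = √(3/(5ε))` of `φ_ε'`. -/
def PA (ψ : ℝ → ℝ) (ε : ℝ) : (ℝ → ℂ) → (ℝ → ℂ) :=
  fourierMul fun ξ => ((1 - ψ (20 * √ε * (|ξ| - √(3 / (5 * ε)))) : ℝ) : ℂ)

/-- The projector `P_{B_ε}` away from the zeros `|ξ| = √(3/(10ε))` of `φ_ε''`. -/
def PB (ψ : ℝ → ℝ) (ε : ℝ) : (ℝ → ℂ) → (ℝ → ℂ) :=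
  fourierMul fun ξ => ((1 - ψ (20 * √ε * (|ξ| - √(3 / (10 * ε)))) : ℝ) : ℂ)

/-- The low frequency projector `P_{≤ 2^k}`, with symbol `η_{≤ 2^k}(ξ) = ψ(2^{-k} ξ)`. -/
def PLow (ψ : ℝ → ℝ) (k : ℕ) : (ℝ → ℂ) → (ℝ → ℂ) :=
  fourierMul fun ξ => (ψ (ξ / 2 ^ k) : ℂ)

/-- The mixed norm `‖F‖_{L^q_x L^p_t}`, `x ∈ ℝ`, `t ∈ I`, of `F = F(t, x)`. -/
def normLxLt (q p : ℝ≥0∞) (I : Set ℝ) (F : ℝ → ℝ → ℂ) : ℝ≥0∞ :=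
  eLpNorm (fun x => eLpNorm (fun t => F t x) p (volume.restrict I)) q volume

/-- The mixed norm `‖F‖_{L^p_t L^q_x}`, `t ∈ I`, `x ∈ ℝ`, of `F = F(t, x)`. -/
def normLtLx (p q : ℝ≥0∞) (I : Set ℝ) (F : ℝ → ℝ → ℂ) : ℝ≥0∞ :=
  eLpNorm (fun t => eLpNorm (F t) q volume) p (volume.restrict I)

end Kawahara

end

namespace Kawahara

/-! After composing the multipliers, every quantity is an oscillatory integral ∫ e^{i(xξ + t p(ξ))}
m(ξ) c(ξ) dξ, with p(ξ) = ξ³ − εξ⁵ and c the normalized Fourier transform of the datum, whose L²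
norm is at most that of the datum. The three bounds have independent proofs. Their constants involve
ψ only through a bound for |ψ| and |1 − ψ|.

Local smoothing: for fixed x, duality (`lintegral_enorm_rpow_le_of_adjoint` with q = 2) asks for ∫
|p'(ξ)| |∫ e^{itp(ξ)} g(t) dt|² dξ ≲ ‖g‖². On each of the four monotonicity intervals of p this is
the substitution τ = p(ξ) followed by Plancherel in time
(`lintegral_abs_deriv_phase_mul_enorm_sq_le`). On the support of the symbol of P_A one has ξ² ≤ 16
|p'(ξ)|, so |p'| pays for the derivative.

Strichartz: the supremum in x is linearized by a measurable choice x(t). Duality with q = 4 and the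
TT* identity reduce the bound to |t|^{-1/2} decay, uniform in x, of a kernel with amplitude
|ξ|^{1/2}; Hardy-Littlewood-Sobolev from L^{4/3} to L⁴ then closes it. The scaling z = √ε ξ
preserves that amplitude and that decay, so only ε = 1 matters. There the decay holds away from the
inflection point z = √(3/10), which P_B removes. According to the range of z and the sign of x/t, it
comes from a second-derivative van der Corput estimate or from integration by parts without
stationary points.

Maximal function: for |ξ| ≤ 3 and ε < 1 the phase p is bounded, so a time derivative costs a
constant. The fundamental theorem of calculus in t and Plancherel in x suffice. -/

/-! ### Oscillatory integrals on an interval -/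

/-- A weighted second-derivative van der Corput estimate. -/
theorem norm_integral_mul_exp_le_of_deriv_ge {Φ a m m' : ℝ → ℝ} {c d lam : ℝ} (hcd : c ≤ d)
    (hlam : 0 < lam) (ha : ContinuousOn a (Set.Icc c d)) (hm' : ContinuousOn m' (Set.Icc c d))
    (hΦ : ∀ z ∈ Set.Icc c d, HasDerivAt Φ (a z * m z) z)
    (hm : ∀ z ∈ Set.Icc c d, HasDerivAt m (m' z) z) (ha0 : ∀ z ∈ Set.Icc c d, 0 ≤ a z)
    (hle : ∀ z ∈ Set.Icc c d, lam * a z ≤ m' z) :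
    ‖∫ z in c..d, (a z : ℂ) * Complex.exp (Complex.I * (Φ z : ℝ))‖
      ≤ (2 * Real.pi + 1) / √lam := by
  have hIcc : Set.uIcc c d = Set.Icc c d := Set.uIcc_of_le hcd
  have hmc : ContinuousOn m (Set.Icc c d) := fun z hz => (hm z hz).continuousAt.continuousWithinAt
  have hΦc : ContinuousOn Φ (Set.Icc c d) := fun z hz => (hΦ z hz).continuousAt.continuousWithinAt
  have hpos : ∀ z, 0 < m z ^ 2 + lam := fun z => by positivity
  set E : ℝ → ℂ := fun z => Complex.exp (Complex.I * (Φ z : ℝ)) with hE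
  have hEn : ∀ z, ‖E z‖ = 1 := fun z => by
    simp only [hE, mul_comm Complex.I, Complex.norm_exp_ofReal_mul_I]
  have hEc : ContinuousOn E (Set.Icc c d) := by
    apply Continuous.comp_continuousOn Complex.continuous_exp
    exact continuousOn_const.mul (Complex.continuous_ofReal.comp_continuousOn hΦc)
  -- Integration by parts would use 1/m, which blows up at a stationary point. The regularization
  -- m/(m² + λ) is bounded by 1/(2√λ) everywhere, so no neighbourhood of the zero of m has to be cut
  -- out.
  set g : ℝ → ℝ := fun z => m z / (m z ^ 2 + lam) with hg
  set g' : ℝ → ℝ := fun z => m' z * (lam - m z ^ 2) / (m z ^ 2 + lam) ^ 2 with hg'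
  have hgd : ∀ z ∈ Set.Icc c d, HasDerivAt g (g' z) z := by
    intro z hz
    have h1 := (hm z hz).div (((hm z hz).pow 2).add_const lam) (hpos z).ne'
    refine h1.congr_deriv ?_
    simp only [hg', Pi.pow_apply]
    congr 1
    push_cast
    ring
  have hg'c : ContinuousOn g' (Set.Icc c d) := by
    apply ContinuousOn.div (hm'.mul (continuousOn_const.sub (hmc.pow 2)))
      (((hmc.pow 2).add continuousOn_const).pow 2)
    intro z _
    exact pow_ne_zero 2 (hpos z).ne'
  set D : ℝ → ℂ := fun z => E z * (Complex.I * (a z * m z : ℝ)) * g z + E z * g' z with hD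
  have hDd : ∀ z ∈ Set.uIcc c d, HasDerivAt (fun z => E z * (g z : ℂ)) (D z) z := by
    intro z hz
    rw [hIcc] at hz
    have h1 : HasDerivAt E (E z * (Complex.I * (a z * m z : ℝ))) z :=
      ((hΦ z hz).ofReal_comp.const_mul Complex.I).cexp
    exact h1.mul (hgd z hz).ofReal_comp
  have hgc : ContinuousOn g (Set.Icc c d) := fun z hz => (hgd z hz).continuousAt.continuousWithinAt
  have hco : ∀ {f : ℝ → ℝ}, ContinuousOn f (Set.Icc c d) →
      ContinuousOn (fun z => (f z : ℂ)) (Set.Icc c d) :=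
    fun h => Complex.continuous_ofReal.comp_continuousOn h
  have hDc : ContinuousOn D (Set.Icc c d) :=
    ((hEc.mul (continuousOn_const.mul (hco (ha.mul hmc)))).mul (hco hgc)).add (hEc.mul (hco hg'c))
  have hDi : IntervalIntegrable D volume c d := by
    apply ContinuousOn.intervalIntegrable; rwa [hIcc]
  have hFTC := intervalIntegral.integral_eq_sub_of_hasDerivAt hDd hDi
  -- The error left by the regularization: a·m·g = a − aλ/(m² + λ). Since λa ≤ m', both this defect
  -- and g' are at most m'/(m² + λ) in modulus.
  set r : ℝ → ℂ := fun z => E z * (Complex.I * (a z * (lam / (m z ^ 2 + lam)) : ℝ) - g' z) with hr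
  have hrc : ContinuousOn r (Set.Icc c d) := by
    refine hEc.mul ((continuousOn_const.mul (hco (ha.mul ?_))).sub (hco hg'c))
    exact continuousOn_const.div ((hmc.pow 2).add continuousOn_const) fun z _ => (hpos z).ne'
  have hri : IntervalIntegrable r volume c d := by
    apply ContinuousOn.intervalIntegrable; rwa [hIcc]
  have hsplit : Complex.I * ∫ z in c..d, (a z : ℂ) * E z
      = (E d * g d - E c * g c) + ∫ z in c..d, r z := by
    rw [← hFTC, ← intervalIntegral.integral_add hDi hri, ← intervalIntegral.integral_const_mul]
    apply intervalIntegral.integral_congr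
    intro z _
    have h2 : m z * g z + lam / (m z ^ 2 + lam) = 1 := by
      simp only [hg]
      have := (hpos z).ne'
      field_simp
    have h3 : (m z : ℂ) * g z + ((lam / (m z ^ 2 + lam) : ℝ) : ℂ) = 1 := by exact_mod_cast h2
    simp only [hD, hr]
    push_cast at h3 ⊢
    linear_combination (-(E z * Complex.I * a z)) * h3
  set s := √lam with hs
  have hs0 : 0 < s := Real.sqrt_pos.2 hlam
  have hss : s ^ 2 = lam := Real.sq_sqrt hlam.le
  have hgb : ∀ z, |g z| ≤ 1 / (2 * s) := by
    intro z
    simp only [hg, abs_div, abs_of_pos (hpos z)]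
    rw [div_le_div_iff₀ (hpos z) (by positivity), ← hss, ← sq_abs (m z)]
    nlinarith [sq_nonneg (|m z| - s)]
  have hbd : ‖E d * g d - E c * g c‖ ≤ 1 / s := by
    refine (norm_sub_le _ _).trans ?_
    rw [norm_mul, norm_mul, hEn, hEn, Complex.norm_real, Complex.norm_real, Real.norm_eq_abs,
      Real.norm_eq_abs]
    have := hgb c
    have := hgb d
    have : 1 / s = 1 / (2 * s) + 1 / (2 * s) := by field_simp; norm_num
    linarith
  -- The majorant is an exact derivative, of (2/√λ) arctan(m/√λ), so its integral is at most 2π/√λ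
  -- however long the interval is.
  set A' : ℝ → ℝ := fun z => 2 * (m' z / (m z ^ 2 + lam)) with hA'
  have hAd : ∀ z ∈ Set.uIcc c d, HasDerivAt (fun z => 2 / s * Real.arctan (m z / s)) (A' z) z := by
    intro z hz
    rw [hIcc] at hz
    have h1 := (((hm z hz).div_const s).arctan).const_mul (2 / s)
    refine h1.congr_deriv ?_
    simp only [hA']
    have := (hpos z).ne'
    rw [← hss] at this ⊢
    have h5 : 1 + (m z / s) ^ 2 = (m z ^ 2 + s ^ 2) / s ^ 2 := by field_simp; ring
    rw [h5]
    field_simp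
  have hA'c : ContinuousOn A' (Set.Icc c d) :=
    continuousOn_const.mul (hm'.div ((hmc.pow 2).add continuousOn_const) fun z _ => (hpos z).ne')
  have hA'i : IntervalIntegrable A' volume c d := by
    apply ContinuousOn.intervalIntegrable; rwa [hIcc]
  have hAF := intervalIntegral.integral_eq_sub_of_hasDerivAt hAd hA'i
  have hrb : ‖∫ z in c..d, r z‖ ≤ ∫ z in c..d, A' z := by
    refine intervalIntegral.norm_integral_le_of_norm_le hcd ?_ hA'i
    refine Filter.Eventually.of_forall fun z hz => ?_
    have hz : z ∈ Set.Icc c d := Set.Ioc_subset_Icc_self hz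
    simp only [hr, norm_mul, hEn, one_mul]
    refine (norm_sub_le _ _).trans ?_
    have hp := hpos z
    have hm0 : 0 ≤ m' z := le_trans (mul_nonneg hlam.le (ha0 z hz)) (hle z hz)
    rw [norm_mul, Complex.norm_I, one_mul, Complex.norm_real, Complex.norm_real, Real.norm_eq_abs,
      Real.norm_eq_abs]
    have e1 : |a z * (lam / (m z ^ 2 + lam))| ≤ m' z / (m z ^ 2 + lam) := by
      rw [abs_of_nonneg (mul_nonneg (ha0 z hz) (by positivity)), mul_div_assoc']
      gcongr
      linarith [hle z hz]
    have e2 : |g' z| ≤ m' z / (m z ^ 2 + lam) := by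
      simp only [hg']
      rw [abs_div, abs_mul, abs_of_nonneg hm0, abs_of_pos (pow_pos hp 2),
        div_le_div_iff₀ (pow_pos hp 2) hp]
      have : |lam - m z ^ 2| ≤ m z ^ 2 + lam := abs_le.2 ⟨by nlinarith [sq_nonneg (m z)],
        by nlinarith [sq_nonneg (m z)]⟩
      calc m' z * |lam - m z ^ 2| * (m z ^ 2 + lam)
          ≤ m' z * (m z ^ 2 + lam) * (m z ^ 2 + lam) := by gcongr
        _ = _ := by ring
    simp only [hA']
    linarith
  have hfin : ∫ z in c..d, A' z ≤ 2 * Real.pi / s := by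
    rw [hAF, ← mul_sub]
    have h1 := Real.arctan_lt_pi_div_two (m d / s)
    have h2 := Real.neg_pi_div_two_lt_arctan (m c / s)
    calc 2 / s * (Real.arctan (m d / s) - Real.arctan (m c / s)) ≤ 2 / s * Real.pi := by
          gcongr; linarith
      _ = _ := by ring
  have hn : ‖∫ z in c..d, (a z : ℂ) * E z‖ = ‖Complex.I * ∫ z in c..d, (a z : ℂ) * E z‖ := by
    rw [norm_mul, Complex.norm_I, one_mul]
  rw [hn, hsplit]
  refine (norm_add_le _ _).trans ?_
  rw [add_div, add_comm]
  exact add_le_add (hrb.trans hfin) hbd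

/-- Complex conjugation flips the phase. This transfers the van der Corput bound to decreasing m,
and later turns negative times into positive ones. -/
theorem norm_integral_mul_exp_neg (Φ a : ℝ → ℝ) (c d : ℝ) :
    ‖∫ z in c..d, (a z : ℂ) * Complex.exp (Complex.I * ((-Φ z : ℝ) : ℂ))‖
      = ‖∫ z in c..d, (a z : ℂ) * Complex.exp (Complex.I * (Φ z : ℝ))‖ := by
  rw [← RCLike.norm_conj (∫ z in c..d, (a z : ℂ) * Complex.exp (Complex.I * (Φ z : ℝ))),
    intervalIntegral, intervalIntegral, map_sub, ← integral_conj, ← integral_conj]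
  congr 3 <;>
  · ext z
    rw [map_mul, ← Complex.exp_conj, map_mul, Complex.conj_I, Complex.conj_ofReal,
      Complex.conj_ofReal]
    push_cast
    ring_nf

theorem norm_integral_mul_exp_le_of_deriv_le {Φ a m m' : ℝ → ℝ} {c d lam : ℝ} (hcd : c ≤ d)
    (hlam : 0 < lam) (ha : ContinuousOn a (Set.Icc c d)) (hm' : ContinuousOn m' (Set.Icc c d))
    (hΦ : ∀ z ∈ Set.Icc c d, HasDerivAt Φ (a z * m z) z)
    (hm : ∀ z ∈ Set.Icc c d, HasDerivAt m (m' z) z) (ha0 : ∀ z ∈ Set.Icc c d, 0 ≤ a z)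
    (hle : ∀ z ∈ Set.Icc c d, m' z ≤ -(lam * a z)) :
    ‖∫ z in c..d, (a z : ℂ) * Complex.exp (Complex.I * (Φ z : ℝ))‖
      ≤ (2 * Real.pi + 1) / √lam := by
  rw [← norm_integral_mul_exp_neg]
  refine norm_integral_mul_exp_le_of_deriv_ge (Φ := fun z => -Φ z) (m := fun z => -m z)
    (m' := fun z => -m' z) hcd hlam ha hm'.neg ?_ (fun z hz => (hm z hz).neg) ha0 ?_
  · intro z hz
    exact (hΦ z hz).neg.congr_deriv (by ring)
  · intro z hz
    linarith [hle z hz]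

theorem intervalIntegral_inv_sq_mul_sqrt_le {c d : ℝ} (hc : 0 < c) (hcd : c ≤ d) :
    IntervalIntegrable (fun z : ℝ => 1 / (z ^ 2 * √z)) volume c d ∧
    ∫ z in c..d, 1 / (z ^ 2 * √z) ≤ 1 / (c * √c) := by
  have hIcc : Set.uIcc c d = Set.Icc c d := Set.uIcc_of_le hcd
  have hpos : ∀ z ∈ Set.Icc c d, 0 < z := fun z hz => hc.trans_le hz.1
  have hi : IntervalIntegrable (fun z : ℝ => 1 / (z ^ 2 * √z)) volume c d := by
    apply ContinuousOn.intervalIntegrable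
    rw [hIcc]
    refine continuousOn_const.div (by fun_prop) fun z hz => ?_
    have := hpos z hz
    positivity
  refine ⟨hi, ?_⟩
  have hd : ∀ z ∈ Set.uIcc c d,
      HasDerivAt (fun z : ℝ => -(2 / 3) * (z * √z)⁻¹) (1 / (z ^ 2 * √z)) z := by
    intro z hz
    rw [hIcc] at hz
    have hz := hpos z hz
    have hs : 0 < √z := Real.sqrt_pos.2 hz
    have h1 := (((hasDerivAt_id z).mul (Real.hasDerivAt_sqrt hz.ne')).inv
      (mul_pos hz hs).ne').const_mul (-(2 / 3) : ℝ)
    refine h1.congr_deriv ?_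
    have h2 : z = √z ^ 2 := (Real.sq_sqrt hz.le).symm
    simp only [id, Pi.mul_apply]
    set s := √z
    rw [h2]
    field_simp
    norm_num
  rw [intervalIntegral.integral_eq_sub_of_hasDerivAt hd hi]
  have h1 : 0 ≤ (d * √d)⁻¹ := by have := hc.trans_le hcd; positivity
  have h2 : 0 ≤ (c * √c)⁻¹ := by positivity
  rw [one_div]
  linarith

/-- Oscillatory integral with amplitude `√z` and no stationary points, away from the origin. -/
theorem norm_integral_sqrt_mul_exp_le_of_one_le {Φ m m' : ℝ → ℝ} {c d τ κ K : ℝ} (hc : 0 < c)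
    (hcd : c ≤ d) (hτ : 0 < τ) (hκ : 0 < κ) (hK : 0 ≤ K) (hc3 : 1 ≤ τ * c ^ 3)
    (hm' : ContinuousOn m' (Set.Icc c d))
    (hΦ : ∀ z ∈ Set.Icc c d, HasDerivAt Φ (√z * m z) z)
    (hm : ∀ z ∈ Set.Icc c d, HasDerivAt m (m' z) z)
    (hlow : ∀ z ∈ Set.Icc c d, κ * τ * (z * √z) ≤ |m z|)
    (hup : ∀ z ∈ Set.Icc c d, |m' z| * z ≤ K * |m z|) :
    ‖∫ z in c..d, (√z : ℂ) * Complex.exp (Complex.I * (Φ z : ℝ))‖ ≤ (2 + K) / κ / √τ := by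
  have hIcc : Set.uIcc c d = Set.Icc c d := Set.uIcc_of_le hcd
  have hpos : ∀ z ∈ Set.Icc c d, 0 < z := fun z hz => hc.trans_le hz.1
  have hzs : ∀ z ∈ Set.Icc c d, 0 < κ * τ * (z * √z) := fun z hz => by
    have := hpos z hz
    positivity
  have hmpos : ∀ z ∈ Set.Icc c d, 0 < |m z| := fun z hz => (hzs z hz).trans_le (hlow z hz)
  have hm0 : ∀ z ∈ Set.Icc c d, m z ≠ 0 := fun z hz => abs_pos.1 (hmpos z hz)
  have hmc : ContinuousOn m (Set.Icc c d) := fun z hz => (hm z hz).continuousAt.continuousWithinAt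
  have hΦc : ContinuousOn Φ (Set.Icc c d) := fun z hz => (hΦ z hz).continuousAt.continuousWithinAt
  set E : ℝ → ℂ := fun z => Complex.exp (Complex.I * (Φ z : ℝ)) with hE
  have hEn : ∀ z, ‖E z‖ = 1 := fun z => by
    simp only [hE, mul_comm Complex.I, Complex.norm_exp_ofReal_mul_I]
  have hEc : ContinuousOn E (Set.Icc c d) := by
    apply Continuous.comp_continuousOn Complex.continuous_exp
    exact continuousOn_const.mul (Complex.continuous_ofReal.comp_continuousOn hΦc)
  set g : ℝ → ℝ := fun z => (m z)⁻¹ with hg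
  set g' : ℝ → ℝ := fun z => -m' z / m z ^ 2 with hg'
  have hgd : ∀ z ∈ Set.Icc c d, HasDerivAt g (g' z) z := fun z hz => (hm z hz).inv (hm0 z hz)
  have hg'c : ContinuousOn g' (Set.Icc c d) :=
    hm'.neg.div (hmc.pow 2) fun z hz => pow_ne_zero 2 (hm0 z hz)
  have hgc : ContinuousOn g (Set.Icc c d) := fun z hz => (hgd z hz).continuousAt.continuousWithinAt
  have hco : ∀ {f : ℝ → ℝ}, ContinuousOn f (Set.Icc c d) →
      ContinuousOn (fun z => (f z : ℂ)) (Set.Icc c d) :=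
    fun h => Complex.continuous_ofReal.comp_continuousOn h
  set D : ℝ → ℂ := fun z => E z * (Complex.I * (√z * m z : ℝ)) * g z + E z * g' z with hD
  have hDd : ∀ z ∈ Set.uIcc c d, HasDerivAt (fun z => E z * (g z : ℂ)) (D z) z := by
    intro z hz
    rw [hIcc] at hz
    have h1 : HasDerivAt E (E z * (Complex.I * (√z * m z : ℝ))) z :=
      ((hΦ z hz).ofReal_comp.const_mul Complex.I).cexp
    exact h1.mul (hgd z hz).ofReal_comp
  have hDc : ContinuousOn D (Set.Icc c d) :=
    ((hEc.mul (continuousOn_const.mul (hco (Real.continuous_sqrt.continuousOn.mul hmc)))).mul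
      (hco hgc)).add (hEc.mul (hco hg'c))
  have hDi : IntervalIntegrable D volume c d := by
    apply ContinuousOn.intervalIntegrable; rwa [hIcc]
  have hri : IntervalIntegrable (fun z => E z * (g' z : ℂ)) volume c d := by
    apply ContinuousOn.intervalIntegrable; rw [hIcc]; exact hEc.mul (hco hg'c)
  have hFTC := intervalIntegral.integral_eq_sub_of_hasDerivAt hDd hDi
  have hsplit : Complex.I * ∫ z in c..d, (√z : ℂ) * E z
      = (E d * g d - E c * g c) - ∫ z in c..d, E z * (g' z : ℂ) := by
    rw [← hFTC, ← intervalIntegral.integral_sub hDi hri, ← intervalIntegral.integral_const_mul]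
    apply intervalIntegral.integral_congr
    intro z hz
    rw [hIcc] at hz
    have h3 : (m z : ℂ) * g z = 1 := by
      simp only [hg]
      exact_mod_cast mul_inv_cancel₀ (hm0 z hz)
    simp only [hD]
    push_cast
    linear_combination (-(E z * Complex.I * √z)) * h3
  have hcs : 0 < c * √c := by positivity
  -- The square of the right side is τ² c³ ≥ τ, because τ c³ ≥ 1.
  have hτc : √τ ≤ τ * (c * √c) := by
    have hsc : √c ^ 2 = c := Real.sq_sqrt hc.le
    have : (c * √c) ^ 2 = c ^ 3 := by rw [mul_pow, hsc]; ring
    apply Real.sqrt_le_iff.2 ⟨by positivity, ?_⟩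
    rw [mul_pow, this]
    nlinarith
  have hst : 0 < √τ := Real.sqrt_pos.2 hτ
  have hgb : ∀ z ∈ Set.Icc c d, |g z| ≤ 1 / κ / √τ := by
    intro z hz
    simp only [hg, abs_inv]
    rw [div_div, ← one_div]
    apply one_div_le_one_div_of_le (by positivity)
    refine le_trans ?_ (hlow z hz)
    have : c * √c ≤ z * √z := mul_le_mul hz.1 (Real.sqrt_le_sqrt hz.1) (by positivity)
      (hpos z hz).le
    calc κ * √τ ≤ κ * (τ * (c * √c)) := by gcongr
      _ ≤ κ * (τ * (z * √z)) := by gcongr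
      _ = _ := by ring
  have hbd : ‖E d * g d - E c * g c‖ ≤ 2 / κ / √τ := by
    refine (norm_sub_le _ _).trans ?_
    rw [norm_mul, norm_mul, hEn, hEn, Complex.norm_real, Complex.norm_real, Real.norm_eq_abs,
      Real.norm_eq_abs]
    have h1 := hgb c (Set.left_mem_Icc.2 hcd)
    have h2 := hgb d (Set.right_mem_Icc.2 hcd)
    have : 2 / κ / √τ = 1 / κ / √τ + 1 / κ / √τ := by ring
    linarith
  obtain ⟨hpi, hpb⟩ := intervalIntegral_inv_sq_mul_sqrt_le hc hcd
  -- Here |g'| = |m'|/m² ≤ K/(z|m|) ≤ K/(κτ z^{5/2}), which is integrable up to infinity with tail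
  -- of size c^{-3/2}.
  have hrb : ‖∫ z in c..d, E z * (g' z : ℂ)‖ ≤ ∫ z in c..d, K / (κ * τ) * (1 / (z ^ 2 * √z)) := by
    refine intervalIntegral.norm_integral_le_of_norm_le hcd ?_ (hpi.const_mul _)
    refine Filter.Eventually.of_forall fun z hz => ?_
    have hz : z ∈ Set.Icc c d := Set.Ioc_subset_Icc_self hz
    have hz0 := hpos z hz
    have hmz := hmpos z hz
    rw [norm_mul, hEn, one_mul, Complex.norm_real, Real.norm_eq_abs]
    simp only [hg']
    rw [abs_div, abs_neg, abs_pow]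
    calc |m' z| / |m z| ^ 2 ≤ (K * |m z| / z) / |m z| ^ 2 := by
          gcongr
          rw [le_div_iff₀ hz0]
          exact hup z hz
      _ = K / z * (1 / |m z|) := by field_simp
      _ ≤ K / z * (1 / (κ * τ * (z * √z))) := by
          have := hzs z hz
          have := hlow z hz
          gcongr
      _ = _ := by field_simp
  have hfin : ∫ z in c..d, K / (κ * τ) * (1 / (z ^ 2 * √z)) ≤ K / κ / √τ := by
    rw [intervalIntegral.integral_const_mul]
    calc K / (κ * τ) * ∫ z in c..d, (1 / (z ^ 2 * √z)) ≤ K / (κ * τ) * (1 / (c * √c)) := by gcongr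
      _ = K / κ * (1 / (τ * (c * √c))) := by field_simp
      _ ≤ K / κ * (1 / √τ) := by gcongr
      _ = _ := by ring
  have hn : ‖∫ z in c..d, (√z : ℂ) * E z‖ = ‖Complex.I * ∫ z in c..d, (√z : ℂ) * E z‖ := by
    rw [norm_mul, Complex.norm_I, one_mul]
  rw [hn, hsplit]
  refine (norm_sub_le _ _).trans ?_
  rw [add_div, add_div]
  exact add_le_add hbd (hrb.trans hfin)

/-- Oscillatory integral with amplitude `√z` and no stationary points. -/
theorem norm_integral_sqrt_mul_exp_le {Φ m m' : ℝ → ℝ} {c d τ κ K : ℝ} (hc : 0 < c)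
    (hcd : c ≤ d) (hτ : 0 < τ) (hκ : 0 < κ) (hK : 0 ≤ K)
    (hm' : ContinuousOn m' (Set.Icc c d))
    (hΦ : ∀ z ∈ Set.Icc c d, HasDerivAt Φ (√z * m z) z)
    (hm : ∀ z ∈ Set.Icc c d, HasDerivAt m (m' z) z)
    (hlow : ∀ z ∈ Set.Icc c d, κ * τ * (z * √z) ≤ |m z|)
    (hup : ∀ z ∈ Set.Icc c d, |m' z| * z ≤ K * |m z|) :
    ‖∫ z in c..d, (√z : ℂ) * Complex.exp (Complex.I * (Φ z : ℝ))‖ ≤ (1 + (2 + K) / κ) / √τ := by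
  have hst : 0 < √τ := Real.sqrt_pos.2 hτ
  have hΦc : ContinuousOn Φ (Set.Icc c d) := fun z hz => (hΦ z hz).continuousAt.continuousWithinAt
  have hEc : ContinuousOn (fun z => (√z : ℂ) * Complex.exp (Complex.I * (Φ z : ℝ)))
      (Set.Icc c d) := by
    refine ContinuousOn.mul (by fun_prop) ?_
    apply Continuous.comp_continuousOn Complex.continuous_exp
    exact continuousOn_const.mul (Complex.continuous_ofReal.comp_continuousOn hΦc)
  -- the trivial bound near the origin
  have hsmall : ∀ e, c ≤ e → e ≤ d → τ * e ^ 3 ≤ 1 →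
      ‖∫ z in c..e, (√z : ℂ) * Complex.exp (Complex.I * (Φ z : ℝ))‖ ≤ 1 / √τ := by
    intro e hce hed he
    have he0 : 0 < e := hc.trans_le hce
    have h1 : ‖∫ z in c..e, (√z : ℂ) * Complex.exp (Complex.I * (Φ z : ℝ))‖ ≤ √e * |e - c| := by
      refine intervalIntegral.norm_integral_le_of_norm_le_const fun z hz => ?_
      rw [Set.uIoc_of_le hce] at hz
      rw [norm_mul, mul_comm Complex.I, Complex.norm_exp_ofReal_mul_I, mul_one, Complex.norm_real,
        Real.norm_of_nonneg (Real.sqrt_nonneg _)]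
      exact Real.sqrt_le_sqrt hz.2
    refine h1.trans ?_
    rw [abs_of_nonneg (by linarith), le_div_iff₀ hst]
    have h2 : √e * (e - c) * √τ ≤ √e * e * √τ := by gcongr; linarith
    refine h2.trans ?_
    have h3 : (√e * e * √τ) ^ 2 ≤ 1 := by
      rw [mul_pow, mul_pow, Real.sq_sqrt he0.le, Real.sq_sqrt hτ.le]
      calc e * e ^ 2 * τ = τ * e ^ 3 := by ring
        _ ≤ 1 := he
    exact (sq_le_one_iff₀ (by positivity)).1 h3
  have hlarge : ∀ e, c ≤ e → e ≤ d → 1 ≤ τ * e ^ 3 →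
      ‖∫ z in e..d, (√z : ℂ) * Complex.exp (Complex.I * (Φ z : ℝ))‖ ≤ (2 + K) / κ / √τ := by
    intro e hce hed he
    have hsub : Set.Icc e d ⊆ Set.Icc c d := Set.Icc_subset_Icc_left hce
    exact norm_integral_sqrt_mul_exp_le_of_one_le (hc.trans_le hce) hed hτ hκ hK he
      (hm'.mono hsub) (fun z hz => hΦ z (hsub hz)) (fun z hz => hm z (hsub hz))
      (fun z hz => hlow z (hsub hz)) (fun z hz => hup z (hsub hz))
  have hp1 : 0 ≤ 1 / √τ := by positivity
  have hp2 : 0 ≤ (2 + K) / κ / √τ := by positivity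
  rw [add_div]
  rcases le_total 1 (τ * c ^ 3) with h | h
  · linarith [hlarge c le_rfl hcd h]
  rcases le_total (τ * d ^ 3) 1 with h' | h'
  · linarith [hsmall d hcd le_rfl h']
  -- The split point τe³ = 1 balances the two bounds: the trivial one, e^{3/2}, equals τ^{-1/2}
  -- there, and the nonstationary one starts to apply.
  obtain ⟨e, he, hee⟩ : (1 : ℝ) ∈ (fun z => τ * z ^ 3) '' Set.Icc c d :=
    intermediate_value_Icc hcd (by fun_prop) ⟨h, h'⟩
  have hi : ∀ u v, c ≤ u → u ≤ v → v ≤ d → IntervalIntegrable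
      (fun z => (√z : ℂ) * Complex.exp (Complex.I * (Φ z : ℝ))) volume u v := by
    intro u v hu huv hv
    apply ContinuousOn.intervalIntegrable
    rw [Set.uIcc_of_le huv]
    exact hEc.mono (Set.Icc_subset_Icc hu hv)
  rw [← intervalIntegral.integral_add_adjacent_intervals (hi c e le_rfl he.1 he.2)
    (hi e d he.1 he.2 le_rfl)]
  exact (norm_add_le _ _).trans (add_le_add (hsmall e he.1 he.2 hee.le) (hlarge e he.1 he.2 hee.ge))

/-! ### Dispersive kernel bounds for the rescaled phase -/

/-- The derivative of the phase `x z + t (z ^ 3 - z ^ 5)` with `x = t * w`. -/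
theorem hasDerivAt_rescaled_phase (t w z : ℝ) :
    HasDerivAt (fun z : ℝ => t * w * z + t * phase 1 z) (t * (w + 3 * z ^ 2 - 5 * z ^ 4)) z := by
  have h1 := ((hasDerivAt_id z).const_mul (t * w)).add
    (((hasDerivAt_pow 3 z).sub ((hasDerivAt_pow 5 z).const_mul 1)).const_mul t)
  refine (h1.congr_deriv ?_).congr_of_eventuallyEq (Filter.Eventually.of_forall fun y => ?_)
  · push_cast; ring
  · simp [phase]

/-- With amplitude √z the relevant m is the phase derivative divided by √z, so it is the sign of its
derivative, not of the second derivative of the phase, that matters. For w = 0 it vanishes at z² =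
9/35, slightly below the inflection point z² = 3/10. -/
theorem hasDerivAt_phase_deriv_div_sqrt (t w : ℝ) {z : ℝ} (hz : 0 < z) :
    HasDerivAt (fun z : ℝ => t * (w + 3 * z ^ 2 - 5 * z ^ 4) / √z)
      (t * (-w + 9 * z ^ 2 - 35 * z ^ 4) / (2 * (z * √z))) z := by
  have hs : 0 < √z := Real.sqrt_pos.2 hz
  have h1 := (((((hasDerivAt_pow 2 z).const_mul 3).const_add w).sub
    ((hasDerivAt_pow 4 z).const_mul 5)).const_mul t).div (Real.hasDerivAt_sqrt hz.ne') hs.ne'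
  refine h1.congr_deriv ?_
  have h2 : z = √z ^ 2 := (Real.sq_sqrt hz.le).symm
  push_cast
  set s := √z
  simp only [Pi.sub_apply]
  rw [h2]
  field_simp
  ring

/-- A common constant for all ranges: 3/10 is the smallest rate that occurs, in the low range, and
(2π + 1)/√0.3 is below 14. -/
theorem two_pi_add_one_div_sqrt_mul_le {t k : ℝ} (ht : 0 < t) (hk : 3 / 10 ≤ k) :
    (2 * Real.pi + 1) / √(k * t) ≤ 14 / √t := by
  have hk0 : 0 < k := by linarith
  rw [Real.sqrt_mul hk0.le, ← div_div]
  have hst : 0 < √t := Real.sqrt_pos.2 ht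
  gcongr
  rw [div_le_iff₀ (Real.sqrt_pos.2 hk0)]
  have h1 : 0.547 ≤ √k := Real.le_sqrt_of_sq_le (by norm_num; linarith)
  have h2 := Real.pi_lt_d2
  nlinarith

/-- The sign of w decides. For w ≤ 0 a stationary point may exist, but −w only helps m', and 9 −
35z² ≥ 3/5 gives m' ≥ (3/10) t √z. For w > 0 the derivative w + 3z² − 5z⁴ ≥ w + (9/5) z² has no
zero, and integration by parts applies. The endpoint 0.486 lies just above √(3/10) − 1/16, the edge
of the window removed by P_B, and still below √(9/35). -/
theorem norm_kernel_low_le {t w c d : ℝ} (ht : 0 < t) (hc : 0 < c) (hcd : c ≤ d)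
    (hd : d ≤ 0.486) :
    ‖∫ z in c..d, (√z : ℂ) * Complex.exp (Complex.I * ((t * w * z + t * phase 1 z : ℝ) : ℂ))‖
      ≤ 14 / √t := by
  have hpos : ∀ z ∈ Set.Icc c d, 0 < z := fun z hz => hc.trans_le hz.1
  have hz2 : ∀ z ∈ Set.Icc c d, z ^ 2 ≤ 0.2362 := fun z hz => by
    have := hpos z hz
    have := hz.2
    nlinarith
  have hΦ : ∀ z ∈ Set.Icc c d, HasDerivAt (fun z : ℝ => t * w * z + t * phase 1 z)
      (√z * (t * (w + 3 * z ^ 2 - 5 * z ^ 4) / √z)) z := fun z hz => by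
    have := Real.sqrt_pos.2 (hpos z hz)
    exact (hasDerivAt_rescaled_phase t w z).congr_deriv (by field_simp)
  have hm : ∀ z ∈ Set.Icc c d, _ := fun z hz => hasDerivAt_phase_deriv_div_sqrt t w (hpos z hz)
  have hm' : ContinuousOn (fun z => t * (-w + 9 * z ^ 2 - 35 * z ^ 4) / (2 * (z * √z)))
      (Set.Icc c d) := by
    refine ContinuousOn.div (by fun_prop) (by fun_prop) fun z hz => ?_
    have := hpos z hz
    positivity
  rcases le_or_gt w 0 with hw | hw
  · refine (norm_integral_mul_exp_le_of_deriv_ge hcd (lam := 3 / 10 * t) (by positivity)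
      Real.continuous_sqrt.continuousOn hm' hΦ hm (fun z _ => Real.sqrt_nonneg z) ?_).trans
      (two_pi_add_one_div_sqrt_mul_le ht le_rfl)
    intro z hz
    have hz0 := hpos z hz
    have h2 := hz2 z hz
    have hs : √z * √z = z := Real.mul_self_sqrt hz0.le
    rw [le_div_iff₀ (by positivity)]
    have : 3 / 10 * t * √z * (2 * (z * √z)) = t * (3 / 5 * z ^ 2) := by
      calc _ = t * (3 / 5 * z * (√z * √z)) := by ring
        _ = _ := by rw [hs]; ring
    rw [this]
    gcongr
    nlinarith [sq_nonneg z]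
  · refine (norm_integral_sqrt_mul_exp_le hc hcd (τ := t) (κ := 9 / 5) (K := 5 / 2) ht (by norm_num)
      (by norm_num) hm' hΦ hm ?_ ?_).trans ?_
    · intro z hz
      have hz0 := hpos z hz
      have h2 := hz2 z hz
      have hs : √z * √z = z := Real.mul_self_sqrt hz0.le
      refine le_trans ?_ (le_abs_self _)
      rw [le_div_iff₀ (by positivity)]
      calc 9 / 5 * t * (z * √z) * √z = t * (9 / 5 * z * (√z * √z)) := by ring
        _ = t * (9 / 5 * z ^ 2) := by rw [hs]; ring
        _ ≤ _ := by gcongr; nlinarith [sq_nonneg z]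
    · intro z hz
      have hz0 := hpos z hz
      have h2 := hz2 z hz
      have hsz : 0 < √z := Real.sqrt_pos.2 hz0
      rw [abs_div, abs_div, abs_of_pos (show 0 < 2 * (z * √z) by positivity), abs_mul t, abs_mul t,
        abs_of_pos ht, abs_of_pos hsz]
      have e1 : |-w + 9 * z ^ 2 - 35 * z ^ 4| ≤ w + 9 * z ^ 2 :=
        abs_le.2 ⟨by nlinarith [sq_nonneg z], by nlinarith [sq_nonneg z, sq_nonneg (z ^ 2)]⟩
      have e2 : w + 9 / 5 * z ^ 2 ≤ |w + 3 * z ^ 2 - 5 * z ^ 4| :=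
        le_trans (by nlinarith [sq_nonneg z]) (le_abs_self _)
      calc t * |-w + 9 * z ^ 2 - 35 * z ^ 4| / (2 * (z * √z)) * z
          = t * |-w + 9 * z ^ 2 - 35 * z ^ 4| / √z / 2 := by field_simp
        _ ≤ t * (w + 9 * z ^ 2) / √z / 2 := by gcongr
        _ ≤ t * (5 * (w + 9 / 5 * z ^ 2)) / √z / 2 := by gcongr; linarith
        _ ≤ t * (5 * |w + 3 * z ^ 2 - 5 * z ^ 4|) / √z / 2 := by gcongr
        _ = _ := by ring
    · gcongr
      norm_num

/-- Beyond the inflection point 6z − 20z³ ≤ −4/5, so the unweighted second-derivative test works for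
either sign of w. Amplitude 1 is enough because the bound serves on [0.61, 1], where √z ≤ 1. The
endpoint 0.61 lies just below √(3/10) + 1/16. -/
theorem norm_kernel_mid_le {t w c d : ℝ} (ht : 0 < t) (hc : 0.61 ≤ c) (hcd : c ≤ d) :
    ‖∫ z in c..d, ((1 : ℝ) : ℂ) *
      Complex.exp (Complex.I * ((t * w * z + t * phase 1 z : ℝ) : ℂ))‖ ≤ 14 / √t := by
  refine (norm_integral_mul_exp_le_of_deriv_le hcd (lam := 4 / 5 * t) (a := fun _ => 1)
    (m := fun z => t * (w + 3 * z ^ 2 - 5 * z ^ 4)) (m' := fun z => t * (6 * z - 20 * z ^ 3))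
    (by positivity) continuousOn_const (by fun_prop)
    (fun z _ => (hasDerivAt_rescaled_phase t w z).congr_deriv (by ring)) ?_
    (fun _ _ => zero_le_one) ?_).trans (two_pi_add_one_div_sqrt_mul_le ht (by norm_num))
  · intro z _
    have h1 := ((((hasDerivAt_pow 2 z).const_mul 3).const_add w).sub
      ((hasDerivAt_pow 4 z).const_mul 5)).const_mul t
    refine h1.congr_deriv ?_
    push_cast
    ring
  · intro z hz
    have hz : 0.61 ≤ z := hc.trans hz.1
    have h2 : 0.372 ≤ z ^ 2 := by nlinarith
    have : 6 * z - 20 * z ^ 3 ≤ -(4 / 5) := by nlinarith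
    nlinarith

/-- The quartic term dominates, so the signs of w exchange their roles compared with the low range:
w ≥ 0 is the case for van der Corput, with m' ≤ −t√z, while for w < 0 the phase derivative is at
most t(w − 2z⁴) and never vanishes. -/
theorem norm_kernel_high_le {t w c d : ℝ} (ht : 0 < t) (hc : 1 ≤ c) (hcd : c ≤ d) :
    ‖∫ z in c..d, (√z : ℂ) * Complex.exp (Complex.I * ((t * w * z + t * phase 1 z : ℝ) : ℂ))‖
      ≤ 14 / √t := by
  have hone : ∀ z ∈ Set.Icc c d, 1 ≤ z := fun z hz => hc.trans hz.1
  have hpos : ∀ z ∈ Set.Icc c d, 0 < z := fun z hz => zero_lt_one.trans_le (hone z hz)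
  have hz2 : ∀ z ∈ Set.Icc c d, 1 ≤ z ^ 2 := fun z hz => by
    nlinarith [hone z hz]
  have hΦ : ∀ z ∈ Set.Icc c d, HasDerivAt (fun z : ℝ => t * w * z + t * phase 1 z)
      (√z * (t * (w + 3 * z ^ 2 - 5 * z ^ 4) / √z)) z := fun z hz => by
    have := Real.sqrt_pos.2 (hpos z hz)
    exact (hasDerivAt_rescaled_phase t w z).congr_deriv (by field_simp)
  have hm : ∀ z ∈ Set.Icc c d, _ := fun z hz => hasDerivAt_phase_deriv_div_sqrt t w (hpos z hz)
  have hm' : ContinuousOn (fun z => t * (-w + 9 * z ^ 2 - 35 * z ^ 4) / (2 * (z * √z)))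
      (Set.Icc c d) := by
    refine ContinuousOn.div (by fun_prop) (by fun_prop) fun z hz => ?_
    have := hpos z hz
    positivity
  rcases le_or_gt 0 w with hw | hw
  · refine (norm_integral_mul_exp_le_of_deriv_le hcd (lam := 1 * t) (by positivity)
      Real.continuous_sqrt.continuousOn hm' hΦ hm (fun z _ => Real.sqrt_nonneg z) ?_).trans
      (two_pi_add_one_div_sqrt_mul_le ht (by norm_num))
    intro z hz
    have hz0 := hpos z hz
    have h2 := hz2 z hz
    have hs : √z * √z = z := Real.mul_self_sqrt hz0.le
    rw [div_le_iff₀ (by positivity)]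
    have : -(1 * t * √z) * (2 * (z * √z)) = t * (-(2 * z ^ 2)) := by
      calc _ = t * (-(2 * z * (√z * √z))) := by ring
        _ = _ := by rw [hs]; ring
    rw [this]
    gcongr
    nlinarith [sq_nonneg z]
  · refine (norm_integral_sqrt_mul_exp_le (by linarith) hcd (τ := t) (κ := 2) (K := 9) ht
      (by norm_num) (by norm_num) hm' hΦ hm ?_ ?_).trans ?_
    · intro z hz
      have hz0 := hpos z hz
      have h2 := hz2 z hz
      have hs : √z * √z = z := Real.mul_self_sqrt hz0.le
      refine le_trans ?_ (neg_le_abs _)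
      rw [← neg_div, le_div_iff₀ (by positivity), ← mul_neg]
      calc 2 * t * (z * √z) * √z = t * (2 * z * (√z * √z)) := by ring
        _ = t * (2 * z ^ 2) := by rw [hs]; ring
        _ ≤ _ := by gcongr; nlinarith [sq_nonneg z]
    · intro z hz
      have hz0 := hpos z hz
      have h2 := hz2 z hz
      have hsz : 0 < √z := Real.sqrt_pos.2 hz0
      rw [abs_div, abs_div, abs_of_pos (show 0 < 2 * (z * √z) by positivity), abs_mul t, abs_mul t,
        abs_of_pos ht, abs_of_pos hsz]
      have e1 : |-w + 9 * z ^ 2 - 35 * z ^ 4| ≤ -w + 35 * z ^ 4 :=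
        abs_le.2 ⟨by nlinarith [sq_nonneg z], by nlinarith [sq_nonneg z, sq_nonneg (z ^ 2)]⟩
      have e2 : -w + 2 * z ^ 4 ≤ |w + 3 * z ^ 2 - 5 * z ^ 4| :=
        le_trans (by nlinarith [sq_nonneg z]) (neg_le_abs _)
      calc t * |-w + 9 * z ^ 2 - 35 * z ^ 4| / (2 * (z * √z)) * z
          = t * |-w + 9 * z ^ 2 - 35 * z ^ 4| / √z / 2 := by field_simp
        _ ≤ t * (-w + 35 * z ^ 4) / √z / 2 := by gcongr
        _ ≤ t * (18 * (-w + 2 * z ^ 4)) / √z / 2 := by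
            gcongr; nlinarith [sq_nonneg (z ^ 2)]
        _ ≤ t * (18 * |w + 3 * z ^ 2 - 5 * z ^ 4|) / √z / 2 := by gcongr
        _ = _ := by ring
    · gcongr
      norm_num

/-- Rescaling and reflection of the kernel estimates. -/
theorem norm_kernel_rescale_le {a : ℝ → ℝ} {c d B : ℝ}
    (h : ∀ t w : ℝ, 0 < t → ‖∫ z in c..d, (a z : ℂ) *
      Complex.exp (Complex.I * ((t * w * z + t * phase 1 z : ℝ) : ℂ))‖ ≤ B / √t)
    {ε : ℝ} (hε : 0 < ε) (x : ℝ) {t : ℝ} (ht : t ≠ 0) :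
    ‖∫ ξ in (c / √ε)..(d / √ε), ((a (√ε * ξ) / √√ε : ℝ) : ℂ) *
      Complex.exp (Complex.I * ((x * ξ + t * phase ε ξ : ℝ) : ℂ))‖ ≤ B / √|t| := by
  have h0 : ∀ t x : ℝ, t ≠ 0 → ‖∫ z in c..d, (a z : ℂ) *
      Complex.exp (Complex.I * ((x * z + t * phase 1 z : ℝ) : ℂ))‖ ≤ B / √|t| := by
    intro t x ht
    rcases lt_or_gt_of_ne ht with h1 | h1
    · rw [← norm_integral_mul_exp_neg, abs_of_neg h1]
      convert h (-t) (x / t) (by linarith) using 9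
      field_simp
      ring
    · rw [abs_of_pos h1]
      convert h t (x / t) h1 using 9
      field_simp
  set δ := √ε with hδ
  have hδ0 : 0 < δ := Real.sqrt_pos.2 hε
  have hδε : ε = δ ^ 2 := (Real.sq_sqrt hε.le).symm
  have hsd : 0 < √δ := Real.sqrt_pos.2 hδ0
  have hkey := intervalIntegral.integral_comp_mul_left (a := c / δ) (b := d / δ)
    (fun z => (a z : ℂ) *
      Complex.exp (Complex.I * ((x / δ * z + t / δ ^ 3 * phase 1 z : ℝ) : ℂ))) hδ0.ne'
  rw [mul_div_cancel₀ _ hδ0.ne', mul_div_cancel₀ _ hδ0.ne'] at hkey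
  have heq : ∫ ξ in (c / δ)..(d / δ), ((a (δ * ξ) / √δ : ℝ) : ℂ) *
      Complex.exp (Complex.I * ((x * ξ + t * phase ε ξ : ℝ) : ℂ))
      = ((1 / √δ : ℝ) : ℂ) * (δ⁻¹ • ∫ z in c..d, (a z : ℂ) *
      Complex.exp (Complex.I * ((x / δ * z + t / δ ^ 3 * phase 1 z : ℝ) : ℂ))) := by
    rw [← hkey, ← intervalIntegral.integral_const_mul]
    apply intervalIntegral.integral_congr
    intro ξ _
    have : x / δ * (δ * ξ) + t / δ ^ 3 * phase 1 (δ * ξ) = x * ξ + t * phase ε ξ := by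
      rw [hδε, phase, phase]
      field_simp
    simp only [this]
    push_cast
    ring
  rw [heq, norm_mul, norm_smul, Complex.norm_real, Real.norm_of_nonneg (by positivity),
    Real.norm_of_nonneg (by positivity)]
  have ht' : t / δ ^ 3 ≠ 0 := by positivity
  have h2 := h0 (t / δ ^ 3) (x / δ) ht'
  -- The gain δ^{3/2} from the rescaled time cancels δ^{-1} from dξ and δ^{-1/2} from the amplitude.
  -- This exact balance makes the estimate uniform in ε.
  have h3 : √|t / δ ^ 3| = √|t| / (δ * √δ) := by
    rw [abs_div, abs_of_pos (pow_pos hδ0 3), Real.sqrt_div (abs_nonneg t)]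
    congr 1
    rw [show δ ^ 3 = δ ^ 2 * δ by ring, Real.sqrt_mul (by positivity), Real.sqrt_sq hδ0.le]
  rw [h3] at h2
  have hst : 0 < √|t| := Real.sqrt_pos.2 (abs_pos.2 ht)
  calc 1 / √δ * (δ⁻¹ * _) ≤ 1 / √δ * (δ⁻¹ * (B / (√|t| / (δ * √δ)))) := by gcongr
    _ = _ := by field_simp

/-- The phase is odd in ξ, so reflecting ξ amounts to replacing (x, t) by (−x, −t), which leaves the
bound unchanged. -/
theorem norm_kernel_reflect_le {a : ℝ → ℝ} {c d B ε : ℝ}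
    (h : ∀ x t : ℝ, t ≠ 0 → ‖∫ ξ in c..d, (a ξ : ℂ) *
      Complex.exp (Complex.I * ((x * ξ + t * phase ε ξ : ℝ) : ℂ))‖ ≤ B / √|t|)
    (x : ℝ) {t : ℝ} (ht : t ≠ 0) :
    ‖∫ ξ in (-d)..(-c), (a (-ξ) : ℂ) *
      Complex.exp (Complex.I * ((x * ξ + t * phase ε ξ : ℝ) : ℂ))‖ ≤ B / √|t| := by
  have h1 := h (-x) (-t) (neg_ne_zero.2 ht)
  rw [abs_neg] at h1
  rw [← intervalIntegral.integral_comp_neg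
    (fun ξ => (a (-ξ) : ℂ) * Complex.exp (Complex.I * ((x * ξ + t * phase ε ξ : ℝ) : ℂ)))]
  refine le_of_eq_of_le ?_ h1
  congr 2
  ext ξ
  rw [neg_neg, show x * -ξ + t * phase ε (-ξ) = -x * ξ + -t * phase ε ξ by
    simp only [phase]; ring]

/-! ### Hardy-Littlewood-Sobolev with kernel |t − s|^{-1/2} -/

theorem lintegral_Ioo_rpow {A θ : ℝ} (hA : 0 ≤ A) (h1 : θ < 1) :
    ∫⁻ b in Set.Ioo 0 A, ENNReal.ofReal (b ^ (-θ)) = ENNReal.ofReal (A ^ (1 - θ) / (1 - θ)) := by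
  have hi : IntervalIntegrable (fun b : ℝ => b ^ (-θ)) volume 0 A :=
    intervalIntegral.intervalIntegrable_rpow' (by linarith)
  rw [restrict_Ioo_eq_restrict_Ioc, ← ofReal_integral_eq_lintegral_ofReal,
    ← intervalIntegral.integral_of_le hA, integral_rpow (Or.inl (by linarith))]
  · rw [Real.zero_rpow (by linarith), sub_zero]
    congr 2 <;> ring_nf
  · exact (intervalIntegrable_iff_integrableOn_Ioc_of_le hA).1 hi
  · refine (ae_restrict_mem measurableSet_Ioc).mono fun b hb => ?_
    exact Real.rpow_nonneg hb.1.le _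

/-- The `L¹`-norm of the kernel `|s|^{-1/2}` on an interval. -/
theorem lintegral_Ioo_enorm_rpow_neg_half {r : ℝ} (hr : 0 ≤ r) :
    ∫⁻ s in Set.Ioo (-r) r, ‖s‖ₑ ^ (-(1 / 2) : ℝ) = ENNReal.ofReal (4 * √r) := by
  have hpos : ∫⁻ s in Set.Ioo 0 r, ‖s‖ₑ ^ (-(1 / 2) : ℝ) = ENNReal.ofReal (2 * √r) := by
    have h := lintegral_Ioo_rpow (θ := 1 / 2) hr (by norm_num)
    rw [show r ^ (1 - 1 / 2 : ℝ) / (1 - 1 / 2) = 2 * √r by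
      rw [Real.sqrt_eq_rpow]; norm_num; ring] at h
    rw [← h]
    refine setLIntegral_congr_fun measurableSet_Ioo fun s hs => ?_
    rw [← ENNReal.ofReal_rpow_of_pos hs.1, Real.enorm_of_nonneg hs.1.le]
  have hneg : ∫⁻ s in Set.Ioo (-r) 0, ‖s‖ₑ ^ (-(1 / 2) : ℝ) = ENNReal.ofReal (2 * √r) := by
    rw [← hpos]
    have hp : MeasurePreserving (fun s : ℝ => -s) volume volume :=
      Measure.measurePreserving_neg volume
    rw [← hp.setLIntegral_comp_preimage_emb (MeasurableEquiv.neg ℝ).measurableEmbedding]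
    simp
  have hun : Set.Ioo (-r) r =ᵐ[volume] (Set.Ioo (-r) 0 ∪ Set.Ioo 0 r : Set ℝ) := by
    have h0 : ({0}ᶜ : Set ℝ) ∈ ae (volume : Measure ℝ) := by
      simp [mem_ae_iff]
    filter_upwards [h0] with s hs
    have hs : s ≠ 0 := hs
    apply propext
    change s ∈ Set.Ioo (-r) r ↔ s ∈ (Set.Ioo (-r) 0 ∪ Set.Ioo 0 r : Set ℝ)
    simp only [Set.mem_Ioo, Set.mem_union]
    constructor
    · rintro ⟨h1, h2⟩
      rcases lt_or_gt_of_ne hs with h | h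
      · exact Or.inl ⟨h1, h⟩
      · exact Or.inr ⟨h, h2⟩
    · rintro (⟨h1, h2⟩ | ⟨h1, h2⟩)
      · exact ⟨h1, by linarith⟩
      · exact ⟨by linarith, h2⟩
  rw [setLIntegral_congr hun, lintegral_union measurableSet_Ioo, hpos, hneg,
    ← ENNReal.ofReal_add (by positivity) (by positivity)]
  · congr 1; ring
  · rw [Set.disjoint_left]
    rintro s ⟨_, h1⟩ ⟨h2, _⟩
    linarith

/-- A rearrangement argument with r = |S|: the interval of radius r about t contributes at most 4√r,
and off it the kernel is at most r^{-1/2} on a set of measure at most r. Sets of measure zero or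
infinity are trivial. -/
theorem lintegral_enorm_sub_rpow_le (t : ℝ) {S : Set ℝ} :
    ∫⁻ s in S, ‖t - s‖ₑ ^ (-(1 / 2) : ℝ) ≤ 5 * volume S ^ (1 / 2 : ℝ) := by
  rcases eq_or_ne (volume S) ∞ with h | h
  · rw [h, ENNReal.top_rpow_of_pos (by norm_num)]
    simp
  rcases eq_or_ne (volume S) 0 with h0 | h0
  · rw [Measure.restrict_eq_zero.2 h0]
    simp
  set r := (volume S).toReal with hr
  have hr0 : 0 < r := ENNReal.toReal_pos h0 h
  have hvol : volume S = ENNReal.ofReal r := (ENNReal.ofReal_toReal h).symm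
  have hle : ∀ s, ‖t - s‖ₑ ^ (-(1 / 2) : ℝ) ≤
      (Set.Ioo (t - r) (t + r)).indicator (fun s => ‖t - s‖ₑ ^ (-(1 / 2) : ℝ)) s
        + ENNReal.ofReal r ^ (-(1 / 2) : ℝ) := by
    intro s
    by_cases hs : s ∈ Set.Ioo (t - r) (t + r)
    · rw [Set.indicator_of_mem hs]
      exact le_self_add
    · rw [Set.indicator_of_notMem hs, zero_add, ENNReal.rpow_neg, ENNReal.rpow_neg]
      apply ENNReal.inv_le_inv.2
      apply ENNReal.rpow_le_rpow _ (by norm_num)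
      rw [Real.enorm_eq_ofReal_abs]
      apply ENNReal.ofReal_le_ofReal
      by_contra hcon
      rw [not_le, abs_lt] at hcon
      exact hs ⟨by linarith, by linarith⟩
  have hshift : ∫⁻ s in Set.Ioo (t - r) (t + r), ‖t - s‖ₑ ^ (-(1 / 2) : ℝ)
      = ENNReal.ofReal (4 * √r) := by
    rw [← lintegral_Ioo_enorm_rpow_neg_half hr0.le]
    have hp : MeasurePreserving (fun s : ℝ => t - s) volume volume :=
      Measure.measurePreserving_sub_left volume t
    rw [← hp.setLIntegral_comp_preimage_emb (MeasurableEquiv.subLeft t).measurableEmbedding]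
    simp
  calc ∫⁻ s in S, ‖t - s‖ₑ ^ (-(1 / 2) : ℝ)
      ≤ ∫⁻ s in S, ((Set.Ioo (t - r) (t + r)).indicator (fun s => ‖t - s‖ₑ ^ (-(1 / 2) : ℝ)) s
        + ENNReal.ofReal r ^ (-(1 / 2) : ℝ)) := lintegral_mono fun s => hle s
    _ = (∫⁻ s in S, (Set.Ioo (t - r) (t + r)).indicator
          (fun s => ‖t - s‖ₑ ^ (-(1 / 2) : ℝ)) s)
        + ENNReal.ofReal r ^ (-(1 / 2) : ℝ) * volume S := by
        rw [lintegral_add_right _ measurable_const, setLIntegral_const]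
    _ ≤ ENNReal.ofReal (4 * √r) + ENNReal.ofReal (√r) := by
        gcongr
        · refine (setLIntegral_le_lintegral _ _).trans ?_
          rw [lintegral_indicator measurableSet_Ioo, hshift]
        · rw [hvol, ENNReal.ofReal_rpow_of_pos hr0, ← ENNReal.ofReal_mul (by positivity)]
          apply ENNReal.ofReal_le_ofReal
          nth_rewrite 2 [← Real.rpow_one r]
          rw [← Real.rpow_add hr0, Real.sqrt_eq_rpow]
          norm_num
    _ = 5 * volume S ^ (1 / 2 : ℝ) := by
        rw [hvol, ← ENNReal.ofReal_add (by positivity) (by positivity),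
          ENNReal.ofReal_rpow_of_pos hr0, ← Real.sqrt_eq_rpow,
          show (5 : ℝ≥0∞) = ENNReal.ofReal 5 by simp, ← ENNReal.ofReal_mul (by norm_num)]
        congr 1; ring

/-- The diagonal case of the Hardy-Littlewood-Sobolev inequality on the line with kernel
`|t - s|^{-1/2}`. -/
theorem lintegral_lintegral_mul_enorm_sub_rpow_le {f : ℝ → ℝ} (hf : Measurable f)
    (hf0 : ∀ t, 0 ≤ f t) :
    ∫⁻ t, ∫⁻ s, ENNReal.ofReal (f t) * ENNReal.ofReal (f s) * ‖t - s‖ₑ ^ (-(1 / 2) : ℝ)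
      ≤ 30 * (∫⁻ t, ENNReal.ofReal (f t) ^ (4 / 3 : ℝ)) ^ (3 / 2 : ℝ) := by
  set M := ∫⁻ t, ENNReal.ofReal (f t) ^ (4 / 3 : ℝ) with hM
  set κ : ℝ → ℝ → ℝ≥0∞ := fun t s => ‖t - s‖ₑ ^ (-(1 / 2) : ℝ) with hκ
  have hκm : Measurable (Function.uncurry κ) := by
    simp only [hκ, Function.uncurry_def]; fun_prop
  -- the part where the second function is the smaller one
  set P : ℝ → ℝ → ℝ≥0∞ := fun t s =>
    {q : ℝ × ℝ | f q.2 ≤ f q.1}.indicator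
      (fun q => ENNReal.ofReal (f q.1) * ENNReal.ofReal (f q.2) * κ q.1 q.2) (t, s) with hP
  have hset : MeasurableSet {q : ℝ × ℝ | f q.2 ≤ f q.1} :=
    measurableSet_le (hf.comp measurable_snd) (hf.comp measurable_fst)
  have hPm : Measurable (Function.uncurry P) := by
    refine Measurable.indicator ?_ hset
    exact ((hf.comp measurable_fst).ennreal_ofReal.mul
      (hf.comp measurable_snd).ennreal_ofReal).mul hκm
  have hsplit : ∀ t s, ENNReal.ofReal (f t) * ENNReal.ofReal (f s) * κ t s ≤ P t s + P s t := by
    intro t s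
    have hsym : κ t s = κ s t := by simp only [hκ]; rw [← enorm_neg, neg_sub]
    simp only [hP]
    rcases le_total (f s) (f t) with h | h
    · rw [Set.indicator_of_mem (show (t, s) ∈ {q : ℝ × ℝ | f q.2 ≤ f q.1} from h)]
      exact le_self_add
    · rw [Set.indicator_of_mem (show (s, t) ∈ {q : ℝ × ℝ | f q.2 ≤ f q.1} from h)]
      rw [hsym, mul_comm (ENNReal.ofReal (f t))]
      exact le_add_self
  -- Chebyshev in L^{4/3}: |{f > b}| ≤ M b^{-4/3}, and then a square root.
  have hlevel : ∀ b : ℝ, 0 < b →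
      volume {s | b < f s} ^ (1 / 2 : ℝ) ≤ M ^ (1 / 2 : ℝ) * ENNReal.ofReal (b ^ (-(2 / 3) : ℝ)) := by
    intro b hb
    have h1 : ENNReal.ofReal b ^ (4 / 3 : ℝ) * volume {s | b < f s} ≤ M := by
      have hsub : {s | b < f s} ⊆
          {s | ENNReal.ofReal b ^ (4 / 3 : ℝ) ≤ ENNReal.ofReal (f s) ^ (4 / 3 : ℝ)} := fun s hs =>
        ENNReal.rpow_le_rpow (ENNReal.ofReal_le_ofReal (le_of_lt hs)) (by norm_num)
      refine le_trans ?_ (mul_meas_ge_le_lintegral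
        (hf.ennreal_ofReal.pow_const (4 / 3 : ℝ)) (ENNReal.ofReal b ^ (4 / 3 : ℝ)))
      exact mul_le_mul_right (measure_mono hsub) _
    have h2 : ENNReal.ofReal b ^ (4 / 3 : ℝ) ≠ 0 := by
      simp [ENNReal.rpow_eq_zero_iff, hb]
    have h3 : ENNReal.ofReal b ^ (4 / 3 : ℝ) ≠ ⊤ :=
      ENNReal.rpow_ne_top_of_nonneg (by norm_num) ENNReal.ofReal_ne_top
    have h4 : volume {s | b < f s} ≤ M * (ENNReal.ofReal b ^ (4 / 3 : ℝ))⁻¹ := by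
      rw [← div_eq_mul_inv, ENNReal.le_div_iff_mul_le (Or.inl h2) (Or.inl h3), mul_comm]
      exact h1
    refine (ENNReal.rpow_le_rpow h4 (by norm_num)).trans ?_
    rw [ENNReal.mul_rpow_of_nonneg _ _ (by norm_num), ← ENNReal.rpow_neg, ← ENNReal.rpow_mul,
      ENNReal.ofReal_rpow_of_pos hb]
    norm_num
  -- Layer-cake in the smaller value f(s): levels b run only up to f(t), each costs at most 5M^{1/2}
  -- b^{-2/3}, and ∫₀^{f(t)} b^{-2/3} db = 3f(t)^{1/3}. The ordering f(s) ≤ f(t) is what replaces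
  -- interpolation.
  have hinner : ∀ t, ∫⁻ s, P t s ≤
      ENNReal.ofReal (f t) * (15 * M ^ (1 / 2 : ℝ) * ENNReal.ofReal (f t ^ (1 / 3 : ℝ))) := by
    intro t
    have h1 : ∀ s, P t s ≤ ENNReal.ofReal (f t) *
        ∫⁻ b in Set.Ioo 0 (f t), {q : ℝ × ℝ | q.2 < f q.1}.indicator (fun q => κ t q.1) (s, b) := by
      intro s
      simp only [hP]
      by_cases hs : f s ≤ f t
      · rw [Set.indicator_of_mem (show (t, s) ∈ {q : ℝ × ℝ | f q.2 ≤ f q.1} from hs), mul_assoc]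
        gcongr
        calc ENNReal.ofReal (f s) * κ t s = ∫⁻ b in Set.Ioo 0 (f s), κ t s := by
              rw [setLIntegral_const, Real.volume_Ioo, sub_zero, mul_comm]
          _ ≤ ∫⁻ b in Set.Ioo 0 (f s),
              {q : ℝ × ℝ | q.2 < f q.1}.indicator (fun q => κ t q.1) (s, b) := by
              refine setLIntegral_mono' measurableSet_Ioo fun b hb => ?_
              rw [Set.indicator_of_mem (show (s, b) ∈ {q : ℝ × ℝ | q.2 < f q.1} from hb.2)]
          _ ≤ _ := lintegral_mono_set (Set.Ioo_subset_Ioo_right hs)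
      · rw [Set.indicator_of_notMem (show (t, s) ∉ {q : ℝ × ℝ | f q.2 ≤ f q.1} from hs)]
        exact zero_le
    have hm2 : Measurable fun q : ℝ × ℝ =>
        {q : ℝ × ℝ | q.2 < f q.1}.indicator (fun q => κ t q.1) q := by
      refine Measurable.indicator ?_ (measurableSet_lt measurable_snd (hf.comp measurable_fst))
      simp only [hκ]; fun_prop
    refine (lintegral_mono h1).trans ?_
    rw [lintegral_const_mul _ (Measurable.lintegral_prod_right' hm2)]
    gcongr
    rw [lintegral_lintegral_swap hm2.aemeasurable]
    calc ∫⁻ b in Set.Ioo 0 (f t), ∫⁻ s,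
          {q : ℝ × ℝ | q.2 < f q.1}.indicator (fun q => κ t q.1) (s, b)
        ≤ ∫⁻ b in Set.Ioo 0 (f t),
            5 * M ^ (1 / 2 : ℝ) * ENNReal.ofReal (b ^ (-(2 / 3) : ℝ)) := by
          refine setLIntegral_mono' measurableSet_Ioo fun b hb => ?_
          have : ∀ s, {q : ℝ × ℝ | q.2 < f q.1}.indicator (fun q => κ t q.1) (s, b)
              = {s | b < f s}.indicator (fun s => κ t s) s := fun s => rfl
          simp only [this]
          rw [lintegral_indicator (measurableSet_lt measurable_const hf), mul_assoc]
          exact (lintegral_enorm_sub_rpow_le t).trans (by gcongr; exact hlevel b hb.1)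
      _ = 5 * M ^ (1 / 2 : ℝ) * ENNReal.ofReal (3 * f t ^ (1 / 3 : ℝ)) := by
          rw [lintegral_const_mul _ (by fun_prop), lintegral_Ioo_rpow (hf0 t) (by norm_num)]
          congr 2
          norm_num
          ring
      _ ≤ _ := by
          rw [ENNReal.ofReal_mul (by norm_num)]
          apply le_of_eq
          rw [show ENNReal.ofReal 3 = 3 by simp, show (15 : ℝ≥0∞) = 5 * 3 by norm_num]
          ring
  have hPP : ∫⁻ t, ∫⁻ s, P t s ≤ 15 * M ^ (3 / 2 : ℝ) := by
    calc ∫⁻ t, ∫⁻ s, P t s ≤ ∫⁻ t, 15 * M ^ (1 / 2 : ℝ) * ENNReal.ofReal (f t) ^ (4 / 3 : ℝ) := by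
          refine lintegral_mono fun t => (hinner t).trans (le_of_eq ?_)
          rw [← ENNReal.ofReal_rpow_of_nonneg (hf0 t) (by norm_num),
            show (4 / 3 : ℝ) = 1 + 1 / 3 by norm_num,
            ENNReal.rpow_add_of_nonneg _ _ (by norm_num) (by norm_num), ENNReal.rpow_one]
          ring
      _ = 15 * M ^ (3 / 2 : ℝ) := by
          rw [lintegral_const_mul _ (by fun_prop), ← hM, show (3 / 2 : ℝ) = 1 / 2 + 1 by norm_num,
            ENNReal.rpow_add_of_nonneg _ _ (by norm_num) (by norm_num), ENNReal.rpow_one]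
          ring
  calc ∫⁻ t, ∫⁻ s, ENNReal.ofReal (f t) * ENNReal.ofReal (f s) * κ t s
      ≤ ∫⁻ t, ∫⁻ s, (P t s + P s t) := lintegral_mono fun t => lintegral_mono fun s => hsplit t s
    _ = (∫⁻ t, ∫⁻ s, P t s) + ∫⁻ t, ∫⁻ s, P s t := by
        have hPi : Measurable fun t => ∫⁻ s, P t s := Measurable.lintegral_prod_right' hPm
        rw [← lintegral_add_left hPi]
        refine lintegral_congr fun t => ?_
        rw [lintegral_add_left]
        exact hPm.comp measurable_prodMk_left
    _ = (∫⁻ t, ∫⁻ s, P t s) + ∫⁻ t, ∫⁻ s, P t s := by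
        congr 1
        exact (lintegral_lintegral_swap (f := P) hPm.aemeasurable).symm
    _ ≤ 15 * M ^ (3 / 2 : ℝ) + 15 * M ^ (3 / 2 : ℝ) := add_le_add hPP hPP
    _ = 30 * M ^ (3 / 2 : ℝ) := by rw [← add_mul]; norm_num

/-! ### TT* and duality -/

theorem norm_exp_I_mul_ofReal (x : ℝ) : ‖Complex.exp (Complex.I * (x : ℂ))‖ = 1 := by
  rw [mul_comm, Complex.norm_exp_ofReal_mul_I]

/-- The `TT*` argument: a weighted `L²` norm of an oscillatory integral is controlled by the
kernel of the composed operator. -/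
theorem lintegral_mul_enorm_sq_le_of_kernel_le {θ : ℝ → ℝ → ℝ}
    (hθ : Measurable (Function.uncurry θ)) {S : Set ℝ} {a : ℝ → ℝ}
    (ha : IntegrableOn a S) (ha0 : ∀ᵐ ξ ∂volume.restrict S, 0 ≤ a ξ) {g : ℝ → ℂ}
    (hgi : Integrable g) {κ : ℝ → ℝ → ℝ≥0∞}
    (hκ : Measurable (Function.uncurry κ))
    (hK : ∀ t s, ‖∫ ξ in S, (a ξ : ℂ) * Complex.exp (Complex.I * ((θ t ξ - θ s ξ : ℝ) : ℂ))‖ₑ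
      ≤ κ t s) :
    ∫⁻ ξ in S, ENNReal.ofReal (a ξ) *
        ‖∫ t, Complex.exp (Complex.I * (θ t ξ : ℝ)) * g t‖ₑ ^ (2 : ℝ)
      ≤ ∫⁻ t, ∫⁻ s, ‖g t‖ₑ * ‖g s‖ₑ * κ t s := by
  set μ := (volume : Measure ℝ).restrict S with hμ
  set H : ℝ → ℂ := fun ξ => ∫ t, Complex.exp (Complex.I * (θ t ξ : ℝ)) * g t with hH
  -- Integrating in q gives a|H|², and integrating in ξ gives the kernel times g(t) times the
  -- conjugate of g(s). Fubini is legitimate because a is integrable on S and g on the line.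
  set Ψ : ℝ → ℝ × ℝ → ℂ := fun ξ q => (a ξ : ℂ) *
    ((Complex.exp (Complex.I * (θ q.1 ξ : ℝ)) * g q.1) *
      (starRingEnd ℂ) (Complex.exp (Complex.I * (θ q.2 ξ : ℝ)) * g q.2)) with hΨ
  have hdom : Integrable (fun z : ℝ × (ℝ × ℝ) => a z.1 * (g z.2.1 * g z.2.2))
      (μ.prod ((volume : Measure ℝ).prod volume)) :=
    Integrable.mul_prod (f := fun ξ => (a ξ : ℂ)) (g := fun q : ℝ × ℝ => g q.1 * g q.2)
      ha.ofReal (hgi.mul_prod hgi)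
  have he : ∀ f : ℝ × (ℝ × ℝ) → ℝ × ℝ, Measurable f →
      Measurable fun z => Complex.exp (Complex.I * (θ (f z).1 (f z).2 : ℝ)) := by
    intro f hf
    have := hθ.comp hf
    exact Complex.measurable_exp.comp
      (measurable_const.mul (Complex.measurable_ofReal.comp this))
  have hg1 : AEStronglyMeasurable (fun z : ℝ × (ℝ × ℝ) => g z.2.1)
      (μ.prod ((volume : Measure ℝ).prod volume)) :=
    (hgi.aestronglyMeasurable.comp_fst (ν := (volume : Measure ℝ))).comp_snd
  have hg2 : AEStronglyMeasurable (fun z : ℝ × (ℝ × ℝ) => g z.2.2)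
      (μ.prod ((volume : Measure ℝ).prod volume)) :=
    (hgi.aestronglyMeasurable.comp_snd (μ := (volume : Measure ℝ))).comp_snd
  have hΨi : Integrable (Function.uncurry Ψ) (μ.prod ((volume : Measure ℝ).prod volume)) := by
    refine hdom.mono ?_ (Filter.Eventually.of_forall fun z => ?_)
    · refine (ha.ofReal.aestronglyMeasurable.comp_fst).mul
        (AEStronglyMeasurable.mul (AEStronglyMeasurable.mul ?_ hg1)
          (Complex.continuous_conj.comp_aestronglyMeasurable (AEStronglyMeasurable.mul ?_ hg2)))
      · exact (he (fun z => (z.2.1, z.1)) (by fun_prop)).aestronglyMeasurable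
      · exact (he (fun z => (z.2.2, z.1)) (by fun_prop)).aestronglyMeasurable
    · simp only [Function.uncurry, hΨ, norm_mul, RCLike.norm_conj, norm_exp_I_mul_ofReal, one_mul]
      exact le_rfl
  have hsq : ∀ ξ, ∫ q, Ψ ξ q ∂((volume : Measure ℝ).prod volume)
      = ((a ξ * ‖H ξ‖ ^ 2 : ℝ) : ℂ) := by
    intro ξ
    simp only [hΨ]
    rw [integral_const_mul, integral_prod_mul
      (fun t => Complex.exp (Complex.I * (θ t ξ : ℝ)) * g t)
      (fun t => (starRingEnd ℂ) (Complex.exp (Complex.I * (θ t ξ : ℝ)) * g t)), integral_conj,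
      Complex.mul_conj, Complex.normSq_eq_norm_sq]
    push_cast
    rfl
  have hint : Integrable (fun ξ => a ξ * ‖H ξ‖ ^ 2) μ := by
    have := hΨi.integral_prod_left
    simp only [Function.uncurry] at this
    simp only [hsq] at this
    exact this.re
  have hLHS : ∫⁻ ξ in S, ENNReal.ofReal (a ξ) * ‖H ξ‖ₑ ^ (2 : ℝ)
      = ‖∫ ξ, ((a ξ * ‖H ξ‖ ^ 2 : ℝ) : ℂ) ∂μ‖ₑ := by
    rw [integral_complex_ofReal, ← ofReal_norm, Complex.norm_real, Real.norm_of_nonneg,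
      ofReal_integral_eq_lintegral_ofReal hint]
    · refine lintegral_congr_ae (ha0.mono fun ξ h => ?_)
      simp only
      rw [ENNReal.ofReal_mul h, ENNReal.ofReal_pow (norm_nonneg _), ofReal_norm]
      norm_cast
    · exact ha0.mono fun ξ h => mul_nonneg h (sq_nonneg _)
    · exact integral_nonneg_of_ae (ha0.mono fun ξ h => mul_nonneg h (sq_nonneg _))
  rw [hLHS]
  simp only [← hsq]
  rw [integral_integral_swap hΨi]
  refine (enorm_integral_le_lintegral_enorm _).trans ?_
  have hbd : ∀ q : ℝ × ℝ, ‖∫ ξ, Ψ ξ q ∂μ‖ₑ ≤ ‖g q.1‖ₑ * ‖g q.2‖ₑ * κ q.1 q.2 := by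
    intro q
    have : ∀ ξ, Ψ ξ q = (g q.1 * (starRingEnd ℂ) (g q.2)) *
        ((a ξ : ℂ) * Complex.exp (Complex.I * ((θ q.1 ξ - θ q.2 ξ : ℝ) : ℂ))) := by
      intro ξ
      simp only [hΨ, map_mul, ← Complex.exp_conj, Complex.conj_I, Complex.conj_ofReal]
      push_cast
      rw [mul_sub, sub_eq_add_neg, Complex.exp_add, neg_mul]
      ring
    simp only [this]
    rw [integral_const_mul, enorm_mul, enorm_mul, RCLike.enorm_conj]
    gcongr
    exact hK q.1 q.2
  refine (lintegral_mono hbd).trans (le_of_eq ?_)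
  rw [lintegral_prod]
  exact ((hgi.aestronglyMeasurable.comp_fst).enorm.mul
    (hgi.aestronglyMeasurable.comp_snd).enorm).mul hκ.aemeasurable

/-- The absorption step that closes the duality argument. Finiteness of J is essential, since J^{1 −
1/q} is divided out. -/
theorem rpow_inv_le_of_le_mul_rpow {J K : ℝ≥0∞} (hJ : J ≠ ⊤) {q : ℝ} (hq : 0 < q)
    (h : J ≤ K * J ^ (1 - 1 / q)) : J ^ (1 / q) ≤ K := by
  rcases eq_or_ne J 0 with h0 | h0
  · rw [h0, ENNReal.zero_rpow_of_pos (by positivity)]; exact zero_le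
  have h1 : J ^ (1 / q) * J ^ (1 - 1 / q) ≤ K * J ^ (1 - 1 / q) := by
    rw [← ENNReal.rpow_add _ _ h0 hJ]
    simpa using h
  have h2 : J ^ (1 - 1 / q) ≠ 0 := by
    rw [Ne, ENNReal.rpow_eq_zero_iff]; tauto
  have h3 : J ^ (1 - 1 / q) ≠ ⊤ := by
    rw [Ne, ENNReal.rpow_eq_top_iff]; tauto
  exact (ENNReal.mul_le_mul_iff_left h2 h3).1 h1

theorem memLp_of_bounded_of_eq_zero {g : ℝ → ℂ} (hgm : Measurable g) {B R : ℝ}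
    (hgb : ∀ t, ‖g t‖ ≤ B) (hgs : ∀ t, t ∉ Set.Icc (-R) R → g t = 0) (p : ℝ≥0∞) : MemLp g p := by
  have hind : (Set.Icc (-R) R).indicator g = g :=
    Set.indicator_eq_self.2 fun t ht => by_contra fun h => ht (hgs t h)
  rw [← hind, memLp_indicator_iff_restrict measurableSet_Icc]
  exact MemLp.of_bound hgm.aestronglyMeasurable B (Filter.Eventually.of_forall hgb)

/-- The duality argument: a weighted `L²` bound for the adjoint oscillatory integral operator on
bounded, compactly supported functions implies an `L^q` bound for the operator itself. -/
theorem lintegral_enorm_rpow_le_of_adjoint {q : ℝ} (hq : 2 ≤ q) {θ : ℝ → ℝ → ℝ}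
    (hθ : Measurable (Function.uncurry θ)) {h : ℝ → ℂ} (hh : Integrable h)
    {f w : ℝ → ℝ≥0∞} (hf : AEMeasurable f) (hw : AEMeasurable w)
    (hle : ∀ ξ, ‖h ξ‖ₑ ≤ f ξ * w ξ ^ (1 / 2 : ℝ)) {A : ℝ≥0∞}
    (hA : ∀ g : ℝ → ℂ, Measurable g → (∃ R, ∀ t, ‖g t‖ ≤ R) →
      (∃ R, ∀ t, t ∉ Set.Icc (-R) R → g t = 0) →
      ∫⁻ ξ, w ξ * ‖∫ t, Complex.exp (Complex.I * (θ t ξ : ℝ)) * g t‖ₑ ^ (2 : ℝ)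
        ≤ A * (∫⁻ t, ‖g t‖ₑ ^ (q / (q - 1))) ^ (2 * (1 - 1 / q))) :
    (∫⁻ t, ‖∫ ξ, Complex.exp (Complex.I * (θ t ξ : ℝ)) * h ξ‖ₑ ^ q) ^ (1 / q)
      ≤ A ^ (1 / 2 : ℝ) * (∫⁻ ξ, f ξ ^ (2 : ℝ)) ^ (1 / 2 : ℝ) := by
  have hq0 : 0 < q := by linarith
  set G : ℝ → ℂ := fun t => ∫ ξ, Complex.exp (Complex.I * (θ t ξ : ℝ)) * h ξ with hG
  have hem : Measurable fun z : ℝ × ℝ => Complex.exp (Complex.I * (θ z.1 z.2 : ℝ)) :=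
    Complex.measurable_exp.comp (measurable_const.mul (Complex.measurable_ofReal.comp hθ))
  have hGb : ∀ t, ‖G t‖ ≤ ∫ ξ, ‖h ξ‖ := by
    intro t
    refine (norm_integral_le_integral_norm _).trans (le_of_eq ?_)
    simp only [norm_mul, norm_exp_I_mul_ofReal, one_mul]
  -- `h` may be replaced by a strongly measurable representative
  obtain ⟨h', hh'm, hh'e⟩ := hh.aestronglyMeasurable
  have hGm : Measurable G := by
    have h1 : StronglyMeasurable fun t => ∫ ξ, Complex.exp (Complex.I * (θ t ξ : ℝ)) * h' ξ := by
      refine StronglyMeasurable.integral_prod_right'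
        (f := fun z : ℝ × ℝ => Complex.exp (Complex.I * (θ z.1 z.2 : ℝ)) * h' z.2) ?_
      exact hem.stronglyMeasurable.mul (hh'm.comp_measurable measurable_snd)
    have h2 : G = fun t => ∫ ξ, Complex.exp (Complex.I * (θ t ξ : ℝ)) * h' ξ := by
      ext t
      exact integral_congr_ae (hh'e.mono fun ξ hξ => by simp only [hξ])
    rw [h2]
    exact h1.measurable
  set M := ∫ ξ, ‖h ξ‖ with hM
  have hM0 : 0 ≤ M := integral_nonneg fun _ => norm_nonneg _
  have key : ∀ R : ℝ, (∫⁻ t in Set.Icc (-R) R, ‖G t‖ₑ ^ q) ^ (1 / q)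
      ≤ A ^ (1 / 2 : ℝ) * (∫⁻ ξ, f ξ ^ (2 : ℝ)) ^ (1 / 2 : ℝ) := by
    intro R
    set J := ∫⁻ t in Set.Icc (-R) R, ‖G t‖ₑ ^ q with hJ
    -- The extremal test function: G·g = |G|^q and |g|^{q/(q−1)} = |G|^q on the window. The
    -- truncation makes g admissible and, as G is bounded by ‖h‖₁, makes J finite.
    set g : ℝ → ℂ := (Set.Icc (-R) R).indicator
      fun t => (starRingEnd ℂ) (G t) * ((‖G t‖ ^ (q - 2) : ℝ) : ℂ) with hg
    have hgm : Measurable g :=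
      Measurable.indicator ((Complex.continuous_conj.measurable.comp hGm).mul
        (Complex.measurable_ofReal.comp (hGm.norm.pow_const _))) measurableSet_Icc
    have hgn : ∀ t, ‖g t‖ = (Set.Icc (-R) R).indicator (fun t => ‖G t‖ ^ (q - 1)) t := by
      intro t
      by_cases ht : t ∈ Set.Icc (-R) R
      · simp only [hg]
        rw [Set.indicator_of_mem ht, Set.indicator_of_mem ht, norm_mul, RCLike.norm_conj,
          Complex.norm_real, Real.norm_of_nonneg (by positivity)]
        rcases eq_or_lt_of_le (norm_nonneg (G t)) with h0 | h0
        · rw [← h0, zero_mul, Real.zero_rpow (by linarith)]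
        · nth_rewrite 1 [← Real.rpow_one ‖G t‖]
          rw [← Real.rpow_add h0]
          congr 1; ring
      · simp only [hg]
        rw [Set.indicator_of_notMem ht, Set.indicator_of_notMem ht, norm_zero]
    have hgb : ∀ t, ‖g t‖ ≤ M ^ (q - 1) := by
      intro t
      rw [hgn]
      refine Set.indicator_le' (f := fun t => ‖G t‖ ^ (q - 1)) (g := fun _ => M ^ (q - 1))
        (fun t _ => Real.rpow_le_rpow (norm_nonneg _) (hGb t) (by linarith))
        (fun t _ => by positivity) t
    have hgs : ∀ t, t ∉ Set.Icc (-R) R → g t = 0 := fun t ht => Set.indicator_of_notMem ht _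
    have hgi : Integrable g :=
      memLp_one_iff_integrable.1 (memLp_of_bounded_of_eq_zero hgm hgb hgs 1)
    have hAg := hA g hgm ⟨_, hgb⟩ ⟨R, hgs⟩
    set H : ℝ → ℂ := fun ξ => ∫ t, Complex.exp (Complex.I * (θ t ξ : ℝ)) * g t with hH
    have hgq : ∫⁻ t, ‖g t‖ₑ ^ (q / (q - 1)) = J := by
      rw [hJ, ← lintegral_indicator measurableSet_Icc]
      refine lintegral_congr fun t => ?_
      rw [← ofReal_norm, hgn]
      by_cases ht : t ∈ Set.Icc (-R) R
      · rw [Set.indicator_of_mem ht, Set.indicator_of_mem ht, ← ofReal_norm,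
          ENNReal.ofReal_rpow_of_nonneg (by positivity) (div_nonneg hq0.le (by linarith)),
          ENNReal.ofReal_rpow_of_nonneg (by positivity) hq0.le, ← Real.rpow_mul (norm_nonneg _)]
        congr 2
        have : q - 1 ≠ 0 := by linarith
        field_simp
      · rw [Set.indicator_of_notMem ht, Set.indicator_of_notMem ht, ENNReal.ofReal_zero,
          ENNReal.zero_rpow_of_pos (div_pos hq0 (by linarith))]
    have hJtop : J ≠ ⊤ := by
      refine ne_top_of_le_ne_top (b := ∫⁻ t in Set.Icc (-R) R, ENNReal.ofReal M ^ q) ?_ ?_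
      · rw [setLIntegral_const]
        exact ENNReal.mul_ne_top (ENNReal.rpow_ne_top_of_nonneg hq0.le ENNReal.ofReal_ne_top)
          (by simp)
      · refine lintegral_mono fun t => ENNReal.rpow_le_rpow ?_ hq0.le
        rw [← ofReal_norm]
        exact ENNReal.ofReal_le_ofReal (hGb t)
    have hpair : ∫ t, G t * g t = ∫ ξ, h ξ * H ξ := by
      have hi : Integrable (Function.uncurry fun t ξ =>
          Complex.exp (Complex.I * (θ t ξ : ℝ)) * h ξ * g t)
          ((volume : Measure ℝ).prod volume) := by
        refine (hgi.mul_prod hh).mono ?_ (Filter.Eventually.of_forall fun z => ?_)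
        · exact (hem.aestronglyMeasurable.mul hh.aestronglyMeasurable.comp_snd).mul
            hgi.aestronglyMeasurable.comp_fst
        · simp only [Function.uncurry, norm_mul, norm_exp_I_mul_ofReal, one_mul]
          rw [mul_comm]
      calc ∫ t, G t * g t = ∫ t, ∫ ξ, Complex.exp (Complex.I * (θ t ξ : ℝ)) * h ξ * g t := by
            refine integral_congr_ae (Filter.Eventually.of_forall fun t => ?_)
            simp only [hG]
            rw [integral_mul_const]
        _ = ∫ ξ, ∫ t, Complex.exp (Complex.I * (θ t ξ : ℝ)) * h ξ * g t :=
            integral_integral_swap hi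
        _ = ∫ ξ, h ξ * H ξ := by
            refine integral_congr_ae (Filter.Eventually.of_forall fun ξ => ?_)
            simp only [hH]
            rw [← integral_const_mul]
            congr 1
            ext t
            ring
    have hGg : ∀ t, G t * g t
        = (((Set.Icc (-R) R).indicator (fun t => ‖G t‖ ^ q) t : ℝ) : ℂ) := by
      intro t
      by_cases ht : t ∈ Set.Icc (-R) R
      · simp only [hg]
        rw [Set.indicator_of_mem ht, Set.indicator_of_mem ht, ← mul_assoc, Complex.mul_conj,
          Complex.normSq_eq_norm_sq, ← Complex.ofReal_mul]
        congr 1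
        rcases eq_or_lt_of_le (norm_nonneg (G t)) with h0 | h0
        · rw [← h0, Real.zero_rpow hq0.ne']; simp
        · rw [← Real.rpow_two, ← Real.rpow_add h0]
          congr 1; ring
      · rw [hgs t ht, Set.indicator_of_notMem ht]; simp
    have hJeq : J = ‖∫ t, G t * g t‖ₑ := by
      simp only [hGg]
      rw [integral_complex_ofReal, ← ofReal_norm, Complex.norm_real,
        Real.norm_of_nonneg (integral_nonneg fun t =>
          Set.indicator_nonneg (fun _ _ => by positivity) _),
        integral_indicator measurableSet_Icc, ofReal_integral_eq_lintegral_ofReal]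
      · refine lintegral_congr fun t => ?_
        rw [← ENNReal.ofReal_rpow_of_nonneg (norm_nonneg _) hq0.le, ofReal_norm]
      · refine Measure.integrableOn_of_bounded (M := M ^ q) (by simp)
          (hGm.norm.pow_const q).aestronglyMeasurable (Filter.Eventually.of_forall fun t => ?_)
        rw [Real.norm_of_nonneg (by positivity)]
        exact Real.rpow_le_rpow (norm_nonneg _) (hGb t) hq0.le
      · exact Filter.Eventually.of_forall fun t => by positivity
    have hHm : AEMeasurable (fun ξ => ‖H ξ‖ₑ) := by
      have h1 : StronglyMeasurable H := by
        refine StronglyMeasurable.integral_prod_right'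
          (f := fun z : ℝ × ℝ => Complex.exp (Complex.I * (θ z.2 z.1 : ℝ)) * g z.2) ?_
        exact ((hem.comp measurable_swap).mul (hgm.comp measurable_snd)).stronglyMeasurable
      exact h1.measurable.enorm.aemeasurable
    -- Pair h with the adjoint applied to g, move w^{1/2} onto the latter, and use Cauchy-Schwarz
    -- and the adjoint bound.
    have hmain : J ≤ A ^ (1 / 2 : ℝ) * (∫⁻ ξ, f ξ ^ (2 : ℝ)) ^ (1 / 2 : ℝ) * J ^ (1 - 1 / q) := by
      calc J = ‖∫ ξ, h ξ * H ξ‖ₑ := by rw [hJeq, hpair]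
        _ ≤ ∫⁻ ξ, ‖h ξ * H ξ‖ₑ := enorm_integral_le_lintegral_enorm _
        _ ≤ ∫⁻ ξ, (f * fun ξ => w ξ ^ (1 / 2 : ℝ) * ‖H ξ‖ₑ) ξ := by
            refine lintegral_mono fun ξ => ?_
            rw [enorm_mul, Pi.mul_apply, ← mul_assoc]
            gcongr
            exact hle ξ
        _ ≤ (∫⁻ ξ, f ξ ^ (2 : ℝ)) ^ (1 / 2 : ℝ) *
            (∫⁻ ξ, (w ξ ^ (1 / 2 : ℝ) * ‖H ξ‖ₑ) ^ (2 : ℝ)) ^ (1 / 2 : ℝ) :=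
            ENNReal.lintegral_mul_le_Lp_mul_Lq _ Real.HolderConjugate.two_two hf
              ((hw.pow_const _).mul hHm)
        _ = (∫⁻ ξ, f ξ ^ (2 : ℝ)) ^ (1 / 2 : ℝ) *
            (∫⁻ ξ, w ξ * ‖H ξ‖ₑ ^ (2 : ℝ)) ^ (1 / 2 : ℝ) := by
            congr 2
            refine lintegral_congr fun ξ => ?_
            rw [ENNReal.mul_rpow_of_nonneg _ _ (by norm_num), ← ENNReal.rpow_mul]
            norm_num
        _ ≤ (∫⁻ ξ, f ξ ^ (2 : ℝ)) ^ (1 / 2 : ℝ) *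
            (A * J ^ (2 * (1 - 1 / q))) ^ (1 / 2 : ℝ) := by
            rw [hgq] at hAg
            gcongr
        _ = _ := by
            rw [ENNReal.mul_rpow_of_nonneg _ _ (by norm_num), ← ENNReal.rpow_mul,
              show 2 * (1 - 1 / q) * (1 / 2) = 1 - 1 / q by ring]
            ring
    exact rpow_inv_le_of_le_mul_rpow hJtop hq0 hmain
  -- The bound on windows does not depend on R, so monotone convergence removes the truncation.
  have hunion : (⋃ n : ℕ, Set.Icc (-(n : ℝ)) n) = Set.univ := by
    refine Set.eq_univ_of_forall fun t => ?_
    obtain ⟨n, hn⟩ := exists_nat_ge |t|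
    exact Set.mem_iUnion.2 ⟨n, abs_le.1 hn⟩
  have hdir : Directed (· ⊆ ·) fun n : ℕ => Set.Icc (-(n : ℝ)) n := by
    refine (monotone_nat_of_le_succ fun n => ?_).directed_le
    apply Set.Icc_subset_Icc <;> push_cast <;> linarith
  rw [← setLIntegral_univ, ← hunion, setLIntegral_iUnion_of_directed _ hdir]
  rw [one_div, ENNReal.rpow_inv_le_iff hq0]
  refine iSup_le fun n => ?_
  rw [← ENNReal.rpow_inv_le_iff hq0, ← one_div]
  exact key n

/-! ### Plancherel and change of variables -/

/-- Plancherel's theorem on `L¹ ∩ L²`. -/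
theorem eLpNorm_fourier_eq_of_integrable {g : ℝ → ℂ} (h1 : Integrable g) (h2 : MemLp g 2) :
    eLpNorm (𝓕 g) 2 volume = eLpNorm g 2 volume := by
  set u : Lp ℂ 2 (volume : Measure ℝ) := h2.toLp g with hu
  have hcont : Continuous (𝓕 g) := VectorFourier.fourierIntegral_continuous
    Real.continuous_fourierChar (by exact continuous_inner) h1
  -- The integral transform and the L² transform agree because they give the same pairing with every
  -- test function: Fubini on one side, the tempered-distribution transform on the other.
  have hae : ∀ᵐ ξ, 𝓕 g ξ = (𝓕 u : Lp ℂ 2 (volume : Measure ℝ)) ξ := by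
    refine ae_eq_of_integral_contDiff_smul_eq hcont.locallyIntegrable
      ((Lp.memLp _).locallyIntegrable (by norm_num)) fun χ hχ hχc => ?_
    have hχc' : HasCompactSupport fun x => (χ x : ℂ) :=
      hχc.comp_left (g := fun y : ℝ => (y : ℂ)) Complex.ofReal_zero
    have hχs : ContDiff ℝ ∞ fun x => (χ x : ℂ) := Complex.ofRealCLM.contDiff.comp hχ
    set X : 𝓢(ℝ, ℂ) := hχc'.toSchwartzMap hχs with hX
    have hXa : ∀ x, X x = χ x := fun x => rfl
    have e1 : ∫ x, χ x • 𝓕 g x = ∫ x, g x • 𝓕 (X : ℝ → ℂ) x := by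
      have hflip := VectorFourier.integral_fourierIntegral_smul_eq_flip (L := innerₗ ℝ)
        Real.continuous_fourierChar (by exact continuous_inner) h1 (X.integrable (μ := volume))
      rw [flip_innerₗ] at hflip
      refine Eq.trans ?_ hflip
      refine integral_congr_ae (Filter.Eventually.of_forall fun x => ?_)
      simp only [hXa, Complex.real_smul, smul_eq_mul]
      rw [mul_comm]
      rfl
    have e2 := congrArg (fun T => T X) (Lp.fourier_toTemperedDistribution_eq u)
    simp only [TemperedDistribution.fourier_apply, Lp.toTemperedDistribution_apply] at e2
    rw [e1]
    have e3 : ∫ x, χ x • (𝓕 u : Lp ℂ 2 (volume : Measure ℝ)) x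
        = ∫ x, X x • (𝓕 u : Lp ℂ 2 (volume : Measure ℝ)) x := by
      refine integral_congr_ae (Filter.Eventually.of_forall fun x => ?_)
      simp only [hXa, Complex.real_smul, smul_eq_mul]
    rw [e3, ← e2]
    refine integral_congr_ae (h2.coeFn_toLp.mono fun x hx => ?_)
    simp only [smul_eq_mul]
    rw [hx, mul_comm, SchwartzMap.fourier_coe]
  rw [eLpNorm_congr_ae hae, eLpNorm_congr_ae h2.coeFn_toLp.symm]
  have := Lp.norm_fourier_eq u
  rw [Lp.norm_def, Lp.norm_def] at this
  exact (ENNReal.toReal_eq_toReal_iff' (Lp.eLpNorm_ne_top _) (Lp.eLpNorm_ne_top _)).1 this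

theorem eLpNorm_two_eq_lintegral {f : ℝ → ℂ} {μ : Measure ℝ} :
    eLpNorm f 2 μ = (∫⁻ x, ‖f x‖ₑ ^ (2 : ℝ) ∂μ) ^ (1 / 2 : ℝ) := by
  rw [eLpNorm_eq_lintegral_rpow_enorm_toReal (by norm_num) (by norm_num)]
  norm_num

theorem lintegral_enorm_fourier_sq_eq {g : ℝ → ℂ} (h1 : Integrable g) (h2 : MemLp g 2) :
    ∫⁻ ξ, ‖𝓕 g ξ‖ₑ ^ (2 : ℝ) = ∫⁻ t, ‖g t‖ₑ ^ (2 : ℝ) := by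
  have h := eLpNorm_fourier_eq_of_integrable h1 h2
  rw [eLpNorm_two_eq_lintegral, eLpNorm_two_eq_lintegral] at h
  exact ENNReal.rpow_left_injective (by norm_num) h

/-- Change of variables and Plancherel's theorem on a set on which the phase is injective. -/
theorem setLIntegral_abs_deriv_mul_enorm_sq_le {p p' : ℝ → ℝ} {S : Set ℝ} (hS : MeasurableSet S)
    (hp : ∀ ξ ∈ S, HasDerivAt p (p' ξ) ξ) (hinj : Set.InjOn p S) {g : ℝ → ℂ}
    (h1 : Integrable g) (h2 : MemLp g 2) :
    ∫⁻ ξ in S, ENNReal.ofReal |p' ξ| *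
        ‖∫ t, Complex.exp (Complex.I * ((t * p ξ : ℝ) : ℂ)) * g t‖ₑ ^ (2 : ℝ)
      ≤ ENNReal.ofReal (2 * Real.pi) * ∫⁻ t, ‖g t‖ₑ ^ (2 : ℝ) := by
  have hpi : 0 < 2 * Real.pi := by positivity
  -- The inner integral is the ordinary-frequency transform at −p/(2π). Its Jacobian is |p'|/(2π),
  -- whence the factor 2π.
  set r : ℝ → ℝ := fun ξ => -(p ξ) / (2 * Real.pi) with hr
  have hF : ∀ ξ, ∫ t, Complex.exp (Complex.I * ((t * p ξ : ℝ) : ℂ)) * g t = 𝓕 g (r ξ) := by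
    intro ξ
    rw [Real.fourier_real_eq_integral_exp_smul]
    refine integral_congr_ae (Filter.Eventually.of_forall fun t => ?_)
    simp only [smul_eq_mul, hr]
    rw [mul_comm Complex.I]
    congr 4
    field_simp
  have hinj' : Set.InjOn r S := by
    intro ξ hξ ξ' hξ' h
    apply hinj hξ hξ'
    simp only [hr] at h
    field_simp at h
    linarith
  have hcv := lintegral_image_eq_lintegral_abs_deriv_mul hS
    (f := r) (f' := fun ξ => -p' ξ / (2 * Real.pi))
    (fun ξ hξ => ((hp ξ hξ).neg.div_const (2 * Real.pi)).hasDerivWithinAt) hinj'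
    (fun η => ‖𝓕 g η‖ₑ ^ (2 : ℝ))
  calc ∫⁻ ξ in S, ENNReal.ofReal |p' ξ| *
        ‖∫ t, Complex.exp (Complex.I * ((t * p ξ : ℝ) : ℂ)) * g t‖ₑ ^ (2 : ℝ)
      = ∫⁻ ξ in S, ENNReal.ofReal (2 * Real.pi) *
          (ENNReal.ofReal |-p' ξ / (2 * Real.pi)| * ‖𝓕 g (r ξ)‖ₑ ^ (2 : ℝ)) := by
        refine lintegral_congr fun ξ => ?_
        rw [hF, ← mul_assoc, ← ENNReal.ofReal_mul hpi.le, abs_div, abs_neg, abs_of_pos hpi,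
          mul_div_cancel₀ _ hpi.ne']
    _ = ENNReal.ofReal (2 * Real.pi) * ∫⁻ η in r '' S, ‖𝓕 g η‖ₑ ^ (2 : ℝ) := by
        rw [lintegral_const_mul' _ _ ENNReal.ofReal_ne_top, hcv]
    _ ≤ ENNReal.ofReal (2 * Real.pi) * ∫⁻ η, ‖𝓕 g η‖ₑ ^ (2 : ℝ) := by
        gcongr
        exact Measure.restrict_le_self
    _ = _ := by rw [lintegral_enorm_fourier_sq_eq h1 h2]

theorem hasDerivAt_phase (ε ξ : ℝ) :
    HasDerivAt (phase ε) (ξ ^ 2 * (3 - 5 * ε * ξ ^ 2)) ξ := by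
  have h := (hasDerivAt_pow 3 ξ).sub ((hasDerivAt_pow 5 ξ).const_mul ε)
  refine h.congr_deriv ?_
  push_cast
  ring

/-- The adjoint form of local smoothing. The weight is the Jacobian of τ = p(ξ), and p is injective
on each of the four intervals cut out by 0 and ±√(3/(5ε)); each costs 2π. -/
theorem lintegral_abs_deriv_phase_mul_enorm_sq_le {ε : ℝ} (hε : 0 < ε) {g : ℝ → ℂ}
    (h1 : Integrable g) (h2 : MemLp g 2) :
    ∫⁻ ξ, ENNReal.ofReal |ξ ^ 2 * (3 - 5 * ε * ξ ^ 2)| *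
        ‖∫ t, Complex.exp (Complex.I * ((t * phase ε ξ : ℝ) : ℂ)) * g t‖ₑ ^ (2 : ℝ)
      ≤ ENNReal.ofReal (8 * Real.pi) * ∫⁻ t, ‖g t‖ₑ ^ (2 : ℝ) := by
  set r := √(3 / (5 * ε)) with hr
  have hr0 : 0 < r := Real.sqrt_pos.2 (by positivity)
  have hr2 : 5 * ε * r ^ 2 = 3 := by
    rw [hr, Real.sq_sqrt (by positivity)]
    field_simp
  have hfac : ∀ ξ, 3 - 5 * ε * ξ ^ 2 = 5 * ε * ((r - ξ) * (r + ξ)) := fun ξ => by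
    linear_combination -hr2
  have hcont : Continuous (phase ε) :=
    continuous_iff_continuousAt.2 fun ξ => (hasDerivAt_phase ε ξ).continuousAt
  have hder : ∀ ξ, deriv (phase ε) ξ = ξ ^ 2 * (5 * ε * ((r - ξ) * (r + ξ))) := fun ξ => by
    rw [(hasDerivAt_phase ε ξ).deriv, hfac]
  have i1 : Set.InjOn (phase ε) (Set.Iic (-r)) := by
    refine (strictAntiOn_of_deriv_neg (convex_Iic _) hcont.continuousOn fun ξ hξ => ?_).injOn
    rw [interior_Iic, Set.mem_Iio] at hξ
    rw [hder]
    have hξ2 : 0 < ξ ^ 2 := by nlinarith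
    have : (r - ξ) * (r + ξ) < 0 := mul_neg_of_pos_of_neg (by linarith) (by linarith)
    exact mul_neg_of_pos_of_neg hξ2 (mul_neg_of_pos_of_neg (by positivity) this)
  have i4 : Set.InjOn (phase ε) (Set.Ici r) := by
    refine (strictAntiOn_of_deriv_neg (convex_Ici _) hcont.continuousOn fun ξ hξ => ?_).injOn
    rw [interior_Ici, Set.mem_Ioi] at hξ
    rw [hder]
    have hξ2 : 0 < ξ ^ 2 := by nlinarith
    have : (r - ξ) * (r + ξ) < 0 := mul_neg_of_neg_of_pos (by linarith) (by linarith)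
    exact mul_neg_of_pos_of_neg hξ2 (mul_neg_of_pos_of_neg (by positivity) this)
  have i2 : Set.InjOn (phase ε) (Set.Icc (-r) 0) := by
    refine (strictMonoOn_of_deriv_pos (convex_Icc _ _) hcont.continuousOn fun ξ hξ => ?_).injOn
    rw [interior_Icc, Set.mem_Ioo] at hξ
    rw [hder]
    have hξ2 : 0 < ξ ^ 2 := by nlinarith
    have : 0 < (r - ξ) * (r + ξ) := mul_pos (by linarith) (by linarith)
    positivity
  have i3 : Set.InjOn (phase ε) (Set.Icc 0 r) := by
    refine (strictMonoOn_of_deriv_pos (convex_Icc _ _) hcont.continuousOn fun ξ hξ => ?_).injOn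
    rw [interior_Icc, Set.mem_Ioo] at hξ
    rw [hder]
    have hξ2 : 0 < ξ ^ 2 := by nlinarith
    have : 0 < (r - ξ) * (r + ξ) := mul_pos (by linarith) (by linarith)
    positivity
  have hcover : (Set.univ : Set ℝ) =
      Set.Iic (-r) ∪ (Set.Icc (-r) 0 ∪ (Set.Icc 0 r ∪ Set.Ici r)) := by
    refine (Set.eq_univ_of_forall fun ξ => ?_).symm
    simp only [Set.mem_union, Set.mem_Iic, Set.mem_Icc, Set.mem_Ici]
    grind
  have hb : ∀ S : Set ℝ, MeasurableSet S → Set.InjOn (phase ε) S → _ := fun S hS hi =>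
    setLIntegral_abs_deriv_mul_enorm_sq_le hS (fun ξ _ => hasDerivAt_phase ε ξ) hi h1 h2
  rw [← setLIntegral_univ, hcover]
  refine (lintegral_union_le _ _ _).trans ((add_le_add_right ((lintegral_union_le _ _ _).trans
    (add_le_add_right (lintegral_union_le _ _ _) _)) _).trans
    ((add_le_add (hb _ measurableSet_Iic i1) (add_le_add (hb _ measurableSet_Icc i2)
      (add_le_add (hb _ measurableSet_Icc i3) (hb _ measurableSet_Ici i4)))).trans
    (le_of_eq ?_)))
  rw [show (8 : ℝ) * Real.pi = 4 * (2 * Real.pi) by ring,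
    ENNReal.ofReal_mul (p := 4) (by norm_num), show ENNReal.ofReal 4 = 4 by simp]
  ring

/-! ### Adjoint Strichartz estimate and linearized supremum -/

/-- `TT*` and Hardy-Littlewood-Sobolev: a dispersive kernel bound on an interval of frequencies
gives the adjoint Strichartz estimate for that interval. -/
theorem setLIntegral_Icc_mul_enorm_sq_le {a : ℝ → ℝ} {c d B ε : ℝ} (hcd : c ≤ d)
    (hB : 0 < B) (ha : ContinuousOn a (Set.Icc c d)) (ha0 : ∀ ξ ∈ Set.Icc c d, 0 ≤ a ξ)
    (h : ∀ x t : ℝ, t ≠ 0 → ‖∫ ξ in c..d, (a ξ : ℂ) *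
      Complex.exp (Complex.I * ((x * ξ + t * phase ε ξ : ℝ) : ℂ))‖ ≤ B / √|t|)
    {x : ℝ → ℝ} (hx : Measurable x) {g : ℝ → ℂ} (hgm : Measurable g) (hg : Integrable g) :
    ∫⁻ ξ in Set.Icc c d, ENNReal.ofReal (a ξ) *
        ‖∫ t, Complex.exp (Complex.I * ((x t * ξ + t * phase ε ξ : ℝ) : ℂ)) * g t‖ₑ ^ (2 : ℝ)
      ≤ ENNReal.ofReal B * (30 * (∫⁻ t, ‖g t‖ₑ ^ (4 / 3 : ℝ)) ^ (3 / 2 : ℝ)) := by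
  have hθ : Measurable (Function.uncurry fun t ξ => x t * ξ + t * phase ε ξ) := by
    simp only [Function.uncurry_def, phase]
    fun_prop
  have hκ : Measurable (Function.uncurry fun t s : ℝ =>
      ENNReal.ofReal B * ‖t - s‖ₑ ^ (-(1 / 2) : ℝ)) := by
    simp only [Function.uncurry_def]; fun_prop
  have hae : ∀ᵐ ξ ∂volume.restrict (Set.Icc c d), 0 ≤ a ξ :=
    (ae_restrict_mem measurableSet_Icc).mono ha0
  have hK : ∀ t s, ‖∫ ξ in Set.Icc c d, (a ξ : ℂ) * Complex.exp (Complex.I *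
      (((x t * ξ + t * phase ε ξ) - (x s * ξ + s * phase ε ξ) : ℝ) : ℂ))‖ₑ
      ≤ ENNReal.ofReal B * ‖t - s‖ₑ ^ (-(1 / 2) : ℝ) := by
    intro t s
    -- On the diagonal the majorant is 0 to a negative power, that is ∞, and nothing is to be shown.
    rcases eq_or_ne t s with hts | hts
    · rw [hts, sub_self, enorm_zero, ENNReal.zero_rpow_of_neg (by norm_num), ENNReal.mul_top]
      · exact le_top
      · simpa using hB
    have hts' : t - s ≠ 0 := sub_ne_zero.2 hts
    have hpos : 0 < |t - s| := abs_pos.2 hts'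
    -- Uniformity of the kernel bound in its space variable is what permits an arbitrary measurable
    -- x(t).
    have h1 := h (x t - x s) (t - s) hts'
    rw [integral_Icc_eq_integral_Ioc, ← intervalIntegral.integral_of_le hcd,
      Real.enorm_eq_ofReal_abs, ENNReal.ofReal_rpow_of_pos hpos, ← ENNReal.ofReal_mul hB.le,
      ← ofReal_norm]
    apply ENNReal.ofReal_le_ofReal
    rw [Real.rpow_neg hpos.le, ← Real.sqrt_eq_rpow, ← div_eq_mul_inv]
    refine le_of_eq_of_le ?_ h1
    congr 2
    ext ξ
    congr 4
    ring
  refine (lintegral_mul_enorm_sq_le_of_kernel_le hθ ha.integrableOn_Icc hae hg hκ hK).trans ?_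
  have hHLS := lintegral_lintegral_mul_enorm_sub_rpow_le hgm.norm (fun t => norm_nonneg (g t))
  simp only [ofReal_norm] at hHLS
  calc ∫⁻ t, ∫⁻ s, ‖g t‖ₑ * ‖g s‖ₑ * (ENNReal.ofReal B * ‖t - s‖ₑ ^ (-(1 / 2) : ℝ))
      = ∫⁻ t, ENNReal.ofReal B * ∫⁻ s, ‖g t‖ₑ * ‖g s‖ₑ * ‖t - s‖ₑ ^ (-(1 / 2) : ℝ) := by
        refine lintegral_congr fun t => ?_
        rw [← lintegral_const_mul' _ _ ENNReal.ofReal_ne_top]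
        refine lintegral_congr fun s => ?_
        ring
    _ = ENNReal.ofReal B * ∫⁻ t, ∫⁻ s, ‖g t‖ₑ * ‖g s‖ₑ * ‖t - s‖ₑ ^ (-(1 / 2) : ℝ) :=
        lintegral_const_mul' _ _ ENNReal.ofReal_ne_top
    _ ≤ _ := by gcongr

/-- The rescaled form of the adjoint estimate, on frequencies of either sign. -/
theorem lintegral_indicator_Icc_mul_enorm_sq_le {a : ℝ → ℝ} {c d B : ℝ} (hcd : c ≤ d)
    (hB : 0 < B) (ha : ContinuousOn a (Set.Icc c d)) (ha0 : ∀ z ∈ Set.Icc c d, 0 ≤ a z)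
    (h : ∀ t w : ℝ, 0 < t → ‖∫ z in c..d, (a z : ℂ) *
      Complex.exp (Complex.I * ((t * w * z + t * phase 1 z : ℝ) : ℂ))‖ ≤ B / √t)
    {ε : ℝ} (hε : 0 < ε) {σ : ℝ} (hσ : σ = 1 ∨ σ = -1)
    {x : ℝ → ℝ} (hx : Measurable x) {g : ℝ → ℂ} (hgm : Measurable g) (hg : Integrable g) :
    ∫⁻ ξ, (Set.Icc c d).indicator (fun z => ENNReal.ofReal (a z / √√ε)) (σ * (√ε * ξ)) *
        ‖∫ t, Complex.exp (Complex.I * ((x t * ξ + t * phase ε ξ : ℝ) : ℂ)) * g t‖ₑ ^ (2 : ℝ)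
      ≤ ENNReal.ofReal B * (30 * (∫⁻ t, ‖g t‖ₑ ^ (4 / 3 : ℝ)) ^ (3 / 2 : ℝ)) := by
  have hδ : 0 < √ε := Real.sqrt_pos.2 hε
  have hsd : 0 < √√ε := Real.sqrt_pos.2 hδ
  have hk : ∀ x t : ℝ, t ≠ 0 → _ := fun x t ht => norm_kernel_rescale_le h hε x ht
  have hcd' : c / √ε ≤ d / √ε := by gcongr
  have hmem : ∀ ξ, ξ ∈ Set.Icc (c / √ε) (d / √ε) ↔ √ε * ξ ∈ Set.Icc c d := by
    intro ξ
    rw [Set.mem_Icc, Set.mem_Icc, div_le_iff₀ hδ, le_div_iff₀ hδ, mul_comm ξ]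
  have hac : ContinuousOn (fun ξ => a (√ε * ξ) / √√ε) (Set.Icc (c / √ε) (d / √ε)) :=
    (ha.comp (by fun_prop) fun ξ hξ => (hmem ξ).1 hξ).div_const _
  have hap : ∀ ξ ∈ Set.Icc (c / √ε) (d / √ε), 0 ≤ a (√ε * ξ) / √√ε :=
    fun ξ hξ => div_nonneg (ha0 _ ((hmem ξ).1 hξ)) hsd.le
  rcases hσ with rfl | rfl
  · refine le_of_eq_of_le ?_ (setLIntegral_Icc_mul_enorm_sq_le hcd' hB hac hap hk hx hgm hg)
    rw [← lintegral_indicator measurableSet_Icc]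
    refine lintegral_congr fun ξ => ?_
    rw [one_mul]
    by_cases hξ : ξ ∈ Set.Icc (c / √ε) (d / √ε)
    · rw [Set.indicator_of_mem hξ, Set.indicator_of_mem ((hmem ξ).1 hξ)]
    · rw [Set.indicator_of_notMem hξ, Set.indicator_of_notMem (fun h => hξ ((hmem ξ).2 h)),
        zero_mul]
  · have hneg : ∀ ξ, ξ ∈ Set.Icc (-(d / √ε)) (-(c / √ε)) ↔ -ξ ∈ Set.Icc (c / √ε) (d / √ε) := by
      intro ξ
      rw [Set.mem_Icc, Set.mem_Icc]
      constructor <;> rintro ⟨h1, h2⟩ <;> constructor <;> linarith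
    refine le_of_eq_of_le ?_ (setLIntegral_Icc_mul_enorm_sq_le (neg_le_neg hcd') hB
      (hac.comp (continuousOn_neg) fun ξ hξ => (hneg ξ).1 hξ)
      (fun ξ hξ => hap _ ((hneg ξ).1 hξ))
      (fun x t ht => norm_kernel_reflect_le hk x ht) hx hgm hg)
    rw [← lintegral_indicator measurableSet_Icc]
    refine lintegral_congr fun ξ => ?_
    rw [show -1 * (√ε * ξ) = √ε * -ξ by ring]
    by_cases hξ : ξ ∈ Set.Icc (-(d / √ε)) (-(c / √ε))
    · rw [Set.indicator_of_mem hξ, Set.indicator_of_mem ((hmem _).1 ((hneg _).1 hξ))]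
      rfl
    · rw [Set.indicator_of_notMem hξ,
        Set.indicator_of_notMem (fun h => hξ ((hneg _).2 ((hmem _).2 h))), zero_mul]

/-- Exhaustion of a set of frequencies by intervals. -/
theorem lintegral_indicator_iUnion_mul_le {c d : ℕ → ℝ}
    (hmono : Monotone fun n => Set.Icc (c n) (d n)) {b F : ℝ → ℝ≥0∞} {ℓ : ℝ → ℝ}
    (hb : Measurable b) (hℓ : Measurable ℓ) (hF : Measurable F) {K : ℝ≥0∞}
    (h : ∀ n, ∫⁻ ξ, (Set.Icc (c n) (d n)).indicator b (ℓ ξ) * F ξ ≤ K) :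
    ∫⁻ ξ, (⋃ n, Set.Icc (c n) (d n)).indicator b (ℓ ξ) * F ξ ≤ K := by
  have hsup : ∀ ξ, (⋃ n, Set.Icc (c n) (d n)).indicator b (ℓ ξ) * F ξ
      = ⨆ n, (Set.Icc (c n) (d n)).indicator b (ℓ ξ) * F ξ := by
    intro ξ
    rw [← ENNReal.iSup_mul]
    congr 1
    rw [Set.indicator_iUnion_apply]
    rfl
  simp only [hsup]
  rw [lintegral_iSup]
  · exact iSup_le h
  · exact fun n => ((hb.indicator measurableSet_Icc).comp hℓ).mul hF
  · intro n m hnm ξ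
    exact mul_le_mul' (Set.indicator_le_indicator_of_subset (f := b) (hmono hnm)
      (fun _ => zero_le) (ℓ ξ)) le_rfl

/-- The weight, in the rescaled frequency `z = √ε ξ > 0`, for which the kernel has the
dispersive decay `|t|^{-1/2}`. -/
noncomputable def halfWeight (z : ℝ) : ℝ≥0∞ :=
  (Set.Ioc 0 0.486).indicator (fun z => ENNReal.ofReal √z) z +
  ((Set.Icc 0.61 1).indicator (fun _ => 1) z + (Set.Ici 1).indicator (fun z => ENNReal.ofReal √z) z)

theorem measurable_halfWeight : Measurable halfWeight := by
  unfold halfWeight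
  refine Measurable.add ?_ (Measurable.add ?_ ?_)
  · exact Measurable.indicator (by fun_prop) measurableSet_Ioc
  · exact Measurable.indicator (by fun_prop) measurableSet_Icc
  · exact Measurable.indicator (by fun_prop) measurableSet_Ici

/-- Three frequency ranges, each contributing 14 from the kernel times 30 from
Hardy-Littlewood-Sobolev. The non-compact ranges (0, 0.486] and [1, ∞) are exhausted by compact
intervals, on which the kernel constants do not depend on the endpoints. -/
theorem lintegral_halfWeight_mul_enorm_sq_le {ε : ℝ} (hε : 0 < ε) {σ : ℝ} (hσ : σ = 1 ∨ σ = -1)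
    {x : ℝ → ℝ} (hx : Measurable x) {g : ℝ → ℂ} (hgm : Measurable g) (hg : Integrable g) :
    ∫⁻ ξ, ENNReal.ofReal (1 / √√ε) * halfWeight (σ * (√ε * ξ)) *
        ‖∫ t, Complex.exp (Complex.I * ((x t * ξ + t * phase ε ξ : ℝ) : ℂ)) * g t‖ₑ ^ (2 : ℝ)
      ≤ 1260 * (∫⁻ t, ‖g t‖ₑ ^ (4 / 3 : ℝ)) ^ (3 / 2 : ℝ) := by
  set F : ℝ → ℝ≥0∞ := fun ξ =>
    ‖∫ t, Complex.exp (Complex.I * ((x t * ξ + t * phase ε ξ : ℝ) : ℂ)) * g t‖ₑ ^ (2 : ℝ) with hF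
  set K := ENNReal.ofReal 14 * (30 * (∫⁻ t, ‖g t‖ₑ ^ (4 / 3 : ℝ)) ^ (3 / 2 : ℝ)) with hK
  have hFm : Measurable F := by
    have h1 : StronglyMeasurable fun ξ =>
        ∫ t, Complex.exp (Complex.I * ((x t * ξ + t * phase ε ξ : ℝ) : ℂ)) * g t := by
      refine StronglyMeasurable.integral_prod_right' (f := fun z : ℝ × ℝ =>
        Complex.exp (Complex.I * ((x z.2 * z.1 + z.2 * phase ε z.1 : ℝ) : ℂ)) * g z.2) ?_
      apply Measurable.stronglyMeasurable
      simp only [phase]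
      fun_prop
    exact h1.measurable.enorm.pow_const _
  have hsc : ∀ y : ℝ, ENNReal.ofReal (y / √√ε) = ENNReal.ofReal (1 / √√ε) * ENNReal.ofReal y := by
    intro y
    rw [← ENNReal.ofReal_mul (by positivity)]
    congr 1; ring
  set k := ENNReal.ofReal (1 / √√ε) with hk
  have hℓ : Measurable fun ξ : ℝ => σ * (√ε * ξ) := by fun_prop
  -- the three ranges of frequencies
  have low : ∫⁻ ξ, (Set.Ioc 0 0.486).indicator (fun z => k * ENNReal.ofReal √z) (σ * (√ε * ξ))
      * F ξ ≤ K := by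
    have hU : Set.Ioc (0 : ℝ) 0.486 = ⋃ n : ℕ, Set.Icc (0.486 / ((n : ℝ) + 1)) 0.486 := by
      ext z
      simp only [Set.mem_Ioc, Set.mem_iUnion, Set.mem_Icc]
      constructor
      · rintro ⟨h0, h1⟩
        obtain ⟨n, hn⟩ := exists_nat_gt (0.486 / z)
        refine ⟨n, ?_, h1⟩
        rw [div_lt_iff₀ h0] at hn
        rw [div_le_iff₀ (by positivity)]
        nlinarith
      · rintro ⟨n, h0, h1⟩
        exact ⟨lt_of_lt_of_le (by positivity) h0, h1⟩
    rw [hU]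
    refine lintegral_indicator_iUnion_mul_le ?_ (by fun_prop) hℓ hFm fun n => ?_
    · intro n m hnm
      apply Set.Icc_subset_Icc_left
      have : (n : ℝ) ≤ m := by exact_mod_cast hnm
      gcongr
    · have hc : 0 < 0.486 / ((n : ℝ) + 1) := by positivity
      have hcd : 0.486 / ((n : ℝ) + 1) ≤ 0.486 := div_le_self (by norm_num) (by
        have : (0 : ℝ) ≤ n := n.cast_nonneg
        linarith)
      have := lintegral_indicator_Icc_mul_enorm_sq_le hcd (by norm_num : (0 : ℝ) < 14)
        Real.continuous_sqrt.continuousOn (fun z _ => Real.sqrt_nonneg z)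
        (fun t w ht => norm_kernel_low_le ht hc hcd le_rfl) hε hσ hx hgm hg
      simpa only [hsc] using this
  have mid : ∫⁻ ξ, (Set.Icc 0.61 1).indicator (fun _ => k * 1) (σ * (√ε * ξ)) * F ξ ≤ K := by
    have := lintegral_indicator_Icc_mul_enorm_sq_le (a := fun _ => 1) (c := 0.61) (d := 1)
      (by norm_num) (by norm_num : (0 : ℝ) < 14) continuousOn_const (fun _ _ => zero_le_one)
      (fun t w ht => norm_kernel_mid_le ht le_rfl (by norm_num)) hε hσ hx hgm hg
    simpa only [hsc, ENNReal.ofReal_one] using this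
  have high : ∫⁻ ξ, (Set.Ici 1).indicator (fun z => k * ENNReal.ofReal √z) (σ * (√ε * ξ))
      * F ξ ≤ K := by
    have hU : Set.Ici (1 : ℝ) = ⋃ n : ℕ, Set.Icc (1 : ℝ) ((n : ℝ) + 1) := by
      ext z
      simp only [Set.mem_Ici, Set.mem_iUnion, Set.mem_Icc]
      constructor
      · intro h1
        obtain ⟨n, hn⟩ := exists_nat_ge z
        exact ⟨n, h1, by linarith⟩
      · rintro ⟨n, h0, _⟩
        exact h0
    rw [hU]
    refine lintegral_indicator_iUnion_mul_le ?_ (by fun_prop) hℓ hFm fun n => ?_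
    · intro n m hnm
      apply Set.Icc_subset_Icc_right
      have : (n : ℝ) ≤ m := by exact_mod_cast hnm
      linarith
    · have hcd : (1 : ℝ) ≤ (n : ℝ) + 1 := by
        have : (0 : ℝ) ≤ n := n.cast_nonneg
        linarith
      have := lintegral_indicator_Icc_mul_enorm_sq_le hcd (by norm_num : (0 : ℝ) < 14)
        Real.continuous_sqrt.continuousOn (fun z _ => Real.sqrt_nonneg z)
        (fun t w ht => norm_kernel_high_le ht le_rfl hcd) hε hσ hx hgm hg
      simpa only [hsc] using this
  have hexp : ∀ ξ, k * halfWeight (σ * (√ε * ξ)) * F ξ =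
      (Set.Ioc 0 0.486).indicator (fun z => k * ENNReal.ofReal √z) (σ * (√ε * ξ)) * F ξ +
      ((Set.Icc 0.61 1).indicator (fun _ => k * 1) (σ * (√ε * ξ)) * F ξ +
      (Set.Ici 1).indicator (fun z => k * ENNReal.ofReal √z) (σ * (√ε * ξ)) * F ξ) := by
    intro ξ
    have hi : ∀ (s : Set ℝ) (f : ℝ → ℝ≥0∞) (z : ℝ),
        s.indicator (fun z => k * f z) z = k * s.indicator f z := by
      intro s f z
      by_cases h : z ∈ s <;> simp [h]
    rw [halfWeight, hi, hi, hi]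
    ring
  change ∫⁻ ξ, k * halfWeight (σ * (√ε * ξ)) * F ξ ≤ _
  simp only [hexp]
  rw [lintegral_add_left, lintegral_add_left]
  · refine (add_le_add low (add_le_add mid high)).trans (le_of_eq ?_)
    rw [hK, show ENNReal.ofReal 14 = 14 by simp]
    ring
  · exact ((Measurable.indicator (by fun_prop) measurableSet_Icc).comp hℓ).mul hFm
  · exact ((Measurable.indicator (by fun_prop) measurableSet_Ioc).comp hℓ).mul hFm

/-- A bound for `F (t, x (t))` uniform in measurable `x` controls the mixed norm with the
supremum in the second variable. -/
theorem lintegral_eLpNorm_top_rpow_le {F : ℝ → ℝ → ℂ} (hF : Continuous (Function.uncurry F))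
    {q : ℝ} (hq : 0 < q) {K : ℝ≥0∞}
    (h : ∀ x : ℝ → ℝ, Measurable x → ∫⁻ t, ‖F t (x t)‖ₑ ^ q ≤ K) :
    ∫⁻ t, eLpNorm (F t) ⊤ volume ^ q ≤ K := by
  classical
  set D : ℕ → ℝ := TopologicalSpace.denseSeq ℝ with hD
  -- A measurable near-maximizer: x n t is one of the first n + 1 points of a dense sequence, the
  -- one where |F t| is largest. The values increase with n, and by continuity in x their supremum
  -- bounds |F t| everywhere.
  let x : ℕ → ℝ → ℝ := fun n => Nat.rec (fun _ => D 0)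
    (fun n y t => if ‖F t (y t)‖ₑ < ‖F t (D (n + 1))‖ₑ then D (n + 1) else y t) n
  have hx0 : x 0 = fun _ => D 0 := rfl
  have hxs : ∀ n, x (n + 1) =
      fun t => if ‖F t (x n t)‖ₑ < ‖F t (D (n + 1))‖ₑ then D (n + 1) else x n t := fun n => rfl
  have hFm : ∀ y : ℝ → ℝ, Measurable y → Measurable fun t => ‖F t (y t)‖ₑ := fun y hy =>
    (hF.measurable.comp (measurable_id.prodMk hy)).enorm
  have hxm : ∀ n, Measurable (x n) := by
    intro n
    induction n with
    | zero => rw [hx0]; exact measurable_const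
    | succ n ih =>
      rw [hxs]
      exact Measurable.ite (measurableSet_lt (hFm _ ih) (hFm _ measurable_const))
        measurable_const ih
  have hstep : ∀ n t, ‖F t (x n t)‖ₑ ≤ ‖F t (x (n + 1) t)‖ₑ := by
    intro n t
    rw [hxs]
    by_cases hc : ‖F t (x n t)‖ₑ < ‖F t (D (n + 1))‖ₑ
    · simp only [if_pos hc]; exact hc.le
    · simp only [if_neg hc]; exact le_rfl
  have hD' : ∀ n t, ‖F t (D n)‖ₑ ≤ ‖F t (x n t)‖ₑ := by
    intro n t
    cases n with
    | zero => rw [hx0]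
    | succ n =>
      rw [hxs]
      by_cases hc : ‖F t (x n t)‖ₑ < ‖F t (D (n + 1))‖ₑ
      · simp only [if_pos hc]; exact le_rfl
      · simp only [if_neg hc]; exact not_lt.1 hc
  have hsup : ∀ t, eLpNorm (F t) ⊤ volume ^ q ≤ ⨆ n, ‖F t (x n t)‖ₑ ^ q := by
    intro t
    have hFt : Continuous fun y => ‖F t y‖ₑ := by
      have : Continuous (F t) := hF.comp (by fun_prop : Continuous fun y : ℝ => (t, y))
      exact this.enorm
    have h1 : ∀ y, ‖F t y‖ₑ ^ q ≤ ⨆ n, ‖F t (x n t)‖ₑ ^ q := by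
      have hcl : IsClosed {y | ‖F t y‖ₑ ^ q ≤ ⨆ n, ‖F t (x n t)‖ₑ ^ q} :=
        isClosed_le (ENNReal.continuous_rpow_const.comp hFt) continuous_const
      have hsub : Set.range D ⊆ {y | ‖F t y‖ₑ ^ q ≤ ⨆ n, ‖F t (x n t)‖ₑ ^ q} := by
        rintro _ ⟨n, rfl⟩
        exact le_iSup_of_le (f := fun n => ‖F t (x n t)‖ₑ ^ q) n (ENNReal.rpow_le_rpow (hD' n t) hq.le)
      intro y
      exact hcl.closure_subset_iff.2 hsub (TopologicalSpace.denseRange_denseSeq ℝ y)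
    refine (ENNReal.le_rpow_inv_iff hq).1 ?_
    rw [eLpNorm_exponent_top]
    exact eLpNormEssSup_le_of_ae_enorm_bound
      (Filter.Eventually.of_forall fun y => (ENNReal.le_rpow_inv_iff hq).2 (h1 y))
  refine (lintegral_mono hsup).trans ?_
  rw [lintegral_iSup]
  · exact iSup_le fun n => h _ (hxm n)
  · exact fun n => (hFm _ (hxm n)).pow_const q
  · refine monotone_nat_of_le_succ fun n t => ENNReal.rpow_le_rpow (hstep n t) hq.le

/-- The symmetric weight on frequencies. -/
noncomputable def strichartzWeight (ε ξ : ℝ) : ℝ≥0∞ :=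
  ENNReal.ofReal (1 / √√ε) * halfWeight (1 * (√ε * ξ)) +
  ENNReal.ofReal (1 / √√ε) * halfWeight (-1 * (√ε * ξ))

theorem measurable_strichartzWeight (ε : ℝ) : Measurable (strichartzWeight ε) := by
  unfold strichartzWeight
  exact ((measurable_halfWeight.comp (by fun_prop)).const_mul _).add
    ((measurable_halfWeight.comp (by fun_prop)).const_mul _)

theorem continuous_integral_exp_mul {h : ℝ → ℂ} (hh : Integrable h) (ε : ℝ) :
    Continuous (Function.uncurry fun t x : ℝ =>
      ∫ ξ, Complex.exp (Complex.I * ((x * ξ + t * phase ε ξ : ℝ) : ℂ)) * h ξ) := by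
  refine continuous_of_dominated (bound := fun ξ => ‖h ξ‖) ?_ ?_ hh.norm ?_
  · intro z
    refine AEStronglyMeasurable.mul ?_ hh.aestronglyMeasurable
    apply Continuous.aestronglyMeasurable
    simp only [phase]
    fun_prop
  · intro z
    refine Filter.Eventually.of_forall fun ξ => ?_
    rw [norm_mul, norm_exp_I_mul_ofReal, one_mul]
  · refine Filter.Eventually.of_forall fun ξ => ?_
    fun_prop

/-- The Strichartz estimate for frequencies controlled by the weight. -/
theorem lintegral_eLpNorm_top_rpow_four_le {ε : ℝ} (hε : 0 < ε) {h : ℝ → ℂ} (hh : Integrable h)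
    {f : ℝ → ℝ≥0∞} (hf : AEMeasurable f)
    (hle : ∀ ξ, ‖h ξ‖ₑ ≤ f ξ * strichartzWeight ε ξ ^ (1 / 2 : ℝ)) :
    (∫⁻ t, eLpNorm (fun x => ∫ ξ, Complex.exp (Complex.I * ((x * ξ + t * phase ε ξ : ℝ) : ℂ))
      * h ξ) ⊤ volume ^ (4 : ℝ)) ^ (1 / 4 : ℝ)
      ≤ 2520 ^ (1 / 2 : ℝ) * (∫⁻ ξ, f ξ ^ (2 : ℝ)) ^ (1 / 2 : ℝ) := by
  rw [one_div, ENNReal.rpow_inv_le_iff (by norm_num)]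
  refine lintegral_eLpNorm_top_rpow_le (continuous_integral_exp_mul hh ε) (by norm_num) ?_
  intro x hx
  rw [← ENNReal.rpow_inv_le_iff (by norm_num), ← one_div (4 : ℝ)]
  have hθ : Measurable (Function.uncurry fun t ξ => x t * ξ + t * phase ε ξ) := by
    simp only [Function.uncurry_def, phase]
    fun_prop
  -- For q = 4 the dual exponent is 4/3 and the outer power 2(1 − 1/4) = 3/2, as in
  -- Hardy-Littlewood-Sobolev. The two signs of ξ double 1260.
  refine lintegral_enorm_rpow_le_of_adjoint (q := 4) (by norm_num) hθ hh hf
    (measurable_strichartzWeight ε).aemeasurable hle fun g hgm ⟨R, hgb⟩ ⟨R', hgs⟩ => ?_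
  have hgi : Integrable g :=
    memLp_one_iff_integrable.1 (memLp_of_bounded_of_eq_zero hgm hgb hgs 1)
  have hHm : Measurable fun ξ =>
      ‖∫ t, Complex.exp (Complex.I * ((x t * ξ + t * phase ε ξ : ℝ) : ℂ)) * g t‖ₑ ^ (2 : ℝ) := by
    have h1 : StronglyMeasurable fun ξ =>
        ∫ t, Complex.exp (Complex.I * ((x t * ξ + t * phase ε ξ : ℝ) : ℂ)) * g t := by
      refine StronglyMeasurable.integral_prod_right' (f := fun z : ℝ × ℝ =>
        Complex.exp (Complex.I * ((x z.2 * z.1 + z.2 * phase ε z.1 : ℝ) : ℂ)) * g z.2) ?_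
      apply Measurable.stronglyMeasurable
      simp only [phase]
      fun_prop
    exact h1.measurable.enorm.pow_const _
  simp only [strichartzWeight, add_mul]
  rw [lintegral_add_left]
  · refine (add_le_add (lintegral_halfWeight_mul_enorm_sq_le hε (Or.inl rfl) hx hgm hgi)
      (lintegral_halfWeight_mul_enorm_sq_le hε (Or.inr rfl) hx hgm hgi)).trans (le_of_eq ?_)
    rw [← add_mul]
    norm_num
  · exact ((measurable_halfWeight.comp (by fun_prop)).const_mul _).mul hHm

/-! ### Fourier multipliers on Schwartz functions -/

theorem hasTemperateGrowth_exp_I_mul :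
    (fun x : ℝ => Complex.exp (Complex.I * (x : ℂ))).HasTemperateGrowth := by
  have hd : ∀ n : ℕ, iteratedDeriv n (fun x : ℝ => Complex.exp (Complex.I * (x : ℂ)))
      = fun x : ℝ => Complex.I ^ n * Complex.exp (Complex.I * (x : ℂ)) := by
    intro n
    induction n with
    | zero => simp
    | succ n ih =>
      rw [iteratedDeriv_succ, ih]
      ext x
      have h1 : HasDerivAt (fun x : ℝ => Complex.exp (Complex.I * (x : ℂ)))
          (Complex.exp (Complex.I * (x : ℂ)) * (Complex.I * 1)) x :=
        ((Complex.ofRealCLM.hasDerivAt (x := x)).const_mul Complex.I).cexp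
      rw [(h1.const_mul (Complex.I ^ n)).deriv]
      ring
  refine ⟨(contDiff_const.mul Complex.ofRealCLM.contDiff).cexp, fun n => ⟨0, 1, fun x => ?_⟩⟩
  rw [norm_iteratedFDeriv_eq_norm_iteratedDeriv, hd]
  simp

theorem hasTemperateGrowth_exp_phase (ε t : ℝ) : (fun v : ℝ =>
    Complex.exp (Complex.I * (t * phase ε (2 * Real.pi * v) : ℝ))).HasTemperateGrowth := by
  refine hasTemperateGrowth_exp_I_mul.comp (f := fun v => t * phase ε (2 * Real.pi * v)) ?_
  simp only [phase]
  fun_prop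

/-- A multiplier with a symbol of temperate growth preserves Schwartz functions. -/
theorem exists_schwartzMap_eq_fourierMul {m : ℝ → ℂ}
    (hm : (fun v => m (2 * Real.pi * v)).HasTemperateGrowth) (f : 𝓢(ℝ, ℂ)) :
    ∃ u : 𝓢(ℝ, ℂ), (u : ℝ → ℂ) = fourierMul m f ∧
      ∀ v, 𝓕 (u : ℝ → ℂ) v = m (2 * Real.pi * v) * 𝓕 (f : ℝ → ℂ) v := by
  set k := SchwartzMap.smulLeftCLM ℂ (fun v => m (2 * Real.pi * v)) (𝓕 f) with hk
  have hka : ∀ v, k v = m (2 * Real.pi * v) * 𝓕 (f : ℝ → ℂ) v := fun v => by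
    rw [hk, SchwartzMap.smulLeftCLM_apply_apply hm, smul_eq_mul, SchwartzMap.fourier_coe]
  refine ⟨𝓕⁻ k, ?_, fun v => ?_⟩
  · rw [SchwartzMap.fourierInv_coe, fourierMul]
    congr 1
    ext v
    exact hka v
  · rw [← SchwartzMap.fourier_coe, FourierTransform.fourier_fourierInv_eq, hka]

theorem fourierMul_apply (m : ℝ → ℂ) (f : ℝ → ℂ) (x : ℝ) :
    fourierMul m f x = (2 * Real.pi : ℝ)⁻¹ • ∫ ξ, Complex.exp (Complex.I * (x * ξ : ℝ)) *
      (m ξ * 𝓕 f (ξ / (2 * Real.pi))) := by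
  have hpi : 0 < 2 * Real.pi := by positivity
  have h := Measure.integral_comp_mul_left (fun ξ => Complex.exp (Complex.I * (x * ξ : ℝ)) *
      (m ξ * 𝓕 f (ξ / (2 * Real.pi)))) (2 * Real.pi)
  rw [abs_of_pos (inv_pos.2 hpi)] at h
  rw [← h, fourierMul, Real.fourierInv_eq']
  refine integral_congr_ae (Filter.Eventually.of_forall fun v => ?_)
  simp only [smul_eq_mul]
  rw [mul_div_cancel_left₀ _ hpi.ne', mul_comm Complex.I]
  congr 4
  simp
  ring

/-- Only the inner symbol must have temperate growth: it keeps the function Schwartz, so Fourier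
inversion applies before the next multiplier. The outermost symbol may be rough, which admits
|ξ|^{1/4}. -/
theorem fourierMul_fourierMul {m : ℝ → ℂ} (hm : (fun v => m (2 * Real.pi * v)).HasTemperateGrowth)
    (m' : ℝ → ℂ) (f : 𝓢(ℝ, ℂ)) :
    fourierMul m' (fourierMul m f) = fourierMul (fun ξ => m' ξ * m ξ) f := by
  obtain ⟨u, hu, huf⟩ := exists_schwartzMap_eq_fourierMul hm f
  rw [← hu, fourierMul, fourierMul]
  congr 1
  ext v
  rw [huf, ← mul_assoc]

theorem fourierMul_deriv_fourierMul {m : ℝ → ℂ}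
    (hm : (fun v => m (2 * Real.pi * v)).HasTemperateGrowth) (m' : ℝ → ℂ) (f : 𝓢(ℝ, ℂ)) :
    fourierMul m' (deriv (fourierMul m f))
      = fourierMul (fun ξ => m' ξ * (Complex.I * ξ * m ξ)) f := by
  obtain ⟨u, hu, huf⟩ := exists_schwartzMap_eq_fourierMul hm f
  rw [← hu, fourierMul, fourierMul]
  have hd : 𝓕 (deriv (u : ℝ → ℂ)) = fun v : ℝ => (2 * Real.pi * Complex.I * v) • 𝓕 (u : ℝ → ℂ) v :=
    Real.fourier_deriv u.integrable u.differentiable (SchwartzMap.derivCLM ℂ ℂ u).integrable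
  congr 1
  ext v
  rw [hd]
  simp only [huf, smul_eq_mul]
  push_cast
  ring

/-- The Fourier transform in the angular frequency, with the normalization of the inversion
formula. -/
noncomputable def angularFourier (f : ℝ → ℂ) (ξ : ℝ) : ℂ :=
  ((2 * Real.pi)⁻¹ : ℝ) * 𝓕 f (ξ / (2 * Real.pi))

theorem fourierMul_eq_integral_angularFourier (m : ℝ → ℂ) (f : ℝ → ℂ) (x : ℝ) :
    fourierMul m f x
      = ∫ ξ, Complex.exp (Complex.I * (x * ξ : ℝ)) * (m ξ * angularFourier f ξ) := by
  rw [fourierMul_apply, Complex.real_smul, ← integral_const_mul]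
  refine integral_congr_ae (Filter.Eventually.of_forall fun ξ => ?_)
  simp only [angularFourier]
  ring

theorem continuous_angularFourier (f : 𝓢(ℝ, ℂ)) : Continuous (angularFourier f) := by
  have h : Continuous (𝓕 (f : ℝ → ℂ)) := by
    rw [← SchwartzMap.fourier_coe]
    exact (𝓕 f).continuous
  unfold angularFourier
  exact continuous_const.mul (h.comp (by fun_prop))

/-- Linear growth is enough for all three symbols; the derivative in the local smoothing estimate
uses it fully. -/
theorem integrable_mul_angularFourier {m : ℝ → ℂ} (hm : Measurable m) {C : ℝ}
    (hC : ∀ ξ, ‖m ξ‖ ≤ C * (1 + |ξ|)) (f : 𝓢(ℝ, ℂ)) :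
    Integrable fun ξ => m ξ * angularFourier f ξ := by
  have hpi : 0 < 2 * Real.pi := by positivity
  have h0 : Integrable fun v : ℝ => ‖v‖ ^ 0 * ‖(𝓕 f) v‖ := (𝓕 f).integrable_pow_mul volume 0
  have h1 : Integrable fun v : ℝ => ‖v‖ ^ 1 * ‖(𝓕 f) v‖ := (𝓕 f).integrable_pow_mul volume 1
  have h2 : Integrable fun v : ℝ => (C * (1 + 2 * Real.pi * |v|) * (2 * Real.pi)⁻¹) *
      ‖(𝓕 f) v‖ := by
    refine ((h0.const_mul (C * (2 * Real.pi)⁻¹)).add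
      (h1.const_mul (C * (2 * Real.pi) * (2 * Real.pi)⁻¹))).congr
      (Filter.Eventually.of_forall fun v => ?_)
    simp only [Pi.add_apply, Real.norm_eq_abs]
    ring
  refine (h2.comp_div hpi.ne').mono' ?_ (Filter.Eventually.of_forall fun ξ => ?_)
  · exact hm.aestronglyMeasurable.mul (continuous_angularFourier f).aestronglyMeasurable
  · rw [norm_mul, angularFourier, norm_mul, Complex.norm_real, Real.norm_of_nonneg (by positivity),
      abs_div, abs_of_pos hpi, mul_div_cancel₀ _ hpi.ne', SchwartzMap.fourier_coe, ← mul_assoc]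
    gcongr
    exact hC ξ

/-- By Plancherel the squared norms differ by the factor 1/(2π), which is simply bounded by 1. -/
theorem lintegral_enorm_angularFourier_sq_le (f : 𝓢(ℝ, ℂ)) :
    (∫⁻ ξ, ‖angularFourier f ξ‖ₑ ^ (2 : ℝ)) ^ (1 / 2 : ℝ) ≤ eLpNorm f 2 volume := by
  have hpi : 0 < 2 * Real.pi := by positivity
  have hcv := lintegral_image_eq_lintegral_abs_deriv_mul (s := Set.univ)
    (f := fun ξ : ℝ => ξ / (2 * Real.pi)) (f' := fun _ => 1 / (2 * Real.pi)) MeasurableSet.univ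
    (fun ξ _ => ((hasDerivAt_id ξ).div_const _).hasDerivWithinAt)
    (fun ξ _ ξ' _ h => by simpa [hpi.ne'] using h) (fun v => ‖𝓕 (f : ℝ → ℂ) v‖ₑ ^ (2 : ℝ))
  rw [eLpNorm_two_eq_lintegral]
  gcongr ?_ ^ _
  rw [← lintegral_enorm_fourier_sq_eq f.integrable (f.memLp 2 volume)]
  have hone : ENNReal.ofReal |1 / (2 * Real.pi)| ≤ 1 := by
    rw [abs_of_pos (by positivity), ← ENNReal.ofReal_one]
    apply ENNReal.ofReal_le_ofReal
    rw [div_le_one hpi]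
    linarith [Real.pi_gt_three]
  calc ∫⁻ ξ, ‖angularFourier f ξ‖ₑ ^ (2 : ℝ)
      = ∫⁻ ξ, ENNReal.ofReal |1 / (2 * Real.pi)| * (ENNReal.ofReal |1 / (2 * Real.pi)| *
          ‖𝓕 (f : ℝ → ℂ) (ξ / (2 * Real.pi))‖ₑ ^ (2 : ℝ)) := by
        refine lintegral_congr fun ξ => ?_
        rw [angularFourier, enorm_mul, ENNReal.mul_rpow_of_nonneg _ _ (by norm_num), ← mul_assoc]
        congr 1
        rw [← ofReal_norm, Complex.norm_real, Real.norm_eq_abs, one_div]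
        rw [show (2 : ℝ) = ((2 : ℕ) : ℝ) by norm_num, ENNReal.rpow_natCast, sq]
    _ ≤ 1 * ∫⁻ ξ, ENNReal.ofReal |1 / (2 * Real.pi)| *
          ‖𝓕 (f : ℝ → ℂ) (ξ / (2 * Real.pi))‖ₑ ^ (2 : ℝ) := by
        rw [lintegral_const_mul' _ _ ENNReal.ofReal_ne_top]
        gcongr
    _ ≤ ∫⁻ v, ‖𝓕 (f : ℝ → ℂ) v‖ₑ ^ (2 : ℝ) := by
        rw [one_mul]
        rw [setLIntegral_univ] at hcv
        rw [← hcv]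
        exact setLIntegral_le_lintegral _ _

theorem lintegral_const_mul_enorm_angularFourier_sq_le (C : ℝ≥0∞) (f : 𝓢(ℝ, ℂ)) :
    (∫⁻ ξ, (C * ‖angularFourier f ξ‖ₑ) ^ (2 : ℝ)) ^ (1 / 2 : ℝ) ≤ C * eLpNorm f 2 volume := by
  have h : ∀ ξ, (C * ‖angularFourier f ξ‖ₑ) ^ (2 : ℝ)
      = C ^ (2 : ℝ) * ‖angularFourier f ξ‖ₑ ^ (2 : ℝ) := fun ξ =>
    ENNReal.mul_rpow_of_nonneg _ _ (by norm_num)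
  simp only [h]
  rw [lintegral_const_mul _ ((continuous_angularFourier f).measurable.enorm.pow_const _),
    ENNReal.mul_rpow_of_nonneg _ _ (by norm_num), ← ENNReal.rpow_mul]
  norm_num
  gcongr
  simpa using lintegral_enorm_angularFourier_sq_le f

/-! ### The cut-off -/

theorem IsCutoff.hasCompactSupport {ψ : ℝ → ℝ} (hψ : IsCutoff ψ) : HasCompactSupport ψ :=
  isCompact_Icc.of_isClosed_subset (isClosed_tsupport ψ) hψ.tsupport_subset

theorem IsCutoff.eq_zero {ψ : ℝ → ℝ} (hψ : IsCutoff ψ) {x : ℝ} (hx : 3 / 2 < |x|) : ψ x = 0 := by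
  refine image_eq_zero_of_notMem_tsupport fun h => ?_
  exact absurd (abs_le.2 (hψ.tsupport_subset h)) (not_le.2 hx)

theorem IsCutoff.exists_bound {ψ : ℝ → ℝ} (hψ : IsCutoff ψ) :
    ∃ M : ℝ, 0 ≤ M ∧ ∀ x, |ψ x| ≤ M ∧ |1 - ψ x| ≤ M := by
  obtain ⟨C, hC⟩ := hψ.hasCompactSupport.exists_bound_of_continuous hψ.smooth.continuous
  have hC0 : 0 ≤ C := (norm_nonneg _).trans (hC 0)
  refine ⟨1 + C, by positivity, fun x => ⟨?_, ?_⟩⟩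
  · have := hC x
    rw [Real.norm_eq_abs] at this
    linarith
  · have := hC x
    rw [Real.norm_eq_abs] at this
    calc |1 - ψ x| ≤ |1| + |ψ x| := abs_sub _ _
      _ ≤ 1 + C := by rw [abs_one]; linarith

theorem IsCutoff.five_fourths_lt {ψ : ℝ → ℝ} (hψ : IsCutoff ψ) {x : ℝ} (hx : 1 - ψ x ≠ 0) :
    5 / 4 < |x| := by
  by_contra h
  apply hx
  rw [hψ.eq_one x (abs_le.1 (not_lt.1 h)), sub_self]

/-- P_B stands between the free evolution and D^{1/4}, so its symbol has to be smooth in spite of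
|ξ|. It is: the bumps at ±√(3/(10ε)) have disjoint supports that avoid 0, since √ε·√(3/(10ε)) ≥ 1/2
puts the argument of ψ beyond 3/2 on the wrong side. Hence the cut-off in |ξ| is a sum of two
shifted copies of ψ. -/
theorem IsCutoff.hasTemperateGrowth_PB {ψ : ℝ → ℝ} (hψ : IsCutoff ψ) {ε : ℝ} (hε : 0 < ε) :
    (fun v : ℝ => ((1 - ψ (20 * √ε * (|2 * Real.pi * v| - √(3 / (10 * ε)))) : ℝ) :
      ℂ)).HasTemperateGrowth := by
  set r := √(3 / (10 * ε)) with hr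
  have hδ : 0 < √ε := Real.sqrt_pos.2 hε
  have hpi : 0 < 2 * Real.pi := by positivity
  have hδr : 1 / 2 ≤ √ε * r := by
    rw [hr, ← Real.sqrt_mul hε.le]
    apply Real.le_sqrt_of_sq_le
    have : ε * (3 / (10 * ε)) = 3 / 10 := by field_simp
    rw [this]
    norm_num
  have hlin : ∀ σ : ℝ,
      (fun v : ℝ => ψ (20 * √ε * (σ * (2 * Real.pi) * v - r))).HasTemperateGrowth := by
    intro σ
    refine (hψ.hasCompactSupport.hasTemperateGrowth hψ.smooth).comp
      (f := fun v : ℝ => 20 * √ε * (σ * (2 * Real.pi) * v - r)) ?_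
    fun_prop
  have hsum : ∀ v : ℝ, ψ (20 * √ε * (|2 * Real.pi * v| - r)) =
      ψ (20 * √ε * (1 * (2 * Real.pi) * v - r)) + ψ (20 * √ε * (-1 * (2 * Real.pi) * v - r)) := by
    intro v
    have key : ∀ y, 0 ≤ y → ψ (20 * √ε * (-y - r)) = 0 := by
      intro y hy
      apply hψ.eq_zero
      rw [lt_abs]
      right
      have : 0 ≤ √ε * y := by positivity
      nlinarith
    rcases le_total 0 v with hv | hv
    · rw [abs_of_nonneg (by positivity), one_mul,
        show -1 * (2 * Real.pi) * v = -(2 * Real.pi * v) by ring, key _ (by positivity), add_zero]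
    · have h2 : 0 ≤ -(2 * Real.pi * v) := by nlinarith
      have h3 := key _ h2
      rw [neg_neg] at h3
      rw [abs_of_nonpos (by linarith), one_mul, h3, zero_add]
      congr 3
      ring
  have hfun : (fun v : ℝ => ((1 - ψ (20 * √ε * (|2 * Real.pi * v| - r)) : ℝ) : ℂ)) =
      Complex.ofReal ∘ fun v : ℝ => 1 - (ψ (20 * √ε * (1 * (2 * Real.pi) * v - r)) +
        ψ (20 * √ε * (-1 * (2 * Real.pi) * v - r))) := by
    ext v
    rw [Function.comp_apply, hsum]
  rw [hfun]
  exact Complex.ofRealCLM.hasTemperateGrowth.comp ((Function.HasTemperateGrowth.const 1).sub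
    ((hlin 1).add (hlin (-1))))

/-! ### Local smoothing -/

theorem measurable_phase (ε : ℝ) : Measurable (phase ε) := by
  unfold phase
  fun_prop

/-- The local smoothing estimate. -/
theorem normLxLt_PA_deriv_U_le {ψ : ℝ → ℝ} (hψ : IsCutoff ψ) {M : ℝ} (hM0 : 0 ≤ M)
    (hM : ∀ x, |1 - ψ x| ≤ M) {ε : ℝ} (hε : 0 < ε) (φ : 𝓢(ℝ, ℂ)) :
    normLxLt ⊤ 2 Set.univ (fun t => PA ψ ε (deriv (U ε t φ)))
      ≤ ENNReal.ofReal (8 * Real.pi) ^ (1 / 2 : ℝ) * ENNReal.ofReal (4 * M) *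
        eLpNorm φ 2 volume := by
  set r := √(3 / (5 * ε)) with hr
  have hδ : 0 < √ε := Real.sqrt_pos.2 hε
  have hδ2 : √ε ^ 2 = ε := Real.sq_sqrt hε.le
  have hr0 : 0 < r := Real.sqrt_pos.2 (by positivity)
  have hr2 : 5 * ε * r ^ 2 = 3 := by
    rw [hr, Real.sq_sqrt (by positivity)]
    field_simp
  have hδr : 3 / 4 ≤ √ε * r := by
    rw [hr, ← Real.sqrt_mul hε.le]
    apply Real.le_sqrt_of_sq_le
    have : ε * (3 / (5 * ε)) = 3 / 5 := by field_simp
    rw [this]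
    norm_num
  set a : ℝ → ℝ := fun ξ => 1 - ψ (20 * √ε * (|ξ| - r)) with ha
  have ham : Measurable a := by
    have := hψ.smooth.continuous.measurable
    simp only [ha]
    fun_prop
  -- Where a ≠ 0, √ε ||ξ| − r| exceeds (5/4)/20 = 1/16, and √ε(|ξ| + r) ≥ 3/4. So |3 − 5εξ²| ≥ 15/64
  -- ≥ 1/16, and |ξ|/4 ≤ √|p'(ξ)|.
  have habs : ∀ ξ, |a ξ| * |ξ| ≤ 4 * M * √|ξ ^ 2 * (3 - 5 * ε * ξ ^ 2)| := by
    intro ξ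
    rcases eq_or_ne (a ξ) 0 with h0 | h0
    · rw [h0, abs_zero, zero_mul]; positivity
    have h1 := hψ.five_fourths_lt h0
    rw [abs_mul, abs_of_pos (show 0 < 20 * √ε by positivity)] at h1
    have h2 : 1 / 16 ≤ √ε * |(|ξ| - r)| := by linarith
    have hfac : 3 - 5 * ε * ξ ^ 2 = -5 * ((√ε * (|ξ| - r)) * (√ε * (|ξ| + r))) := by
      have : ξ ^ 2 = |ξ| ^ 2 := (sq_abs ξ).symm
      rw [this]
      linear_combination -hr2 + (5 * (|ξ| ^ 2 - r ^ 2)) * hδ2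
    have h3 : 1 / 16 ≤ |3 - 5 * ε * ξ ^ 2| := by
      rw [hfac, abs_mul, abs_mul, abs_mul, abs_of_pos hδ,
        abs_of_nonneg (show 0 ≤ √ε * (|ξ| + r) by positivity), abs_neg, abs_of_pos (by norm_num)]
      have h4 : 3 / 4 ≤ √ε * (|ξ| + r) := by nlinarith [abs_nonneg ξ]
      nlinarith
    have h5 : |ξ| / 4 ≤ √|ξ ^ 2 * (3 - 5 * ε * ξ ^ 2)| := by
      apply Real.le_sqrt_of_sq_le
      rw [abs_mul, abs_of_nonneg (sq_nonneg ξ), div_pow, sq_abs]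
      nlinarith [sq_nonneg ξ]
    calc |a ξ| * |ξ| ≤ M * |ξ| := by gcongr; exact hM _
      _ = 4 * M * (|ξ| / 4) := by ring
      _ ≤ _ := by gcongr
  set m : ℝ → ℂ := fun ξ => (a ξ : ℂ) * (Complex.I * ξ) with hm
  have hmm : Measurable m := by simp only [hm]; fun_prop
  have hmn : ∀ ξ, ‖m ξ‖ = |a ξ| * |ξ| := fun ξ => by simp [hm]
  have hmb : ∀ ξ, ‖m ξ‖ ≤ M * (1 + |ξ|) := by
    intro ξ
    rw [hmn]
    gcongr
    · exact hM _
    · linarith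
  have hform : ∀ t x, PA ψ ε (deriv (U ε t φ)) x = ∫ ξ, Complex.exp (Complex.I *
      ((t * phase ε ξ : ℝ) : ℂ)) * (Complex.exp (Complex.I * (x * ξ : ℝ)) *
        (m ξ * angularFourier φ ξ)) := by
    intro t x
    rw [PA, U, fourierMul_deriv_fourierMul (hasTemperateGrowth_exp_phase ε t),
      fourierMul_eq_integral_angularFourier]
    refine integral_congr_ae (Filter.Eventually.of_forall fun ξ => ?_)
    simp only [hm]
    ring
  have hint := integrable_mul_angularFourier hmm hmb φ
  rw [normLxLt, eLpNorm_exponent_top]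
  refine eLpNormEssSup_le_of_ae_enorm_bound (Filter.Eventually.of_forall fun x => ?_)
  rw [enorm_eq_self, Measure.restrict_univ, eLpNorm_two_eq_lintegral]
  simp only [hform]
  have hem : Measurable fun ξ : ℝ => Complex.exp (Complex.I * (x * ξ : ℝ)) := by fun_prop
  have hθ : Measurable (Function.uncurry fun t ξ => t * phase ε ξ) :=
    measurable_fst.mul ((measurable_phase ε).comp measurable_snd)
  refine (lintegral_enorm_rpow_le_of_adjoint (q := 2) le_rfl hθ
    (h := fun ξ => Complex.exp (Complex.I * (x * ξ : ℝ)) * (m ξ * angularFourier φ ξ))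
    (f := fun ξ => ENNReal.ofReal (4 * M) * ‖angularFourier φ ξ‖ₑ)
    (w := fun ξ => ENNReal.ofReal |ξ ^ 2 * (3 - 5 * ε * ξ ^ 2)|)
    (A := ENNReal.ofReal (8 * Real.pi)) ?_ ?_ ?_ ?_ ?_).trans ?_
  · refine hint.mono (hem.aestronglyMeasurable.mul hint.aestronglyMeasurable)
      (Filter.Eventually.of_forall fun ξ => ?_)
    rw [norm_mul, norm_exp_I_mul_ofReal, one_mul]
  · exact ((continuous_angularFourier φ).measurable.enorm.const_mul _).aemeasurable
  · exact Measurable.aemeasurable (by fun_prop)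
  · intro ξ
    rw [enorm_mul, enorm_mul, ← ofReal_norm (Complex.exp _), norm_exp_I_mul_ofReal,
      ENNReal.ofReal_one, one_mul, ENNReal.ofReal_rpow_of_nonneg (abs_nonneg _) (by norm_num),
      ← Real.sqrt_eq_rpow, mul_right_comm, ← ENNReal.ofReal_mul (by positivity), ← ofReal_norm (m ξ),
      hmn]
    exact mul_le_mul' (ENNReal.ofReal_le_ofReal (habs ξ)) le_rfl
  · rintro g hgm ⟨R, hgb⟩ ⟨R', hgs⟩
    have hgi : Integrable g :=
      memLp_one_iff_integrable.1 (memLp_of_bounded_of_eq_zero hgm hgb hgs 1)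
    have hg2 : MemLp g 2 := memLp_of_bounded_of_eq_zero hgm hgb hgs 2
    have := lintegral_abs_deriv_phase_mul_enorm_sq_le hε hgi hg2
    norm_num
    norm_num at this
    exact this
  · rw [mul_assoc]
    gcongr
    exact lintegral_const_mul_enorm_angularFourier_sq_le _ φ

/-! ### Strichartz estimate -/

/-- Outside the gap around √(3/10) the weight dominates √z, which rescales to |ξ|^{1/2}, the square
of the symbol of D^{1/4}. -/
theorem rpow_half_le_halfWeight {z : ℝ} (hz : 0 < z) (h : z ≤ 0.486 ∨ 0.61 ≤ z) :
    ENNReal.ofReal √z ≤ halfWeight z := by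
  rw [halfWeight]
  rcases h with h | h
  · rw [Set.indicator_of_mem (show z ∈ Set.Ioc 0 0.486 from ⟨hz, h⟩)]
    exact le_self_add
  rcases le_total z 1 with h1 | h1
  · rw [Set.indicator_of_mem (show z ∈ Set.Icc 0.61 1 from ⟨h, h1⟩)]
    refine le_trans ?_ (le_add_self.trans' le_self_add)
    rw [← ENNReal.ofReal_one]
    apply ENNReal.ofReal_le_ofReal
    exact Real.sqrt_le_one.2 h1
  · rw [Set.indicator_of_mem (show z ∈ Set.Ici 1 from h1)]
    exact le_add_self.trans' le_add_self

/-- The Strichartz estimate. -/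
theorem normLtLx_D_PB_U_le {ψ : ℝ → ℝ} (hψ : IsCutoff ψ) {M : ℝ} (hM0 : 0 ≤ M)
    (hM : ∀ x, |1 - ψ x| ≤ M) {ε : ℝ} (hε : 0 < ε) (φ : 𝓢(ℝ, ℂ)) :
    normLtLx 4 ⊤ Set.univ (fun t => D (1 / 4) (PB ψ ε (U ε t φ)))
      ≤ 2520 ^ (1 / 2 : ℝ) * ENNReal.ofReal M * eLpNorm φ 2 volume := by
  set r := √(3 / (10 * ε)) with hr
  have hδ : 0 < √ε := Real.sqrt_pos.2 hε
  have hsd : 0 < √√ε := Real.sqrt_pos.2 hδ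
  have hδr : √ε * r = √(3 / 10) := by
    rw [hr, ← Real.sqrt_mul hε.le]
    congr 1
    field_simp
  have hlo : √(3 / 10) ≤ 0.548 := Real.sqrt_le_iff.2 ⟨by norm_num, by norm_num⟩
  have hhi : 0.5475 ≤ √(3 / 10) := Real.le_sqrt_of_sq_le (by norm_num)
  set b : ℝ → ℝ := fun ξ => 1 - ψ (20 * √ε * (|ξ| - r)) with hb
  have hbm : Measurable b := by
    have := hψ.smooth.continuous.measurable
    simp only [hb]
    fun_prop
  set m : ℝ → ℂ := fun ξ => ((|ξ| ^ (1 / 4 : ℝ) : ℝ) : ℂ) * (b ξ : ℂ) with hm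
  have hmm : Measurable m := by simp only [hm]; fun_prop
  have hmn : ∀ ξ, ‖m ξ‖ = |ξ| ^ (1 / 4 : ℝ) * |b ξ| := fun ξ => by
    rw [hm, norm_mul, Complex.norm_real, Complex.norm_real, Real.norm_of_nonneg (by positivity),
      Real.norm_eq_abs]
  have hmb : ∀ ξ, ‖m ξ‖ ≤ M * (1 + |ξ|) := by
    intro ξ
    rw [hmn, mul_comm]
    gcongr
    · exact hM _
    · rcases le_total |ξ| 1 with h | h
      · have := Real.rpow_le_one (abs_nonneg ξ) h (show (0 : ℝ) ≤ 1 / 4 by norm_num)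
        linarith [abs_nonneg ξ]
      · have := Real.rpow_le_rpow_of_exponent_le h (show (1 / 4 : ℝ) ≤ 1 by norm_num)
        rw [Real.rpow_one] at this
        linarith
  have hform : ∀ t x, D (1 / 4) (PB ψ ε (U ε t φ)) x = ∫ ξ, Complex.exp (Complex.I *
      ((x * ξ + t * phase ε ξ : ℝ) : ℂ)) * (m ξ * angularFourier φ ξ) := by
    intro t x
    obtain ⟨u, hu, -⟩ := exists_schwartzMap_eq_fourierMul
      (m := fun ξ => Complex.exp (Complex.I * (t * phase ε ξ : ℝ)))
      (hasTemperateGrowth_exp_phase ε t) φ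
    rw [D, PB, U, ← hu, fourierMul_fourierMul (hψ.hasTemperateGrowth_PB hε), hu,
      fourierMul_fourierMul (hasTemperateGrowth_exp_phase ε t),
      fourierMul_eq_integral_angularFourier]
    refine integral_congr_ae (Filter.Eventually.of_forall fun ξ => ?_)
    simp only [hm, hb]
    rw [Complex.ofReal_add, mul_add, Complex.exp_add]
    ring
  have hint := integrable_mul_angularFourier hmm hmb φ
  have hweight : ∀ ξ, ‖m ξ‖ₑ ≤ ENNReal.ofReal M * strichartzWeight ε ξ ^ (1 / 2 : ℝ) := by
    intro ξ
    rw [← ofReal_norm, hmn]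
    rcases eq_or_ne (b ξ) 0 with h0 | h0
    · rw [h0, abs_zero, mul_zero, ENNReal.ofReal_zero]; exact zero_le
    rcases eq_or_ne ξ 0 with hξ | hξ
    · rw [hξ, abs_zero, Real.zero_rpow (by norm_num), zero_mul, ENNReal.ofReal_zero]
      exact zero_le
    have hz0 : 0 < √ε * |ξ| := by positivity
    have h1 := hψ.five_fourths_lt h0
    rw [abs_mul, abs_of_pos (show 0 < 20 * √ε by positivity)] at h1
    have h2 : 1 / 16 < |√ε * |ξ| - √(3 / 10)| := by
      rw [← hδr, ← mul_sub, abs_mul, abs_of_pos hδ]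
      linarith
    -- With 0.5475 ≤ √(3/10) ≤ 0.548, a distance above 1/16 = 0.0625 lands outside (0.486, 0.61).
    have h3 : √ε * |ξ| ≤ 0.486 ∨ 0.61 ≤ √ε * |ξ| := by
      rcases lt_abs.1 h2 with h | h
      · right
        norm_num at h hhi ⊢
        linarith
      · left
        norm_num at h hlo ⊢
        linarith
    have h4 := rpow_half_le_halfWeight hz0 h3
    have h5 : ENNReal.ofReal (1 / √√ε) * halfWeight (√ε * |ξ|) ≤ strichartzWeight ε ξ := by
      rw [strichartzWeight]
      rcases abs_cases ξ with ⟨h, _⟩ | ⟨h, _⟩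
      · rw [h, one_mul]; exact le_self_add
      · rw [h, show √ε * -ξ = -1 * (√ε * ξ) by ring]; exact le_add_self
    have h6 : ENNReal.ofReal √|ξ| ≤ strichartzWeight ε ξ := by
      refine le_trans ?_ h5
      refine le_trans ?_ (mul_le_mul_right h4 _)
      rw [← ENNReal.ofReal_mul (by positivity), Real.sqrt_mul hδ.le]
      apply ENNReal.ofReal_le_ofReal
      apply le_of_eq
      field_simp
    rw [mul_comm, ENNReal.ofReal_mul (abs_nonneg _)]
    refine mul_le_mul' (ENNReal.ofReal_le_ofReal (hM _)) ?_
    refine le_trans (le_of_eq ?_) (ENNReal.rpow_le_rpow h6 (by norm_num))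
    rw [ENNReal.ofReal_rpow_of_nonneg (Real.sqrt_nonneg _) (by norm_num), Real.sqrt_eq_rpow,
      ← Real.rpow_mul (abs_nonneg _)]
    norm_num
  rw [normLtLx, Measure.restrict_univ,
    eLpNorm_eq_lintegral_rpow_enorm_toReal (by norm_num) (by norm_num)]
  simp only [enorm_eq_self, ENNReal.toReal_ofNat]
  have hfun : ∀ t, D (1 / 4) (PB ψ ε (U ε t φ)) = fun x => ∫ ξ, Complex.exp (Complex.I *
      ((x * ξ + t * phase ε ξ : ℝ) : ℂ)) * (m ξ * angularFourier φ ξ) :=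
    fun t => funext fun x => hform t x
  simp only [hfun]
  refine (lintegral_eLpNorm_top_rpow_four_le hε hint
    (f := fun ξ => ENNReal.ofReal M * ‖angularFourier φ ξ‖ₑ)
    ((continuous_angularFourier φ).measurable.enorm.const_mul _).aemeasurable ?_).trans ?_
  · intro ξ
    rw [enorm_mul, mul_right_comm]
    gcongr
    exact hweight ξ
  · rw [mul_assoc]
    gcongr
    exact lintegral_const_mul_enorm_angularFourier_sq_le _ φ

/-! ### Maximal function estimate -/

/-- Plancherel's inequality for an integral against `e^{ixξ}`. -/
theorem lintegral_enorm_integral_exp_sq_le {k : ℝ → ℂ} (h1 : Integrable k) (h2 : MemLp k 2) :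
    ∫⁻ x, ‖∫ ξ, Complex.exp (Complex.I * ((x * ξ : ℝ) : ℂ)) * k ξ‖ₑ ^ (2 : ℝ)
      ≤ ENNReal.ofReal (2 * Real.pi) * ∫⁻ ξ, ‖k ξ‖ₑ ^ (2 : ℝ) := by
  have h := setLIntegral_abs_deriv_mul_enorm_sq_le (S := Set.univ) (p := fun x => x)
    (p' := fun _ => 1) MeasurableSet.univ (fun x _ => hasDerivAt_id x) (fun _ _ _ _ h => h) h1 h2
  rw [setLIntegral_univ] at h
  simpa only [abs_one, ENNReal.ofReal_one, one_mul, mul_comm] using h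

theorem sq_lintegral_Icc_le {f : ℝ → ℝ≥0∞} (hf : Measurable f) :
    (∫⁻ s in Set.Icc (-1 : ℝ) 1, f s) ^ (2 : ℝ) ≤ 2 * ∫⁻ s in Set.Icc (-1 : ℝ) 1, f s ^ (2 : ℝ) := by
  have h := ENNReal.lintegral_mul_le_Lp_mul_Lq (volume.restrict (Set.Icc (-1 : ℝ) 1))
    Real.HolderConjugate.two_two hf.aemeasurable (aemeasurable_const (b := (1 : ℝ≥0∞)))
  have h' := ENNReal.rpow_le_rpow h (show (0 : ℝ) ≤ 2 by norm_num)
  rw [ENNReal.mul_rpow_of_nonneg _ _ (by norm_num), ← ENNReal.rpow_mul, ← ENNReal.rpow_mul] at h'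
  simp only [Pi.mul_apply, mul_one, ENNReal.one_rpow, lintegral_const, Measure.restrict_apply_univ,
    Real.volume_Icc, one_mul] at h'
  norm_num at h'
  rw [mul_comm] at h'
  simpa using h'

/-- One-dimensional Sobolev embedding in time for the free evolution. -/
theorem enorm_integral_exp_le {ε : ℝ} {χ : ℝ → ℂ} (h1 : Integrable χ)
    (h2 : Integrable fun ξ => Complex.I * (phase ε ξ : ℂ) * χ ξ) (x : ℝ) {t : ℝ}
    (ht : t ∈ Set.Icc (-1 : ℝ) 1) :
    ‖∫ ξ, Complex.exp (Complex.I * ((x * ξ + t * phase ε ξ : ℝ) : ℂ)) * χ ξ‖ₑ ≤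
      ‖∫ ξ, Complex.exp (Complex.I * ((x * ξ : ℝ) : ℂ)) * χ ξ‖ₑ +
      ∫⁻ s in Set.Icc (-1 : ℝ) 1, ‖∫ ξ, Complex.exp (Complex.I *
        ((x * ξ + s * phase ε ξ : ℝ) : ℂ)) * (Complex.I * (phase ε ξ : ℂ) * χ ξ)‖ₑ := by
  set F : ℝ → ℂ := fun t =>
    ∫ ξ, Complex.exp (Complex.I * ((x * ξ + t * phase ε ξ : ℝ) : ℂ)) * χ ξ with hF
  set G : ℝ → ℂ := fun s => ∫ ξ, Complex.exp (Complex.I * ((x * ξ + s * phase ε ξ : ℝ) : ℂ)) *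
    (Complex.I * (phase ε ξ : ℂ) * χ ξ) with hG
  have hem : ∀ t : ℝ, AEStronglyMeasurable (fun ξ : ℝ =>
      Complex.exp (Complex.I * ((x * ξ + t * phase ε ξ : ℝ) : ℂ))) volume := by
    intro t
    apply Continuous.aestronglyMeasurable
    simp only [phase]
    fun_prop
  have hd : ∀ t, HasDerivAt F (G t) t := by
    intro t
    refine (hasDerivAt_integral_of_dominated_loc_of_deriv_le (μ := volume)
      (F := fun t ξ => Complex.exp (Complex.I * ((x * ξ + t * phase ε ξ : ℝ) : ℂ)) * χ ξ)
      (F' := fun s ξ => Complex.exp (Complex.I * ((x * ξ + s * phase ε ξ : ℝ) : ℂ)) *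
        (Complex.I * (phase ε ξ : ℂ) * χ ξ))
      (bound := fun ξ => ‖Complex.I * (phase ε ξ : ℂ) * χ ξ‖) (s := Set.univ) Filter.univ_mem
      ?_ ?_ ?_ ?_ h2.norm ?_).2
    · exact Filter.Eventually.of_forall fun t => (hem t).mul h1.aestronglyMeasurable
    · refine h1.mono ((hem t).mul h1.aestronglyMeasurable) (Filter.Eventually.of_forall fun ξ => ?_)
      rw [norm_mul, norm_exp_I_mul_ofReal, one_mul]
    · exact (hem t).mul h2.aestronglyMeasurable
    · refine Filter.Eventually.of_forall fun ξ s _ => ?_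
      rw [norm_mul, norm_exp_I_mul_ofReal, one_mul]
    · refine Filter.Eventually.of_forall fun ξ s _ => ?_
      have h3 : HasDerivAt (fun s : ℝ => x * ξ + s * phase ε ξ) (phase ε ξ) s := by
        simpa using ((hasDerivAt_id s).mul_const (phase ε ξ)).const_add (x * ξ)
      have h4 := ((h3.ofReal_comp.const_mul Complex.I).cexp).mul_const (χ ξ)
      refine h4.congr_deriv ?_
      ring
  have hGc : Continuous G := (continuous_integral_exp_mul h2 ε).comp
    (by fun_prop : Continuous fun s : ℝ => (s, x))
  have hFTC : ∫ s in (0 : ℝ)..t, G s = F t - F 0 :=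
    intervalIntegral.integral_eq_sub_of_hasDerivAt (fun s _ => hd s) (hGc.intervalIntegrable _ _)
  have hF0 : F 0 = ∫ ξ, Complex.exp (Complex.I * ((x * ξ : ℝ) : ℂ)) * χ ξ := by
    simp only [hF, zero_mul, add_zero]
  have hsub : Set.uIoc 0 t ⊆ Set.Icc (-1 : ℝ) 1 := by
    refine Set.uIoc_subset_uIcc.trans (Set.uIcc_subset_Icc ?_ ht)
    constructor <;> norm_num
  have hI : ‖∫ s in (0 : ℝ)..t, G s‖ₑ ≤ ∫⁻ s in Set.Icc (-1 : ℝ) 1, ‖G s‖ₑ := by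
    rw [← ofReal_norm, intervalIntegral.norm_intervalIntegral_eq, ofReal_norm]
    exact (enorm_integral_le_lintegral_enorm _).trans (lintegral_mono_set hsub)
  calc ‖F t‖ₑ = ‖F 0 + ∫ s in (0 : ℝ)..t, G s‖ₑ := by rw [hFTC]; congr 1; ring
    _ ≤ ‖F 0‖ₑ + ‖∫ s in (0 : ℝ)..t, G s‖ₑ := enorm_add_le _ _
    _ ≤ _ := by rw [hF0]; gcongr

/-- The `L²` maximal estimate on the unit time interval, for bounded `phase`. -/
theorem lintegral_maximal_sq_le {ε : ℝ} {χ : ℝ → ℂ} (h1 : Integrable χ) (h2 : MemLp χ 2)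
    {C : ℝ} (hC : ∀ ξ, ‖(phase ε ξ : ℂ) * χ ξ‖ ≤ C * ‖χ ξ‖) {I : Set ℝ} (hI : MeasurableSet I)
    (hIs : I ⊆ Set.Icc (-1 : ℝ) 1) :
    ∫⁻ x, eLpNorm (fun t => ∫ ξ, Complex.exp (Complex.I * ((x * ξ + t * phase ε ξ : ℝ) : ℂ)) * χ ξ)
      ⊤ (volume.restrict I) ^ (2 : ℝ) ≤
      ENNReal.ofReal (2 * Real.pi) * (2 + 8 * ENNReal.ofReal C ^ (2 : ℝ)) *
        ∫⁻ ξ, ‖χ ξ‖ₑ ^ (2 : ℝ) := by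
  set χ' : ℝ → ℂ := fun ξ => Complex.I * (phase ε ξ : ℂ) * χ ξ with hχ'
  have hn : ∀ ξ, ‖χ' ξ‖ ≤ C * ‖χ ξ‖ := fun ξ => by
    simp only [hχ']
    rw [mul_assoc, norm_mul, Complex.norm_I, one_mul]
    exact hC ξ
  have hχ'm : AEStronglyMeasurable χ' volume := by
    refine AEStronglyMeasurable.mul ?_ h1.aestronglyMeasurable
    exact (measurable_const.mul
      (Complex.measurable_ofReal.comp (measurable_phase ε))).aestronglyMeasurable
  have h1' : Integrable χ' := (h1.norm.const_mul C).mono' hχ'm (Filter.Eventually.of_forall hn)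
  have h2' : MemLp χ' 2 := h2.of_le_mul hχ'm (Filter.Eventually.of_forall hn)
  set P := ∫⁻ ξ, ‖χ ξ‖ₑ ^ (2 : ℝ) with hP
  set F0 : ℝ → ℝ≥0∞ := fun x => ‖∫ ξ, Complex.exp (Complex.I * ((x * ξ : ℝ) : ℂ)) * χ ξ‖ₑ with hF0
  set G : ℝ → ℝ → ℝ≥0∞ := fun s x => ‖∫ ξ, Complex.exp (Complex.I *
    ((x * ξ + s * phase ε ξ : ℝ) : ℂ)) * χ' ξ‖ₑ with hG
  have hGm : Measurable (Function.uncurry G) :=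
    (continuous_integral_exp_mul h1' ε).measurable.enorm
  have hF0m : Measurable F0 := by
    have := ((continuous_integral_exp_mul h1 ε).comp
      (by fun_prop : Continuous fun x : ℝ => ((0 : ℝ), x))).measurable.enorm
    simpa only [Function.comp_def, Function.uncurry, zero_mul, add_zero] using this
  -- The final 8 is 2·2·2: one factor from (u + v)² ≤ 2(u² + v²), one from Cauchy-Schwarz on an
  -- interval of length 2, and one from integrating a bound uniform in s over that interval.
  have hpt : ∀ x, eLpNorm (fun t => ∫ ξ, Complex.exp (Complex.I *
      ((x * ξ + t * phase ε ξ : ℝ) : ℂ)) * χ ξ) ⊤ (volume.restrict I) ^ (2 : ℝ) ≤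
      2 * (F0 x ^ (2 : ℝ) + 2 * ∫⁻ s in Set.Icc (-1 : ℝ) 1, G s x ^ (2 : ℝ)) := by
    intro x
    have hle : eLpNorm (fun t => ∫ ξ, Complex.exp (Complex.I *
        ((x * ξ + t * phase ε ξ : ℝ) : ℂ)) * χ ξ) ⊤ (volume.restrict I)
        ≤ F0 x + ∫⁻ s in Set.Icc (-1 : ℝ) 1, G s x := by
      rw [eLpNorm_exponent_top]
      refine eLpNormEssSup_le_of_ae_enorm_bound ((ae_restrict_mem hI).mono fun t ht => ?_)
      exact enorm_integral_exp_le h1 h1' x (hIs ht)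
    refine (ENNReal.rpow_le_rpow hle (by norm_num)).trans ?_
    refine (ENNReal.rpow_add_le_mul_rpow_add_rpow _ _ (by norm_num)).trans ?_
    have hGx : Measurable fun s => G s x := hGm.of_uncurry_right
    rw [show (2 : ℝ) - 1 = 1 by norm_num, ENNReal.rpow_one]
    gcongr
    exact sq_lintegral_Icc_le hGx
  have hGs : ∀ s, ∫⁻ x, G s x ^ (2 : ℝ) ≤
      ENNReal.ofReal (2 * Real.pi) * (ENNReal.ofReal C ^ (2 : ℝ) * P) := by
    intro s
    set k : ℝ → ℂ := fun ξ => Complex.exp (Complex.I * ((s * phase ε ξ : ℝ) : ℂ)) * χ' ξ with hk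
    have hkn : ∀ ξ, ‖k ξ‖ = ‖χ' ξ‖ := fun ξ => by
      rw [hk, norm_mul, norm_exp_I_mul_ofReal, one_mul]
    have hkm : AEStronglyMeasurable k volume := by
      refine AEStronglyMeasurable.mul ?_ hχ'm
      apply Continuous.aestronglyMeasurable
      simp only [phase]
      fun_prop
    have hk1 : Integrable k := h1'.mono hkm (Filter.Eventually.of_forall fun ξ => (hkn ξ).le)
    have hk2 : MemLp k 2 := h2'.mono hkm (Filter.Eventually.of_forall fun ξ => (hkn ξ).le)
    have hGk : ∀ x, G s x = ‖∫ ξ, Complex.exp (Complex.I * ((x * ξ : ℝ) : ℂ)) * k ξ‖ₑ := by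
      intro x
      simp only [hG, hk]
      congr 2
      ext ξ
      rw [Complex.ofReal_add, mul_add, Complex.exp_add, mul_assoc]
    simp only [hGk]
    refine (lintegral_enorm_integral_exp_sq_le hk1 hk2).trans ?_
    gcongr
    rw [hP, ← lintegral_const_mul' _ _
      (ENNReal.rpow_ne_top_of_nonneg (by norm_num) ENNReal.ofReal_ne_top)]
    refine lintegral_mono fun ξ => ?_
    rw [← ENNReal.mul_rpow_of_nonneg _ _ (by norm_num)]
    gcongr
    rw [← ofReal_norm, ← ofReal_norm, ← ENNReal.ofReal_mul' (norm_nonneg _), hkn]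
    exact ENNReal.ofReal_le_ofReal (hn ξ)
  have hGG : ∫⁻ x, ∫⁻ s in Set.Icc (-1 : ℝ) 1, G s x ^ (2 : ℝ) ≤
      2 * (ENNReal.ofReal (2 * Real.pi) * (ENNReal.ofReal C ^ (2 : ℝ) * P)) := by
    rw [lintegral_lintegral_swap (((hGm.comp measurable_swap).pow_const 2).aemeasurable)]
    refine (lintegral_mono fun s => hGs s).trans (le_of_eq ?_)
    rw [setLIntegral_const, Real.volume_Icc, mul_comm]
    norm_num
  have hF00 : ∫⁻ x, F0 x ^ (2 : ℝ) ≤ ENNReal.ofReal (2 * Real.pi) * P :=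
    lintegral_enorm_integral_exp_sq_le h1 h2
  calc _ ≤ ∫⁻ x, 2 * (F0 x ^ (2 : ℝ) + 2 * ∫⁻ s in Set.Icc (-1 : ℝ) 1, G s x ^ (2 : ℝ)) :=
        lintegral_mono hpt
    _ = 2 * ((∫⁻ x, F0 x ^ (2 : ℝ)) +
          2 * ∫⁻ x, ∫⁻ s in Set.Icc (-1 : ℝ) 1, G s x ^ (2 : ℝ)) := by
        rw [lintegral_const_mul' _ _ (by norm_num), lintegral_add_left (hF0m.pow_const 2),
          lintegral_const_mul' _ _ (by norm_num)]
    _ ≤ 2 * (ENNReal.ofReal (2 * Real.pi) * P +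
          2 * (2 * (ENNReal.ofReal (2 * Real.pi) * (ENNReal.ofReal C ^ (2 : ℝ) * P)))) := by
        gcongr
    _ = _ := by ring

/-- The local-in-time maximal function estimate at low frequency. -/
theorem normLxLt_PLow_U_le {ψ : ℝ → ℝ} (hψ : IsCutoff ψ) {M : ℝ} (hM0 : 0 ≤ M)
    (hM : ∀ x, |ψ x| ≤ M) {ε : ℝ} (hε : 0 < ε) (hε1 : ε < 1) {T : ℝ} (hT1 : T ≤ 1)
    (φ : 𝓢(ℝ, ℂ)) :
    normLxLt 2 ⊤ (Set.Icc (-T) T) (fun t => PLow ψ 1 (U ε t φ))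
      ≤ (ENNReal.ofReal (2 * Real.pi) * (2 + 8 * ENNReal.ofReal 270 ^ (2 : ℝ))) ^ (1 / 2 : ℝ) *
        ENNReal.ofReal M * eLpNorm φ 2 volume := by
  set m : ℝ → ℂ := fun ξ => (ψ (ξ / 2 ^ 1) : ℂ) with hm
  have hmm : Measurable m := by
    have := hψ.smooth.continuous.measurable
    simp only [hm]
    fun_prop
  have hmn : ∀ ξ, ‖m ξ‖ ≤ M := fun ξ => by
    rw [hm, Complex.norm_real, Real.norm_eq_abs]
    exact hM _
  set χ : ℝ → ℂ := fun ξ => m ξ * angularFourier φ ξ with hχ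
  have h1 : Integrable χ := by
    refine integrable_mul_angularFourier hmm (C := M) (fun ξ => (hmn ξ).trans ?_) φ
    nlinarith [abs_nonneg ξ]
  have hχb : ∀ ξ, ‖χ ξ‖ₑ ≤ ENNReal.ofReal M * ‖angularFourier φ ξ‖ₑ := fun ξ => by
    rw [hχ, enorm_mul]
    gcongr
    rw [← ofReal_norm]
    exact ENNReal.ofReal_le_ofReal (hmn ξ)
  have hχP : (∫⁻ ξ, ‖χ ξ‖ₑ ^ (2 : ℝ)) ^ (1 / 2 : ℝ) ≤ ENNReal.ofReal M * eLpNorm φ 2 volume := by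
    refine le_trans ?_ (lintegral_const_mul_enorm_angularFourier_sq_le _ φ)
    gcongr
    exact hχb _
  have h2 : MemLp χ 2 := by
    refine ⟨h1.aestronglyMeasurable, ?_⟩
    rw [eLpNorm_two_eq_lintegral]
    exact hχP.trans_lt (ENNReal.mul_lt_top ENNReal.ofReal_lt_top (φ.memLp 2 volume).2)
  -- ψ(ξ/2) vanishes for |ξ| > 3, and for |ξ| ≤ 3 with ε < 1 the phase is at most 3³ + 3⁵ = 270.
  have hC : ∀ ξ, ‖(phase ε ξ : ℂ) * χ ξ‖ ≤ 270 * ‖χ ξ‖ := by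
    intro ξ
    rw [norm_mul, Complex.norm_real, Real.norm_eq_abs]
    by_cases hξ : |ξ| ≤ 3
    · gcongr
      rw [phase]
      have e3 : |ξ| ^ 3 ≤ 3 ^ 3 := by gcongr
      have e5 : |ξ| ^ 5 ≤ 3 ^ 5 := by gcongr
      calc |ξ ^ 3 - ε * ξ ^ 5| ≤ |ξ ^ 3| + |ε * ξ ^ 5| := abs_sub _ _
        _ = |ξ| ^ 3 + ε * |ξ| ^ 5 := by rw [abs_mul, abs_pow, abs_pow, abs_of_pos hε]
        _ ≤ 3 ^ 3 + 1 * 3 ^ 5 := by gcongr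
        _ = 270 := by norm_num
    · have : χ ξ = 0 := by
        simp only [hχ, hm]
        rw [hψ.eq_zero, Complex.ofReal_zero, zero_mul]
        rw [abs_div, pow_one, abs_of_pos (by norm_num : (0 : ℝ) < 2)]
        linarith
      rw [this, norm_zero, mul_zero, mul_zero]
  have hform : ∀ t x, PLow ψ 1 (U ε t φ) x = ∫ ξ, Complex.exp (Complex.I *
      ((x * ξ + t * phase ε ξ : ℝ) : ℂ)) * χ ξ := by
    intro t x
    rw [PLow, U, fourierMul_fourierMul (hasTemperateGrowth_exp_phase ε t),
      fourierMul_eq_integral_angularFourier]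
    refine integral_congr_ae (Filter.Eventually.of_forall fun ξ => ?_)
    simp only [hχ, hm]
    rw [Complex.ofReal_add, mul_add, Complex.exp_add]
    ring
  rw [normLxLt, eLpNorm_eq_lintegral_rpow_enorm_toReal (by norm_num) (by norm_num)]
  simp only [enorm_eq_self, ENNReal.toReal_ofNat, hform]
  have hmax := lintegral_maximal_sq_le h1 h2 hC (measurableSet_Icc (a := -T) (b := T))
    (Set.Icc_subset_Icc (neg_le_neg hT1) hT1)
  refine (ENNReal.rpow_le_rpow hmax (by norm_num)).trans ?_
  rw [ENNReal.mul_rpow_of_nonneg _ _ (by norm_num), mul_assoc _ (ENNReal.ofReal M)]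
  gcongr

end Kawahara

theorem lemma2p1 (ψ : ℝ → ℝ) (hψ : Kawahara.IsCutoff ψ) :
    ∃ ε₀ : ℝ, 0 < ε₀ ∧ ∃ C : ℝ≥0, ∀ ε : ℝ, 0 < ε → ε < ε₀ → ∀ T : ℝ, 0 < T → T ≤ 1 →
      ∀ φ : 𝓢(ℝ, ℂ),
        Kawahara.normLxLt ∞ 2 Set.univ
            (fun t => Kawahara.PA ψ ε (deriv (Kawahara.U ε t φ))) ≤ C * eLpNorm φ 2 volume ∧
        Kawahara.normLtLx 4 ∞ Set.univ
            (fun t => Kawahara.D (1 / 4) (Kawahara.PB ψ ε (Kawahara.U ε t φ)))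
          ≤ C * eLpNorm φ 2 volume ∧
        Kawahara.normLxLt 2 ∞ (Set.Icc (-T) T)
            (fun t => Kawahara.PLow ψ 1 (Kawahara.U ε t φ)) ≤ C * eLpNorm φ 2 volume := by
  obtain ⟨M, hM0, hM⟩ := hψ.exists_bound
  set C₁ : ℝ≥0∞ := ENNReal.ofReal (8 * Real.pi) ^ (1 / 2 : ℝ) * ENNReal.ofReal (4 * M) with hC₁
  set C₂ : ℝ≥0∞ := 2520 ^ (1 / 2 : ℝ) * ENNReal.ofReal M with hC₂
  set C₃ : ℝ≥0∞ := (ENNReal.ofReal (2 * Real.pi) *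
    (2 + 8 * ENNReal.ofReal 270 ^ (2 : ℝ))) ^ (1 / 2 : ℝ) * ENNReal.ofReal M with hC₃
  have h₁ : C₁ ≠ ⊤ := ENNReal.mul_ne_top
    (ENNReal.rpow_ne_top_of_nonneg (by norm_num) ENNReal.ofReal_ne_top) ENNReal.ofReal_ne_top
  have h₂ : C₂ ≠ ⊤ := ENNReal.mul_ne_top
    (ENNReal.rpow_ne_top_of_nonneg (by norm_num) (by norm_num)) ENNReal.ofReal_ne_top
  have h₃ : C₃ ≠ ⊤ := by
    refine ENNReal.mul_ne_top (ENNReal.rpow_ne_top_of_nonneg (by norm_num)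
      (ENNReal.mul_ne_top ENNReal.ofReal_ne_top (ENNReal.add_ne_top.2 ⟨by norm_num,
        ENNReal.mul_ne_top (by norm_num)
          (ENNReal.rpow_ne_top_of_nonneg (by norm_num) ENNReal.ofReal_ne_top)⟩)))
      ENNReal.ofReal_ne_top
  -- Only the maximal estimate restricts ε; the other two hold for every ε > 0 by scaling.
  refine ⟨1, one_pos, (C₁ + C₂ + C₃).toNNReal, fun ε hε hε1 T _ hT1 φ => ?_⟩
  rw [ENNReal.coe_toNNReal (ENNReal.add_ne_top.2 ⟨ENNReal.add_ne_top.2 ⟨h₁, h₂⟩, h₃⟩)]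
  refine ⟨?_, ?_, ?_⟩
  · refine (Kawahara.normLxLt_PA_deriv_U_le hψ hM0 (fun x => (hM x).2) hε φ).trans ?_
    gcongr
    exact le_self_add.trans le_self_add
  · refine (Kawahara.normLtLx_D_PB_U_le hψ hM0 (fun x => (hM x).2) hε φ).trans ?_
    gcongr
    exact le_add_self.trans le_self_add
  · refine (Kawahara.normLxLt_PLow_U_le hψ hM0 (fun x => (hM x).1) hε hε1 hT1 φ).trans ?_
    gcongr
    exact le_add_self
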